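/- **Setting.** Let $\Omega=\mathbb T^2\times(-1,1)$ with $\mathbb T=\mathbb R/2\pi\mathbb Z$, let $\Gamma=\mathbb T^2\times\{\pm1\}$ with outward unit normal $\nu$, let $\mathbb D\mathbf v=\frac12(\nabla\mathbf v+\nabla^{\top}\mathbf v)$, and let $\beta>0$. Set $$H=\{\mathbf v\in L^2(\Omega)^3:\ \nabla\cdot\mathbf v=0,\ \mathbf v\cdot\nu=0\text{ on }\Gamma\},\qquad V_{\mathcal P}=H\cap H^1(\Omega)^3 .$$ Consider the Navier–Stokes problem $$\mathbf v_t-\Delta\mathbf v+(\mathbf v\cdot\nabla)\mathbf v+\nabla q=\mathbf 0,\quad \nabla\cdot\mathbf v=0\ \text{ in }\Omega\times(0,T),\qquad \mathbf v\cdot\nu=0,\quad 2(\mathbb D\mathbf v\,\nu)\cdot\tau+\beta\,\mathbf v\cdot\tau=0\ \text{ on }\Gamma\times(0,T)$$ for all tangential $\tau$, with $\mathbf v(0)=\mathbf v_0$. A *Leray–Hopf solution* on $[0,T)$ is a $\mathbf v\in L^\infty(0,T;H)\cap L^2(0,T;V_{\mathcal P})$ such that, for all $\boldsymbol\varphi\in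 V_{\mathcal P}$ and $\theta\in C_0^\infty[0,T)$, $$\int_0^T(\mathbf v,\boldsymbol\varphi)\,\theta'\,dt+(\mathbf v_0,\boldsymbol\varphi)\,\theta(0)=\int_0^T\Big\{2(\mathbb D\mathbf v,\mathbb D\boldsymbol\varphi)+\beta\int_\Gamma\mathbf v_\tau\cdot\boldsymbol\varphi_\tau+((\mathbf v\cdot\nabla)\mathbf v,\boldsymbol\varphi)\Big\}\theta\,dt ,$$ and for almost every $t\in(0,T)$ $$\tfrac12\|\mathbf v(t)\|_{L^2(\Omega)}^2+\int_0^t2\|\mathbb D\mathbf v\|_{L^2(\Omega)}^2\,ds+\beta\int_0^t\|\mathbf v_\tau\|_{L^2(\Gamma)}^2\,ds\le\tfrac12\|\mathbf v_0\|_{L^2(\Omega)}^2 .$$ Here $(\cdot,\cdot)$ is the $L^2(\Omega)$ scalar product and $\mathbf v_\tau$ is the tangential part of the trace of $\mathbf v$ on $\Gamma$. A *pressure* for $\mathbf v$ is a $q\in L^1_{loc}(\Omega\times(0,T))$ for which the momentum equation holds in the sense of distributions in $\Omega\times(0,T)$. For $n\in\mathbb N_+$ and $p\in\mathbb N$ let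 $\lambda_{0,n,p}$ be the unique $\lambda\in\big(n^2+\frac{\pi^2}4p^2,\ n^2+\frac{\pi^2}4(1+p)^2\big)$ with $$\cot\sqrt{\lambda-n^2}=\frac{\sqrt{\lambda-n^2}}\beta\ \ (p\text{ even}),\qquad \tan\sqrt{\lambda-n^2}=-\frac{\sqrt{\lambda-n^2}}\beta\ \ (p\text{ odd}).$$ With $\lambda=\lambda_{0,n,p}$, let $\mathcal Z_{0,n,p}(z)=\cos(\sqrt{\lambda-n^2}\,z)$ for $p$ even and $\mathcal Z_{0,n,p}(z)=\sin(\sqrt{\lambda-n^2}\,z)$ for $p$ odd, and let $$\mathbf u_{0,n,p}(y,z)=\big(\mathcal Z_{0,n,p}(z)\,[a\sin(ny)+d\cos(ny)],\,0,\,0\big),$$ where $a,d\in\mathbb R$ are such that $\|\mathbf u_{0,n,p}\|_{L^2(\Omega)}=1$. **Proposition 3.9.** Let $n_k\in\mathbb N_+$ and $p_k\in\mathbb N$ for $k\ge1$, let $\mathbf u_{0,n_k,p_k}$ be eigenfunctions as above (the coefficients $a,d$ may depend on $k$), and let $\lambda_k=\lambda_{0,n_k,p_k}$. Let $\gamma_k\in\mathbb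 R$ with $\sum_{k=1}^\infty\lambda_k\gamma_k^2<\infty$, and let $\mathbf v_0=\sum_{k=1}^\infty\gamma_k\mathbf u_{0,n_k,p_k}\in V_{\mathcal P}$, the series converging in $L^2(\Omega)$. Then the following hold. 1. There is a $\mathbf v\in L^\infty(\mathbb R^+;V_{\mathcal P})$ given by $$\mathbf v(t,y,z)=\sum_{k=1}^\infty\gamma_k\,e^{-\lambda_kt}\,\mathbf u_{0,n_k,p_k}(y,z),$$ where the series converges in $L^2(\Omega)$ for every $t\ge0$ and in $V_{\mathcal P}$ for every $t>0$. 2. The nonlinearity vanishes: $(\mathbf v\cdot\nabla)\mathbf v=\mathbf 0$ for every $t\ge0$. For every $T>0$, $\mathbf v$ is a Leray–Hopf solution on $[0,T)$ with initial datum $\mathbf v_0$, and every constant $q=Q_0\in\mathbb R$ is a pressure for it. 3. The solution is unique: for every $T>0$, every Leray–Hopf solution on $[0,T)$ with initial datum $\mathbf v_0$ coincides with $\mathbf v$ almost everywhere in $\Omega\times(0,T)$, and each pressure for it is, for almost every $t\in(0,T)$, constant in space. -/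

import Mathlib

open MeasureTheory Filter Topology
open scoped ContDiff

namespace NSChannel

noncomputable section

/-- Points `(x, y, z)`.  The domain is `Ω = 𝕋² × (-1, 1)` with `𝕋 = ℝ / 2πℤ`. -/
abbrev Pt := ℝ × ℝ × ℝ

/-- Vector fields `(u, v, w)`, given by their components.  Only the values on the periodicity
cell `(0, 2π)² × (-1, 1)` matter, and these only almost everywhere: a function on `Ω` is the
same as a function on the cell, and the periodic identification of opposite faces enters
through the periodic test functions. -/
abbrev Field := Fin 3 → Pt → ℝ

/-- Matrix fields; `G i j` stands for `∂ⱼ uᵢ`. -/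
abbrev MField := Fin 3 → Fin 3 → Pt → ℝ

/-- Vector fields on `Γ = 𝕋² × {±1}`; the index `true` is the face `z = 1`, the index `false`
is the face `z = -1`. -/
abbrev BField := Bool → Fin 3 → ℝ × ℝ → ℝ

/-- Periodicity cell of `𝕋²`. -/
def square : Set (ℝ × ℝ) := Set.Ioo 0 (2 * Real.pi) ×ˢ Set.Ioo 0 (2 * Real.pi)

/-- Periodicity cell of `Ω`. -/
def cell : Set Pt :=
  Set.Ioo 0 (2 * Real.pi) ×ˢ Set.Ioo 0 (2 * Real.pi) ×ˢ Set.Ioo (-1 : ℝ) 1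

/-- Lebesgue measure on `Ω`. -/
def volΩ : Measure Pt := volume.restrict cell

/-- Surface measure on either face of `Γ`. -/
def volΓ : Measure (ℝ × ℝ) := volume.restrict square

/-- Lebesgue measure on the time interval `(0, T)`. -/
def volT (T : ℝ) : Measure ℝ := volume.restrict (Set.Ioo 0 T)

/-- The coordinate directions. -/
def dir : Fin 3 → Pt := ![(1, 0, 0), (0, 1, 0), (0, 0, 1)]

/-- The classical partial derivative `∂ᵢ f`. -/
def pd (i : Fin 3) (f : Pt → ℝ) (p : Pt) : ℝ := fderiv ℝ f p (dir i)

/-- `2π`-periodic in `x` and in `y`. -/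
def Periodic (f : Pt → ℝ) : Prop :=
  ∀ x y z : ℝ, f (x + 2 * Real.pi, y, z) = f (x, y, z) ∧ f (x, y + 2 * Real.pi, z) = f (x, y, z)

/-- Test functions that are smooth up to the boundary of `Ω`. -/
def IsTest (φ : Pt → ℝ) : Prop := ContDiff ℝ ∞ φ ∧ Periodic φ

/-- Test functions with compact support in `Ω`: the class `C₀^∞(Ω)`. -/
def IsInteriorTest (φ : Pt → ℝ) : Prop :=
  IsTest φ ∧ ∃ δ < (1 : ℝ), ∀ x y z : ℝ, δ ≤ |z| → φ (x, y, z) = 0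

/-- `g` is the weak derivative `∂ᵢ f` in `Ω`. -/
def HasWeakPD (i : Fin 3) (f g : Pt → ℝ) : Prop :=
  ∀ φ, IsInteriorTest φ → ∫ p, f p * pd i φ p ∂volΩ = - ∫ p, g p * φ p ∂volΩ

/-- `u ∈ H¹(Ω)` (hence periodic) with weak gradient `G i j = ∂ⱼ uᵢ`. -/
def IsH1 (u : Field) (G : MField) : Prop :=
  (∀ i, MemLp (u i) 2 volΩ) ∧ (∀ i j, MemLp (G i j) 2 volΩ) ∧
    ∀ i j, HasWeakPD j (u i) (G i j)

/-- `u ∈ H`: square integrable, divergence free in the sense of distributions and with vanishing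
normal trace on `Γ`; both conditions are expressed by Green's formula, with test functions that
need not vanish on `Γ`. -/
def IsH (u : Field) : Prop :=
  (∀ i, MemLp (u i) 2 volΩ) ∧ ∀ φ, IsTest φ → ∑ i, ∫ p, u i p * pd i φ p ∂volΩ = 0

/-- `τ` is the trace on `Γ` of the `H¹` field `u` with weak gradient `G`, expressed by Green's
formula in the direction `z`, which determines `τ` almost everywhere on `Γ`. -/
def HasTrace (u : Field) (G : MField) (τ : BField) : Prop :=
  (∀ b i, MemLp (τ b i) 2 volΓ) ∧
  ∀ i, ∀ φ, IsTest φ →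
    ∫ p, (u i p * pd 2 φ p + G i 2 p * φ p) ∂volΩ =
      ∫ s, (τ true i s * φ (s.1, s.2, 1) - τ false i s * φ (s.1, s.2, -1)) ∂volΓ

/-- `u` belongs to `V_P = H¹(Ω) ∩ H`, has weak gradient `G` and trace `τ`. -/
def IsVP (u : Field) (G : MField) (τ : BField) : Prop :=
  IsH u ∧ IsH1 u G ∧ HasTrace u G τ

/-- `u ∈ V_P`. -/
def MemVP (u : Field) : Prop := ∃ G τ, IsVP u G τ

/-- `(u, φ) = ∫_Ω u · φ`. -/
def ip (u φ : Field) : ℝ := ∫ p, ∑ i, u i p * φ i p ∂volΩ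

/-- `(G, Φ) = ∫_Ω G : Φ`. -/
def ipM (G Φ : MField) : ℝ := ∫ p, ∑ i, ∑ j, G i j p * Φ i j p ∂volΩ

/-- The strain tensor `(∇u + ∇ᵀu) / 2`. -/
def strain (G : MField) : MField := fun i j p => (G i j p + G j i p) / 2

/-- `∫_Γ u_τ · φ_τ`, in terms of the traces; the tangential components are the first two. -/
def ipΓ (τ σ : BField) : ℝ :=
  ∑ b, ∫ s, (τ b 0 s * σ b 0 s + τ b 1 s * σ b 1 s) ∂volΓ

/-- The convective term `(u · ∇)u`. -/
def conv (u : Field) (G : MField) : Field := fun i p => ∑ j, u j p * G i j p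

/-- The square of the norm of `V_P`, that is of `H¹(Ω)`. -/
def normSqVP (u : Field) (G : MField) : ℝ := ip u u + ipM G G

/-- `v` is a Leray-Hopf weak solution on the time interval `[0, T)` of the unforced Navier-Stokes
equations `v_t - Δv + (v·∇)v + ∇q = 0`, `∇·v = 0` in `Ω`, with the boundary conditions
`v·ν = 0` and `2(𝔻v·ν)·τ + β v·τ = 0` on `Γ` and with initial datum `v₀`;
`G t` and `τ t` are the gradient and the trace of `v t`. -/
structure IsLerayHopf (β T : ℝ) (v₀ : Field) (v : ℝ → Field) (G : ℝ → MField)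
    (τ : ℝ → BField) : Prop where
  /-- `v t ∈ V_P` for almost every `t`. -/
  memVP : ∀ᵐ t ∂volT T, IsVP (v t) (G t) (τ t)
  /-- `v ∈ L²(0, T; V_P)`. -/
  memLp : ∀ i, MemLp (fun P : ℝ × Pt => v P.1 i P.2) 2 ((volT T).prod volΩ)
  memLp_grad : ∀ i j, MemLp (fun P : ℝ × Pt => G P.1 i j P.2) 2 ((volT T).prod volΩ)
  memLp_trace : ∀ b i, MemLp (fun P : ℝ × (ℝ × ℝ) => τ P.1 b i P.2) 2 ((volT T).prod volΓ)
  /-- `v ∈ L^∞(0, T; H)`. -/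
  bounded : ∃ C : ℝ, ∀ᵐ t ∂volT T, ip (v t) (v t) ≤ C
  /-- The weak formulation, for `φ ∈ V_P` and `θ ∈ C₀^∞[0, T)`. -/
  weak : ∀ (φ : Field) (Φ : MField) (σ : BField), IsVP φ Φ σ →
    ∀ θ : ℝ → ℝ, ContDiff ℝ ∞ θ → (∃ T' < T, ∀ t, T' ≤ t → θ t = 0) →
      (∫ t, ip (v t) φ * deriv θ t ∂volT T) + ip v₀ φ * θ 0 =
        ∫ t, (2 * ipM (strain (G t)) (strain Φ) + β * ipΓ (τ t) σ
          + ip (conv (v t) (G t)) φ) * θ t ∂volT T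
  /-- The energy inequality. -/
  energy : ∀ᵐ t ∂volT T,
    1 / 2 * ip (v t) (v t)
      + (∫ s in Set.Ioo 0 t, 2 * ipM (strain (G s)) (strain (G s)))
      + β * (∫ s in Set.Ioo 0 t, ipΓ (τ s) (τ s)) ≤ 1 / 2 * ip v₀ v₀

/-- `q` is a pressure for the velocity `v` with gradient `G`: it is locally integrable in
`Ω × (0, T)` and the momentum equation `v_t - Δv + (v·∇)v + ∇q = 0` holds there in the sense of
distributions. -/
def IsPressure (T : ℝ) (v : ℝ → Field) (G : ℝ → MField) (q : ℝ → Pt → ℝ) : Prop :=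
  (∀ a b δ : ℝ, 0 < a → b < T → δ < 1 →
    IntegrableOn (fun P : ℝ × Pt => q P.1 P.2)
      (Set.Ioo a b ×ˢ (cell ∩ {p | |p.2.2| < δ}))) ∧
  ∀ ψ : ℝ × Pt → ℝ, ContDiff ℝ ∞ ψ → (∀ t, Periodic fun p => ψ (t, p)) →
    (∃ a b δ : ℝ, 0 < a ∧ b < T ∧ δ < 1 ∧
      ∀ t x y z : ℝ, (t ≤ a ∨ b ≤ t ∨ δ ≤ |z|) → ψ (t, x, y, z) = 0) →
    ∀ i, ∫ P : ℝ × Pt,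
      (v P.1 i P.2 * fderiv ℝ ψ P (1, 0)
        - (∑ j, G P.1 i j P.2 * pd j (fun p => ψ (P.1, p)) P.2)
        - conv (v P.1) (G P.1) i P.2 * ψ P
        + q P.1 P.2 * pd i (fun p => ψ (P.1, p)) P.2) ∂((volT T).prod volΩ) = 0

/-- `μ² = m² + n²`. -/
def muSq (m n : ℕ) : ℝ := (m : ℝ) ^ 2 + (n : ℝ) ^ 2

/-- `lam` is the eigenvalue `λ_{m,n,p}(β)` of the Stokes operator with constant pressure: the
solution in the indicated interval of `cot s = s / β` (`p` even) or `tan s = - s / β` (`p` odd),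
where `s = √(λ - μ²)`. -/
def IsStokesEigenvalue (β : ℝ) (m n p : ℕ) (lam : ℝ) : Prop :=
  lam ∈ Set.Ioo (muSq m n + Real.pi ^ 2 / 4 * (p : ℝ) ^ 2)
      (muSq m n + Real.pi ^ 2 / 4 * (1 + (p : ℝ)) ^ 2) ∧
  if Even p then Real.cot (Real.sqrt (lam - muSq m n)) = Real.sqrt (lam - muSq m n) / β
  else Real.tan (Real.sqrt (lam - muSq m n)) = - Real.sqrt (lam - muSq m n) / β

/-- The profile `𝒵_{m,n,p}(z)`. -/
def profileZ (m n p : ℕ) (lam z : ℝ) : ℝ :=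
  if Even p then Real.cos (Real.sqrt (lam - muSq m n) * z)
  else Real.sin (Real.sqrt (lam - muSq m n) * z)

/-- `𝒫^u_{m,n}(x, y)`. -/
def periodicU (m n : ℕ) (a b c d x y : ℝ) : ℝ :=
  a * Real.cos (m * x) * Real.sin (n * y) - b * Real.sin (m * x) * Real.sin (n * y)
    - c * Real.sin (m * x) * Real.cos (n * y) + d * Real.cos (m * x) * Real.cos (n * y)

/-- `𝒫^v_{m,n}(x, y)`. -/
def periodicV (m n : ℕ) (a b c d x y : ℝ) : ℝ :=
  a * Real.sin (m * x) * Real.cos (n * y) + b * Real.cos (m * x) * Real.cos (n * y)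
    - c * Real.cos (m * x) * Real.sin (n * y) - d * Real.sin (m * x) * Real.sin (n * y)

/-- The eigenfunction
`u_{m,n,p} = 𝒵_{m,n,p}(z) (𝒫^u_{m,n}(x, y), -(m/n) 𝒫^v_{m,n}(x, y), 0)`, for `1 ≤ n`. -/
def eigenfunction (m n p : ℕ) (lam a b c d : ℝ) : Field :=
  ![fun P => profileZ m n p lam P.2.2 * periodicU m n a b c d P.1 P.2.1,
    fun P => profileZ m n p lam P.2.2 * (-((m : ℝ) / n) * periodicV m n a b c d P.1 P.2.1),
    fun _ => 0]

/-- `∑_{k < N} γ_k exp(-λ_k t) u_k`. -/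
def partialSum (γ lam : ℕ → ℝ) (u : ℕ → Field) (N : ℕ) (t : ℝ) : Field :=
  fun i p => ∑ k ∈ Finset.range N, γ k * Real.exp (-lam k * t) * u k i p

/-- The classical gradient. -/
def grad (u : Field) : MField := fun i j => pd j (u i)

end

end NSChannel

namespace NSChannel

/-! ### Calculus on the periodicity cell -/

/-! The eigenfunctions have the form `(f(y,z), 0, 0)`: they point in the direction `x` and do not
depend on `x`. For sums of such fields `(v·∇)v` vanishes, and the problem reduces to a heat equation
for `f` with the Robin conditions `∂_z f = ∓β f` at `z = ±1`. Each distinct pair `(n, p)` together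
with the choice of sine or cosine in `y` gives one normalized mode. These modes are orthonormal and
satisfy `∑ Λ⁻² < ∞` (`modeFamily_stokesMode`); the analysis uses only the abstract properties
collected in `ModeFamily`.

The link to the Navier–Stokes problem is Green's formula `IsRobin.form_eq`: the Stokes form of a
mode against any `H¹` field with trace is `Λ` times a Fourier coefficient of the first component of
that field. It yields Bessel's inequality for the energy (`ModeFamily.bessel_form`), so `v₀ ∈ V_P`
gives a bound `B` on the sums `∑ Λ c²`.

Existence: for `t > 0` the exponentials make the series and its first derivatives converge
absolutely and uniformly, and every identity is summed mode by mode. Since `v₀` lies in the closed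
span of the modes, Parseval's identity holds for it, and the energy inequality is an equality
(`ModeFamily.isLerayHopf`).

Uniqueness is a weak-strong argument. A Leray–Hopf solution `w` is compared with a finite partial
sum `v_F = (f, 0, 0)` of the series. Put `z = w - v_F`, with strain `S`. The crux is
`IsRobin.ip_conv_le`: the term `((w·∇)w, v_F)` equals `2 ∫ ∑ⱼ zⱼ S₀ⱼ f`. Indeed `∂ⱼz₀ = 2 S₀ⱼ -
∂ₓzⱼ`, the part `∑ zⱼ ∂ₓzⱼ f = ½ ∂ₓ|z|² f` integrates to zero because `f` does not depend on `x`,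
and the other terms vanish by the divergence condition or by integration in `x`. Young's inequality
gives `2‖S‖² + ½ M² ‖z‖²` with `M` a bound for `|f|`; the first term is absorbed exactly by the
dissipation, without Korn or Sobolev inequalities. The choice `M² = B ∑ exp(-2Λt)/Λ` has a time
integral bounded independently of `F`. Gronwall's inequality (`ae_le_of_gronwall`) then bounds `‖w -
v_F‖²` by a constant times `‖v₀‖² - ∑_F c²`, which tends to zero as `F` exhausts the modes.

Pressure: the series solves the momentum equation with zero pressure, so any pressure of a solution
that agrees with it has vanishing spatial gradient. Splitting each factor of a product test function
into a mean part and a derivative shows that such a function depends on time only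
(`ae_eq_of_derivatives_eq_zero`). -/

theorem volΩ_eq : volΩ = (volume.restrict (Set.Ioo 0 (2 * Real.pi))).prod
    ((volume.restrict (Set.Ioo 0 (2 * Real.pi))).prod (volume.restrict (Set.Ioo (-1 : ℝ) 1))) := by
  simp only [volΩ, cell, Measure.prod_restrict]
  rfl

theorem volΓ_eq : volΓ = (volume.restrict (Set.Ioo 0 (2 * Real.pi))).prod
    (volume.restrict (Set.Ioo 0 (2 * Real.pi))) := by
  simp only [volΓ, square, Measure.prod_restrict]
  rfl

instance : IsFiniteMeasure volΩ := by rw [volΩ_eq]; infer_instance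

instance : IsFiniteMeasure volΓ := by rw [volΓ_eq]; infer_instance

instance (T : ℝ) : IsFiniteMeasure (volT T) := by unfold volT; infer_instance

theorem measurableSet_cell : MeasurableSet cell :=
  measurableSet_Ioo.prod (measurableSet_Ioo.prod measurableSet_Ioo)

theorem measurableSet_square : MeasurableSet square := measurableSet_Ioo.prod measurableSet_Ioo

/-- The closed periodicity cell. -/
def closedCell : Set Pt :=
  Set.Icc 0 (2 * Real.pi) ×ˢ Set.Icc 0 (2 * Real.pi) ×ˢ Set.Icc (-1 : ℝ) 1

theorem isCompact_closedCell : IsCompact closedCell :=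
  isCompact_Icc.prod (isCompact_Icc.prod isCompact_Icc)

theorem cell_subset_closedCell : cell ⊆ closedCell :=
  Set.prod_mono Set.Ioo_subset_Icc_self
    (Set.prod_mono Set.Ioo_subset_Icc_self Set.Ioo_subset_Icc_self)

theorem ae_mem_cell : ∀ᵐ p ∂volΩ, p ∈ cell := ae_restrict_mem measurableSet_cell

theorem exists_bound_cell {f : Pt → ℝ} (hf : Continuous f) :
    ∃ C, 0 ≤ C ∧ ∀ p ∈ closedCell, |f p| ≤ C := by
  obtain ⟨C, hC⟩ := isCompact_closedCell.exists_bound_of_continuousOn hf.continuousOn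
  exact ⟨max C 0, le_max_right _ _, fun p hp => (hC p hp).trans (le_max_left _ _)⟩

theorem exists_ae_bound {f : Pt → ℝ} (hf : Continuous f) :
    ∃ C, 0 ≤ C ∧ ∀ᵐ p ∂volΩ, |f p| ≤ C := by
  obtain ⟨C, h0, hC⟩ := exists_bound_cell hf
  exact ⟨C, h0, ae_mem_cell.mono fun p hp => hC p (cell_subset_closedCell hp)⟩

theorem memLp_of_continuous {f : Pt → ℝ} (hf : Continuous f) {q : ENNReal} :
    MemLp f q volΩ := by
  obtain ⟨C, -, hC⟩ := exists_ae_bound hf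
  exact MemLp.of_bound hf.aestronglyMeasurable C hC

theorem integrable_of_continuous {f : Pt → ℝ} (hf : Continuous f) : Integrable f volΩ :=
  memLp_one_iff_integrable.1 (memLp_of_continuous hf)

theorem memLp_of_continuous_square {f : ℝ × ℝ → ℝ} (hf : Continuous f) {q : ENNReal} :
    MemLp f q volΓ := by
  have hK : IsCompact (Set.Icc 0 (2 * Real.pi) ×ˢ Set.Icc 0 (2 * Real.pi) : Set (ℝ × ℝ)) :=
    isCompact_Icc.prod isCompact_Icc
  obtain ⟨C, hC⟩ := hK.exists_bound_of_continuousOn hf.continuousOn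
  refine MemLp.of_bound hf.aestronglyMeasurable C ?_
  filter_upwards [ae_restrict_mem (μ := volume) measurableSet_square] with s hs
  exact hC s ⟨Set.Ioo_subset_Icc_self hs.1, Set.Ioo_subset_Icc_self hs.2⟩

theorem integrable_of_continuous_square {f : ℝ × ℝ → ℝ} (hf : Continuous f) :
    Integrable f volΓ :=
  memLp_one_iff_integrable.1 (memLp_of_continuous_square hf)

theorem hasDerivAt_fst {F : Pt → ℝ} (hF : Differentiable ℝ F) (x y z : ℝ) :
    HasDerivAt (fun x => F (x, y, z)) (pd 0 F (x, y, z)) x := by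
  have h : HasDerivAt (fun x : ℝ => ((x, y, z) : Pt)) ((1, 0, 0) : Pt) x :=
    (hasDerivAt_id x).prodMk (hasDerivAt_const x (y, z))
  exact (hF (x, y, z)).hasFDerivAt.comp_hasDerivAt x h

theorem hasDerivAt_snd {F : Pt → ℝ} (hF : Differentiable ℝ F) (x y z : ℝ) :
    HasDerivAt (fun y => F (x, y, z)) (pd 1 F (x, y, z)) y := by
  have h : HasDerivAt (fun y : ℝ => ((x, y, z) : Pt)) ((0, 1, 0) : Pt) y :=
    (hasDerivAt_const y x).prodMk ((hasDerivAt_id y).prodMk (hasDerivAt_const y z))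
  exact (hF (x, y, z)).hasFDerivAt.comp_hasDerivAt y h

theorem hasDerivAt_trd {F : Pt → ℝ} (hF : Differentiable ℝ F) (x y z : ℝ) :
    HasDerivAt (fun z => F (x, y, z)) (pd 2 F (x, y, z)) z := by
  have h : HasDerivAt (fun z : ℝ => ((x, y, z) : Pt)) ((0, 0, 1) : Pt) z :=
    (hasDerivAt_const z x).prodMk ((hasDerivAt_const z y).prodMk (hasDerivAt_id z))
  exact (hF (x, y, z)).hasFDerivAt.comp_hasDerivAt z h

theorem continuous_pd {F : Pt → ℝ} (hF : ContDiff ℝ 1 F) (i : Fin 3) : Continuous (pd i F) :=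
  (hF.continuous_fderiv one_ne_zero).clm_apply continuous_const

theorem contDiff_pd {F : Pt → ℝ} (hF : ContDiff ℝ ∞ F) (i : Fin 3) : ContDiff ℝ ∞ (pd i F) :=
  (hF.fderiv_right (m := ∞) le_rfl).clm_apply contDiff_const

theorem Periodic.pd {F : Pt → ℝ} (hF : Periodic F) (i : Fin 3) : Periodic (pd i F) := by
  intro x y z
  constructor
  · have h : (fun p : Pt => F (p + (2 * Real.pi, 0, 0))) = F := by
      ext ⟨x, y, z⟩; simpa using (hF x y z).1
    have := fderiv_comp_add_right (𝕜 := ℝ) (f := F) (x := (x, y, z)) (2 * Real.pi, 0, 0)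
    rw [h] at this
    simp only [NSChannel.pd, this]
    simp
  · have h : (fun p : Pt => F (p + (0, 2 * Real.pi, 0))) = F := by
      ext ⟨x, y, z⟩; simpa using (hF x y z).2
    have := fderiv_comp_add_right (𝕜 := ℝ) (f := F) (x := (x, y, z)) (0, 2 * Real.pi, 0)
    rw [h] at this
    simp only [NSChannel.pd, this]
    simp

theorem IsTest.pd {F : Pt → ℝ} (hF : IsTest F) (i : Fin 3) : IsTest (pd i F) :=
  ⟨contDiff_pd hF.1 i, hF.2.pd i⟩

theorem IsTest.mul {f g : Pt → ℝ} (hf : IsTest f) (hg : IsTest g) :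
    IsTest fun p => f p * g p :=
  ⟨hf.1.mul hg.1, fun x y z => by simp only [hf.2 x y z, hg.2 x y z, and_self]⟩

theorem IsTest.const_mul {f : Pt → ℝ} (hf : IsTest f) (c : ℝ) : IsTest fun p => c * f p :=
  ⟨contDiff_const.mul hf.1, fun x y z => by simp only [hf.2 x y z, and_self]⟩

theorem IsTest.sum {ι : Type*} {f : ι → Pt → ℝ} (s : Finset ι) (hf : ∀ i ∈ s, IsTest (f i)) :
    IsTest fun p => ∑ i ∈ s, f i p :=
  ⟨ContDiff.sum fun i hi => (hf i hi).1, fun x y z =>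
    ⟨Finset.sum_congr rfl fun i hi => ((hf i hi).2 x y z).1,
      Finset.sum_congr rfl fun i hi => ((hf i hi).2 x y z).2⟩⟩

theorem IsTest.differentiable {f : Pt → ℝ} (hf : IsTest f) : Differentiable ℝ f :=
  hf.1.differentiable (by simp)

theorem IsTest.continuous {f : Pt → ℝ} (hf : IsTest f) : Continuous f := hf.1.continuous

theorem IsTest.continuous_pd {f : Pt → ℝ} (hf : IsTest f) (i : Fin 3) :
    Continuous (NSChannel.pd i f) := (hf.pd i).continuous

theorem pd_mul {f g : Pt → ℝ} (hf : Differentiable ℝ f) (hg : Differentiable ℝ g) (i : Fin 3)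
    (p : Pt) : pd i (fun p => f p * g p) p = f p * pd i g p + pd i f p * g p := by
  simp only [pd]
  rw [fderiv_fun_mul (hf p) (hg p)]
  simp [mul_comm]

theorem pd_const_mul {f : Pt → ℝ} (hf : Differentiable ℝ f) (c : ℝ) (i : Fin 3) (p : Pt) :
    pd i (fun p => c * f p) p = c * pd i f p := by
  simp only [pd]
  rw [fderiv_const_mul (hf p)]
  simp

theorem pd_sum {ι : Type*} {f : ι → Pt → ℝ} (s : Finset ι)
    (hf : ∀ i ∈ s, Differentiable ℝ (f i)) (j : Fin 3) (p : Pt) :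
    pd j (fun p => ∑ i ∈ s, f i p) p = ∑ i ∈ s, pd j (f i) p := by
  simp only [pd]
  rw [fderiv_fun_sum fun i hi => hf i hi p]
  simp

theorem integral_Ioo_deriv {f f' : ℝ → ℝ} {a b : ℝ} (hab : a ≤ b)
    (hf : ∀ x, HasDerivAt f (f' x) x) (hf' : Continuous f') :
    ∫ x in Set.Ioo a b, f' x = f b - f a := by
  rw [← integral_Ioc_eq_integral_Ioo, ← intervalIntegral.integral_of_le hab]
  exact intervalIntegral.integral_eq_sub_of_hasDerivAt (fun x _ => hf x)
    (hf'.intervalIntegrable _ _)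

/-- Fubini with `x` innermost leaves the difference of the values on two opposite faces, which
periodicity cancels. -/
theorem integral_pd_fst {F : Pt → ℝ} (hF : ContDiff ℝ 1 F) (hp : Periodic F) :
    ∫ p, pd 0 F p ∂volΩ = 0 := by
  have hi := integrable_of_continuous (continuous_pd hF 0)
  rw [volΩ_eq] at hi ⊢
  rw [integral_prod_symm _ hi]
  refine integral_eq_zero_of_ae (Eventually.of_forall fun s => ?_)
  simp only [Pi.zero_apply]
  rw [integral_Ioo_deriv (by positivity)
    (hasDerivAt_fst (hF.differentiable one_ne_zero) · s.1 s.2)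
    ((continuous_pd hF 0).comp (by fun_prop))]
  have := (hp 0 s.1 s.2).1
  rw [zero_add] at this
  rw [this, sub_self]

theorem integral_pd_snd {F : Pt → ℝ} (hF : ContDiff ℝ 1 F) (hp : Periodic F) :
    ∫ p, pd 1 F p ∂volΩ = 0 := by
  have hi := integrable_of_continuous (continuous_pd hF 1)
  rw [volΩ_eq] at hi ⊢
  rw [integral_prod _ hi]
  refine integral_eq_zero_of_ae (hi.prod_right_ae.mono fun x hx => ?_)
  simp only [Pi.zero_apply]
  rw [integral_prod_symm _ hx]
  refine integral_eq_zero_of_ae (Eventually.of_forall fun z => ?_)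
  simp only [Pi.zero_apply]
  rw [integral_Ioo_deriv (by positivity)
    (hasDerivAt_snd (hF.differentiable one_ne_zero) x · z)
    ((continuous_pd hF 1).comp (by fun_prop))]
  have := (hp x 0 z).2
  rw [zero_add] at this
  rw [this, sub_self]

/-- The vertical direction is the only one that produces boundary terms; no periodicity enters. -/
theorem integral_pd_trd {F : Pt → ℝ} (hF : ContDiff ℝ 1 F) :
    ∫ p, pd 2 F p ∂volΩ = ∫ s, (F (s.1, s.2, 1) - F (s.1, s.2, -1)) ∂volΓ := by
  have hi := integrable_of_continuous (continuous_pd hF 2)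
  have hc : Continuous fun s : ℝ × ℝ => F (s.1, s.2, 1) - F (s.1, s.2, -1) :=
    (hF.continuous.comp (by fun_prop)).sub (hF.continuous.comp (by fun_prop))
  have hi' := integrable_of_continuous_square hc
  rw [volΩ_eq] at hi ⊢
  rw [volΓ_eq] at hi' ⊢
  rw [integral_prod _ hi, integral_prod _ hi']
  refine integral_congr_ae (hi.prod_right_ae.mono fun x hx => ?_)
  simp only
  rw [integral_prod _ hx]
  refine integral_congr_ae (Eventually.of_forall fun y => ?_)
  simp only
  rw [integral_Ioo_deriv (by norm_num)
    (hasDerivAt_trd (hF.differentiable one_ne_zero) x y ·)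
    ((continuous_pd hF 2).comp (by fun_prop))]

theorem integral_pd_of_ne_two {F : Pt → ℝ} (hF : ContDiff ℝ 1 F) (hp : Periodic F) {i : Fin 3}
    (hi : i ≠ 2) : ∫ p, pd i F p ∂volΩ = 0 := by
  fin_cases i
  · exact integral_pd_fst hF hp
  · exact integral_pd_snd hF hp
  · exact absurd rfl hi

theorem integrable_mul_continuous {f g : Pt → ℝ} (hf : Integrable f volΩ) (hg : Continuous g) :
    Integrable (fun p => f p * g p) volΩ := by
  obtain ⟨C, -, hC⟩ := exists_ae_bound hg
  exact hf.mul_bdd (c := C) hg.aestronglyMeasurable hC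

theorem integral_mul_pd_of_ne_two {f g : Pt → ℝ} (hf : IsTest f) (hg : IsTest g) {i : Fin 3}
    (hi : i ≠ 2) : ∫ p, f p * pd i g p ∂volΩ = - ∫ p, pd i f p * g p ∂volΩ := by
  have h := integral_pd_of_ne_two ((hf.mul hg).1.of_le (by simp)) (hf.mul hg).2 hi
  simp only [pd_mul hf.differentiable hg.differentiable] at h
  have h1 : Integrable (fun p => f p * pd i g p) volΩ :=
    integrable_of_continuous (hf.continuous.mul (hg.continuous_pd i))
  have h2 : Integrable (fun p => pd i f p * g p) volΩ :=
    integrable_of_continuous ((hf.continuous_pd i).mul hg.continuous)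
  rw [integral_add h1 h2] at h
  linarith

theorem integral_mul_pd_two {f g : Pt → ℝ} (hf : IsTest f) (hg : IsTest g) :
    ∫ p, (f p * pd 2 g p + pd 2 f p * g p) ∂volΩ =
      ∫ s, (f (s.1, s.2, 1) * g (s.1, s.2, 1) - f (s.1, s.2, -1) * g (s.1, s.2, -1)) ∂volΓ := by
  rw [← integral_pd_trd ((hf.mul hg).1.of_le (by simp))]
  simp only [pd_mul hf.differentiable hg.differentiable]

/-- A classical derivative is a weak derivative. -/
theorem IsTest.hasWeakPD {f : Pt → ℝ} (hf : IsTest f) (i : Fin 3) : HasWeakPD i f (NSChannel.pd i f) := by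
  intro φ hφ
  by_cases hi : i = 2
  · subst hi
    have h := integral_mul_pd_two hf hφ.1
    obtain ⟨δ, hδ, hz⟩ := hφ.2
    have h1 : ∀ s : ℝ × ℝ, φ (s.1, s.2, 1) = 0 := fun s => hz _ _ _ (by simpa using hδ.le)
    have h2 : ∀ s : ℝ × ℝ, φ (s.1, s.2, -1) = 0 := fun s => hz _ _ _ (by simpa using hδ.le)
    simp only [h1, h2, mul_zero, sub_zero, integral_zero] at h
    have h3 : Integrable (fun p => f p * NSChannel.pd 2 φ p) volΩ :=
      integrable_of_continuous (hf.continuous.mul (hφ.1.continuous_pd 2))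
    have h4 : Integrable (fun p => NSChannel.pd 2 f p * φ p) volΩ :=
      integrable_of_continuous ((hf.continuous_pd 2).mul hφ.1.continuous)
    rw [integral_add h3 h4] at h
    linarith
  · exact integral_mul_pd_of_ne_two hf hφ.1 hi

/-! ### Cut-off in the vertical direction -/

/-- Smooth cut-off functions vanishing near `|z| = 1` and tending to `1` in `(-1, 1)`. -/
noncomputable def cutoff (k : ℕ) (z : ℝ) : ℝ := Real.smoothTransition (k * (1 - z ^ 2) - 1)

theorem contDiff_cutoff (k : ℕ) : ContDiff ℝ ∞ (cutoff k) :=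
  Real.smoothTransition.contDiff.comp (by fun_prop)

theorem abs_cutoff_le (k : ℕ) (z : ℝ) : |cutoff k z| ≤ 1 := by
  rw [cutoff, abs_of_nonneg (Real.smoothTransition.nonneg _)]
  exact Real.smoothTransition.le_one _

theorem exists_cutoff_eq_zero (k : ℕ) : ∃ δ < (1 : ℝ), ∀ z, δ ≤ |z| → cutoff k z = 0 := by
  -- With this `δ`, `δ ≤ |z|` means `1 - z² ≤ 1/(k+1)`, so `k(1 - z²) ≤ 1`. Using `k + 1` in the
  -- denominator also covers `k = 0`.
  refine ⟨Real.sqrt (1 - 1 / (k + 1)), ?_, fun z hz => ?_⟩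
  · rw [Real.sqrt_lt' one_pos]
    have : (0 : ℝ) < 1 / (k + 1) := by positivity
    linarith
  · apply Real.smoothTransition.zero_of_nonpos
    have h1 : 1 - 1 / ((k : ℝ) + 1) ≤ z ^ 2 := by
      rw [← sq_abs]; exact Real.sqrt_le_iff.1 hz |>.2
    have h2 : 1 - z ^ 2 ≤ 1 / ((k : ℝ) + 1) := by linarith
    have hk : (0 : ℝ) ≤ k := k.cast_nonneg
    have h3 : (k : ℝ) * (1 - z ^ 2) ≤ k * (1 / (k + 1)) := mul_le_mul_of_nonneg_left h2 hk
    have h4 : (k : ℝ) * (1 / (k + 1)) ≤ 1 := by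
      rw [mul_one_div, div_le_one (by positivity)]; linarith
    linarith

theorem tendsto_cutoff {z : ℝ} (hz : z ∈ Set.Ioo (-1 : ℝ) 1) :
    Tendsto (fun k => cutoff k z) atTop (𝓝 1) := by
  have hp : 0 < 1 - z ^ 2 := by nlinarith [hz.1, hz.2]
  have h : ∀ᶠ k : ℕ in atTop, cutoff k z = 1 := by
    have := tendsto_natCast_atTop_atTop (R := ℝ) |>.atTop_mul_const hp
    filter_upwards [this.eventually_ge_atTop 2] with k hk
    exact Real.smoothTransition.one_of_one_le (by linarith)
  exact tendsto_const_nhds.congr' (h.mono fun k hk => hk.symm)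

theorem isInteriorTest_cutoff_mul {φ : Pt → ℝ} (hφ : IsTest φ) (k : ℕ) :
    IsInteriorTest fun p => cutoff k p.2.2 * φ p := by
  have hc : IsTest fun p : Pt => cutoff k p.2.2 :=
    ⟨(contDiff_cutoff k).comp (by fun_prop), fun x y z => ⟨rfl, rfl⟩⟩
  obtain ⟨δ, hδ, h⟩ := exists_cutoff_eq_zero k
  exact ⟨hc.mul hφ, δ, hδ, fun x y z hz => by simp [h z hz]⟩

/-- The cut-off depends on `z` alone and therefore commutes with the two periodic derivatives. -/
theorem pd_cutoff_mul {φ : Pt → ℝ} (hφ : IsTest φ) (k : ℕ) {i : Fin 3} (hi : i ≠ 2) (p : Pt) :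
    pd i (fun p => cutoff k p.2.2 * φ p) p = cutoff k p.2.2 * pd i φ p := by
  have hd : Differentiable ℝ fun p : Pt => cutoff k p.2.2 :=
    ((contDiff_cutoff k).comp (g := cutoff k) (f := fun p : Pt => p.2.2)
      (by fun_prop)).differentiable (by simp)
  rw [pd_mul hd hφ.differentiable]
  suffices h : pd i (fun p : Pt => cutoff k p.2.2) p = 0 by rw [h]; ring
  obtain ⟨x, y, z⟩ := p
  fin_cases i
  · exact (hasDerivAt_fst hd x y z).unique (hasDerivAt_const x (cutoff k z))
  · exact (hasDerivAt_snd hd x y z).unique (hasDerivAt_const y (cutoff k z))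
  · exact absurd rfl hi

theorem tendsto_integral_cutoff_mul {f : Pt → ℝ} (hf : Integrable f volΩ) :
    Tendsto (fun k => ∫ p, cutoff k p.2.2 * f p ∂volΩ) atTop (𝓝 (∫ p, f p ∂volΩ)) := by
  refine tendsto_integral_of_dominated_convergence (fun p => |f p|) (fun k => ?_) hf.abs
    (fun k => Eventually.of_forall fun p => ?_) ?_
  · exact (((contDiff_cutoff k).continuous.comp (by fun_prop)).aestronglyMeasurable).mul
      hf.aestronglyMeasurable
  · rw [Real.norm_eq_abs, abs_mul]
    exact mul_le_of_le_one_left (abs_nonneg _) (abs_cutoff_le k _)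
  · filter_upwards [ae_mem_cell] with p hp
    simpa using (tendsto_cutoff hp.2.2).mul_const (f p)

/-- In the periodic directions the test functions of a weak derivative need not vanish on `Γ`. -/
theorem HasWeakPD.integral_mul_pd {i : Fin 3} {f g : Pt → ℝ} (h : HasWeakPD i f g) (hi : i ≠ 2)
    (hf : Integrable f volΩ) (hg : Integrable g volΩ) {φ : Pt → ℝ} (hφ : IsTest φ) :
    ∫ p, f p * pd i φ p ∂volΩ = - ∫ p, g p * φ p ∂volΩ := by
  -- The weak derivative is tested with `cutoff k * φ`, which is admissible, and both sides converge
  -- by dominated convergence.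
  have h1 := tendsto_integral_cutoff_mul (integrable_mul_continuous hf (hφ.continuous_pd i))
  have h2 := tendsto_integral_cutoff_mul (integrable_mul_continuous hg hφ.continuous)
  refine tendsto_nhds_unique h1 (h2.neg.congr fun k => ?_)
  have := h _ (isInteriorTest_cutoff_mul hφ k)
  simp only [pd_cutoff_mul hφ k hi] at this
  calc _ = - ∫ p, g p * (cutoff k p.2.2 * φ p) ∂volΩ := by
        congr 1; exact integral_congr_ae (Eventually.of_forall fun p => by simp only; ring)
    _ = _ := by
        rw [← this]
        exact integral_congr_ae (Eventually.of_forall fun p => by simp only; ring)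

end NSChannel

namespace NSChannel

/-! ### Determining families of test functions -/

/-- The functions in `𝒜` separate integrable functions. -/
def Determining {X : Type*} [MeasurableSpace X] (μ : Measure X) (𝒜 : Set (X → ℝ)) : Prop :=
  ∀ F : X → ℝ, Integrable F μ → (∀ A ∈ 𝒜, ∫ x, F x * A x ∂μ = 0) → F =ᵐ[μ] 0

/-- Products of functions from two families. -/
def prodFamily {X Y : Type*} (𝒜 : Set (X → ℝ)) (ℬ : Set (Y → ℝ)) : Set (X × Y → ℝ) :=
  {C | ∃ A ∈ 𝒜, ∃ B ∈ ℬ, C = fun p => A p.1 * B p.2}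

/-- Measurable functions bounded by one. -/
def UnitBounded {X : Type*} [MeasurableSpace X] (𝒜 : Set (X → ℝ)) : Prop :=
  ∀ A ∈ 𝒜, Measurable A ∧ ∀ x, |A x| ≤ 1

theorem UnitBounded.prodFamily {X Y : Type*} [MeasurableSpace X] [MeasurableSpace Y]
    {𝒜 : Set (X → ℝ)} {ℬ : Set (Y → ℝ)} (hA : UnitBounded 𝒜) (hB : UnitBounded ℬ) :
    UnitBounded (prodFamily 𝒜 ℬ) := by
  rintro _ ⟨A, hA', B, hB', rfl⟩
  refine ⟨((hA A hA').1.comp measurable_fst).mul ((hB B hB').1.comp measurable_snd), fun p => ?_⟩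
  rw [abs_mul]
  exact mul_le_one₀ ((hA A hA').2 _) (abs_nonneg _) ((hB B hB').2 _)

/-- By Fubini and the separation property of `ℬ`, for each `A` the partial integral of `F` against
`A` vanishes for almost every `y`. Countability of `𝒜` allows one null set of `y` for all `A`, and
then `𝒜` separates the remaining slices. -/
theorem Determining.prod {X Y : Type*} [MeasurableSpace X] [MeasurableSpace Y]
    {μ : Measure X} {ν : Measure Y} [SFinite μ] [SFinite ν]
    {𝒜 : Set (X → ℝ)} {ℬ : Set (Y → ℝ)} (hμ : Determining μ 𝒜) (hν : Determining ν ℬ)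
    (hc : 𝒜.Countable) (hA : UnitBounded 𝒜) (hB : UnitBounded ℬ) :
    Determining (μ.prod ν) (prodFamily 𝒜 ℬ) := by
  intro F hF h
  have hFA : ∀ A ∈ 𝒜, Integrable (fun p : X × Y => F p * A p.1) (μ.prod ν) := fun A hA' =>
    hF.mul_bdd (c := 1) (((hA A hA').1.comp measurable_fst).aestronglyMeasurable)
      (Eventually.of_forall fun p => (hA A hA').2 _)
  have key : ∀ A ∈ 𝒜, ∀ᵐ y ∂ν, ∫ x, F (x, y) * A x ∂μ = 0 := by
    intro A hA'
    refine hν _ (hFA A hA').integral_prod_right fun B hB' => ?_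
    have hi : Integrable (fun p : X × Y => F p * (A p.1 * B p.2)) (μ.prod ν) :=
      hF.mul_bdd (c := 1) ((hA.prodFamily hB _ ⟨A, hA', B, hB', rfl⟩).1.aestronglyMeasurable)
        (Eventually.of_forall fun p => (hA.prodFamily hB _ ⟨A, hA', B, hB', rfl⟩).2 p)
    rw [← h _ ⟨A, hA', B, hB', rfl⟩, integral_prod_symm _ hi]
    refine integral_congr_ae (Eventually.of_forall fun y => ?_)
    simp only [← integral_mul_const, mul_assoc]
  have h0 : ∀ᵐ y ∂ν, ∀ᵐ x ∂μ, F (x, y) = 0 := by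
    filter_upwards [(ae_ball_iff hc).2 key, hF.prod_left_ae] with y hy hyi
    exact hμ _ hyi hy
  have hz : ∀ᵐ y ∂ν, ∫ x, ‖F (x, y)‖ ∂μ = 0 := h0.mono fun y hy =>
    integral_eq_zero_of_ae (hy.mono fun x hx => by simp [hx])
  have : ∫ p, ‖F p‖ ∂(μ.prod ν) = 0 := by
    rw [integral_prod_symm _ hF.norm]
    exact integral_eq_zero_of_ae hz
  rw [integral_eq_zero_iff_of_nonneg (fun p => norm_nonneg _) hF.norm] at this
  exact this.mono fun p hp => norm_eq_zero.1 hp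

theorem Determining.mono {X : Type*} [MeasurableSpace X] {μ : Measure X} {𝒜 ℬ : Set (X → ℝ)}
    (h : Determining μ 𝒜) (hs : 𝒜 ⊆ ℬ) : Determining μ ℬ :=
  fun F hF hB => h F hF fun A hA => hB A (hs hA)

/-- Dominated convergence gives zero integrals over all intervals with rational end points. These
form a π-system generating the Borel sets, so all set integrals vanish. -/
theorem determining_of_tendsto_indicator {ν : Measure ℝ} {A : ℚ → ℚ → ℕ → ℝ → ℝ}
    (hm : ∀ c d k, Continuous (A c d k)) (hb : ∀ c d k t, |A c d k t| ≤ 1)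
    (hlim : ∀ c d : ℚ, ∀ᵐ t ∂ν, Tendsto (fun k => A c d k t) atTop
      (𝓝 (Set.indicator (Set.Ioo (c : ℝ) d) 1 t))) :
    Determining ν {f | ∃ c d k, f = A c d k} := by
  intro F hF h
  have hI : ∀ c d : ℚ, ∫ t in Set.Ioo (c : ℝ) d, F t ∂ν = 0 := by
    intro c d
    have h1 : Tendsto (fun k => ∫ t, F t * A c d k t ∂ν) atTop
        (𝓝 (∫ t, F t * Set.indicator (Set.Ioo (c : ℝ) d) 1 t ∂ν)) := by
      refine tendsto_integral_of_dominated_convergence (fun t => |F t|) (fun k => ?_) hF.abs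
        (fun k => Eventually.of_forall fun t => ?_) ?_
      · exact hF.aestronglyMeasurable.mul (hm c d k).aestronglyMeasurable
      · rw [Real.norm_eq_abs, abs_mul]
        exact mul_le_of_le_one_right (abs_nonneg _) (hb c d k t)
      · exact (hlim c d).mono fun t ht => ht.const_mul _
    simp only [h _ ⟨c, d, _, rfl⟩] at h1
    rw [← integral_indicator measurableSet_Ioo]
    rw [← tendsto_nhds_unique h1 tendsto_const_nhds]
    refine integral_congr_ae (Eventually.of_forall fun t => ?_)
    by_cases ht : t ∈ Set.Ioo (c : ℝ) d <;> simp [ht]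
  -- The total integral is needed for the complement step of the π-λ induction.
  have htot : ∫ t, F t ∂ν = 0 := by
    have h1 : Tendsto (fun k : ℕ => ∫ t in Set.Ioo (((-k : ℚ)) : ℝ) ((k : ℚ) : ℝ), F t ∂ν) atTop
        (𝓝 (∫ t in ⋃ k : ℕ, Set.Ioo (((-k : ℚ)) : ℝ) ((k : ℚ) : ℝ), F t ∂ν)) := by
      refine tendsto_setIntegral_of_monotone (fun k => measurableSet_Ioo) ?_ hF.integrableOn
      intro i j hij
      have : (i : ℝ) ≤ j := by exact_mod_cast hij
      apply Set.Ioo_subset_Ioo <;> push_cast <;> linarith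
    have hU : (⋃ k : ℕ, Set.Ioo (((-k : ℚ)) : ℝ) ((k : ℚ) : ℝ)) = Set.univ := by
      ext t
      obtain ⟨n, hn⟩ := exists_nat_gt |t|
      simp only [Set.mem_iUnion, Set.mem_univ, iff_true]
      refine ⟨n, ?_⟩
      push_cast
      exact abs_lt.1 hn
    rw [hU, setIntegral_univ] at h1
    simp only [hI] at h1
    exact (tendsto_nhds_unique h1 tendsto_const_nhds)
  have hall : ∀ s, MeasurableSet s → ∫ t in s, F t ∂ν = 0 := by
    intro s hs
    refine MeasurableSpace.induction_on_inter (C := fun s _ => ∫ t in s, F t ∂ν = 0)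
      (s := ⋃ (a : ℚ) (b : ℚ) (_ : a < b), {Set.Ioo (a : ℝ) b})
      (BorelSpace.measurable_eq.trans Real.borel_eq_generateFrom_Ioo_rat) Real.isPiSystem_Ioo_rat ?_ ?_ ?_ ?_ s hs
    · simp
    · intro t ht
      simp only [Set.mem_iUnion, Set.mem_singleton_iff] at ht
      obtain ⟨a, b, -, rfl⟩ := ht
      exact hI a b
    · intro t ht h0
      have := integral_add_compl ht hF
      linarith
    · intro f hd hf h0
      rw [integral_iUnion hf hd hF.integrableOn]
      simp [h0]
  exact hF.ae_eq_zero_of_forall_setIntegral_eq_zero fun s hs _ => hall s hs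

/-! ### Smooth approximations of indicator functions -/

theorem tendsto_smoothTransition_mul {g b : ℝ} :
    Tendsto (fun k : ℕ => Real.smoothTransition (k * g - b)) atTop (𝓝 1) ∨ g ≤ 0 := by
  rcases le_or_gt g 0 with h | h
  · exact Or.inr h
  · left
    have h1 := tendsto_natCast_atTop_atTop (R := ℝ) |>.atTop_mul_const h
    refine tendsto_const_nhds.congr' ?_
    filter_upwards [h1.eventually_ge_atTop (1 + b)] with k hk
    exact (Real.smoothTransition.one_of_one_le (by linarith)).symm

/-- Here `g` is positive exactly on `s`: there `k * g - b` grows beyond one, and off `s` it is never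
positive, since `b ≥ 0`. -/
theorem tendsto_smoothTransition_indicator {g b : ℝ} (hb : 0 ≤ b) {s : Set ℝ} {t : ℝ}
    (h1 : t ∈ s → 0 < g) (h2 : t ∉ s → g ≤ 0) :
    Tendsto (fun k : ℕ => Real.smoothTransition (k * g - b)) atTop
      (𝓝 (Set.indicator s 1 t)) := by
  by_cases ht : t ∈ s
  · simpa [ht] using (tendsto_smoothTransition_mul (g := g) (b := b)).resolve_right
      (not_le.2 (h1 ht))
  · have : ∀ k : ℕ, Real.smoothTransition (k * g - b) = 0 := fun k =>
      Real.smoothTransition.zero_of_nonpos (by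
        have := mul_nonpos_of_nonneg_of_nonpos k.cast_nonneg (h2 ht) (α := ℝ)
        linarith)
    simp [ht, this]

/-- Smooth functions with compact support in `(a, b)`, approximating indicator functions. -/
noncomputable def bump (a b : ℝ) (c d : ℚ) (k : ℕ) (t : ℝ) : ℝ :=
  if max a c < min b d then
    Real.smoothTransition (k * ((t - max a c) * (min b d - t)) - 1) else 0

/-- Smooth `2π`-periodic functions, approximating indicator functions in `(0, 2π)`. -/
noncomputable def periodicBump (c d : ℚ) (k : ℕ) (t : ℝ) : ℝ :=
  if max 0 (c : ℝ) < min (2 * Real.pi) d then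
    Real.smoothTransition (k * (Real.cos (t - (max 0 (c : ℝ) + min (2 * Real.pi) d) / 2)
      - Real.cos ((min (2 * Real.pi) d - max 0 (c : ℝ)) / 2)) - 0) else 0

theorem contDiff_bump (a b : ℝ) (c d : ℚ) (k : ℕ) : ContDiff ℝ ∞ (bump a b c d k) := by
  unfold bump
  split_ifs
  · exact Real.smoothTransition.contDiff.comp (by fun_prop)
  · exact contDiff_const

theorem contDiff_periodicBump (c d : ℚ) (k : ℕ) : ContDiff ℝ ∞ (periodicBump c d k) := by
  unfold periodicBump
  split_ifs
  · exact Real.smoothTransition.contDiff.comp (by fun_prop)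
  · exact contDiff_const

theorem abs_smoothTransition_le (x : ℝ) : |Real.smoothTransition x| ≤ 1 := by
  rw [abs_of_nonneg (Real.smoothTransition.nonneg _)]
  exact Real.smoothTransition.le_one _

theorem abs_bump_le (a b : ℝ) (c d : ℚ) (k : ℕ) (t : ℝ) : |bump a b c d k t| ≤ 1 := by
  unfold bump
  split_ifs
  · exact abs_smoothTransition_le _
  · simp

theorem abs_periodicBump_le (c d : ℚ) (k : ℕ) (t : ℝ) : |periodicBump c d k t| ≤ 1 := by
  unfold periodicBump
  split_ifs
  · exact abs_smoothTransition_le _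
  · simp

theorem periodicBump_periodic (c d : ℚ) (k : ℕ) (t : ℝ) :
    periodicBump c d k (t + 2 * Real.pi) = periodicBump c d k t := by
  unfold periodicBump
  rw [show ∀ m : ℝ, t + 2 * Real.pi - m = t - m + 2 * Real.pi from fun m => by ring]
  simp only [Real.cos_add_two_pi]

/-- The shift by one in `bump` leaves a margin: within distance `1/((k+1)(b-a))` of an end point of
`(a, b)` the quadratic is at most `1/(k+1)`, and `k` times it does not exceed one. -/
theorem bump_eq_zero (a b : ℝ) (hab : a < b) (c d : ℚ) (k : ℕ) :
    ∃ a' b', a < a' ∧ b' < b ∧ ∀ t, (t ≤ a' ∨ b' ≤ t) → bump a b c d k t = 0 := by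
  have hpos : 0 < 1 / ((k + 1 : ℝ) * (b - a)) := by
    have : 0 < b - a := sub_pos.2 hab
    positivity
  refine ⟨a + 1 / ((k + 1 : ℝ) * (b - a)), b - 1 / ((k + 1 : ℝ) * (b - a)), by linarith,
    by linarith, fun t ht => ?_⟩
  unfold bump
  split_ifs with hcd
  · apply Real.smoothTransition.zero_of_nonpos
    set c' := max a (c : ℝ)
    set d' := min b (d : ℝ)
    have hc : a ≤ c' := le_max_left _ _
    have hd : d' ≤ b := min_le_left _ _
    set ε := 1 / ((k + 1 : ℝ) * (b - a)) with hε
    have hεk : (k + 1 : ℝ) * (ε * (b - a)) = 1 := by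
      have : b - a ≠ 0 := (sub_pos.2 hab).ne'
      have : (k + 1 : ℝ) ≠ 0 := by positivity
      rw [hε]; field_simp
    have hprod : (t - c') * (d' - t) ≤ ε * (b - a) := by
      rcases le_or_gt t c' with h1 | h1
      · rcases le_or_gt d' t with h2 | h2
        · linarith
        · have : (t - c') * (d' - t) ≤ 0 :=
            mul_nonpos_of_nonpos_of_nonneg (by linarith) (by linarith)
          have : 0 ≤ ε * (b - a) := mul_nonneg hpos.le (by linarith)
          linarith
      · rcases le_or_gt d' t with h2 | h2
        · have : (t - c') * (d' - t) ≤ 0 :=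
            mul_nonpos_of_nonneg_of_nonpos (by linarith) (by linarith)
          have : 0 ≤ ε * (b - a) := mul_nonneg hpos.le (by linarith)
          linarith
        · rcases ht with ht | ht
          · exact mul_le_mul (by linarith) (by linarith) (by linarith) hpos.le
          · rw [mul_comm ε]
            exact mul_le_mul (by linarith) (by linarith) (by linarith) (by linarith)
    have hk : (0 : ℝ) ≤ k := k.cast_nonneg
    have h3 : (k : ℝ) * ((t - c') * (d' - t)) ≤ k * (ε * (b - a)) :=
      mul_le_mul_of_nonneg_left hprod hk
    have h4 : 0 ≤ ε * (b - a) := mul_nonneg hpos.le (by linarith)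
    linarith
  · rfl

theorem determining_bump (a b : ℝ) :
    Determining (volume.restrict (Set.Ioo a b)) {f | ∃ c d k, f = bump a b c d k} := by
  refine determining_of_tendsto_indicator (fun c d k => (contDiff_bump a b c d k).continuous)
    (abs_bump_le a b) fun c d => ?_
  filter_upwards [ae_restrict_mem measurableSet_Ioo] with t ht
  have hiff : t ∈ Set.Ioo (c : ℝ) d ↔ t ∈ Set.Ioo (max a (c : ℝ)) (min b (d : ℝ)) := by
    simp only [Set.mem_Ioo, max_lt_iff, lt_min_iff]
    exact ⟨fun h => ⟨⟨ht.1, h.1⟩, ht.2, h.2⟩, fun h => ⟨h.1.2, h.2.2⟩⟩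
  unfold bump
  split_ifs with hcd
  · refine tendsto_smoothTransition_indicator zero_le_one (fun h => ?_) fun h => ?_
    · have := hiff.1 h
      exact mul_pos (by linarith [this.1]) (by linarith [this.2])
    · rw [hiff, Set.mem_Ioo, not_and_or, not_lt, not_lt] at h
      rcases h with h | h
      · exact mul_nonpos_of_nonpos_of_nonneg (by linarith) (by linarith)
      · exact mul_nonpos_of_nonneg_of_nonpos (by linarith) (by linarith)
  · have : t ∉ Set.Ioo (c : ℝ) d := fun h => hcd ((hiff.1 h).1.trans (hiff.1 h).2)
    simp [this]

/-- For `t` in one period, the cosine of the distance to the midpoint exceeds the cosine of half the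
length exactly inside the interval. The cosine thus plays the role of the quadratic in `bump` and
supplies periodicity. -/
theorem determining_periodicBump :
    Determining (volume.restrict (Set.Ioo 0 (2 * Real.pi)))
      {f | ∃ c d k, f = periodicBump c d k} := by
  refine determining_of_tendsto_indicator
    (fun c d k => (contDiff_periodicBump c d k).continuous) abs_periodicBump_le fun c d => ?_
  filter_upwards [ae_restrict_mem measurableSet_Ioo] with t ht
  have hiff : t ∈ Set.Ioo (c : ℝ) d ↔
      t ∈ Set.Ioo (max 0 (c : ℝ)) (min (2 * Real.pi) (d : ℝ)) := by
    simp only [Set.mem_Ioo, max_lt_iff, lt_min_iff]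
    exact ⟨fun h => ⟨⟨ht.1, h.1⟩, ht.2, h.2⟩, fun h => ⟨h.1.2, h.2.2⟩⟩
  unfold periodicBump
  split_ifs with hcd
  · have hc : 0 ≤ max 0 (c : ℝ) := le_max_left _ _
    have hd : min (2 * Real.pi) (d : ℝ) ≤ 2 * Real.pi := min_le_left _ _
    set c' := max 0 (c : ℝ)
    set d' := min (2 * Real.pi) (d : ℝ)
    refine tendsto_smoothTransition_indicator le_rfl (fun h => ?_) fun h => ?_
    · have := hiff.1 h
      rw [sub_pos, ← Real.cos_abs (t - _)]
      refine Real.cos_lt_cos_of_nonneg_of_le_pi (abs_nonneg _) (by linarith) ?_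
      rw [abs_lt]
      constructor <;> linarith [this.1, this.2]
    · rw [hiff, Set.mem_Ioo, not_and_or, not_lt, not_lt] at h
      rw [sub_nonpos, ← Real.cos_abs (t - _)]
      have h1 : (d' - c') / 2 ≤ |t - (c' + d') / 2| := by
        rw [le_abs]
        rcases h with h | h
        · right; linarith
        · left; linarith
      have h2 : |t - (c' + d') / 2| ≤ 2 * Real.pi - (d' - c') / 2 := by
        rw [abs_le]
        constructor <;> linarith [ht.1, ht.2]
      -- Beyond `π` the cosine increases again. Reflection at `π` returns to the decreasing branch,
      -- where `h2` keeps the reflected distance at least half the length.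
      rcases le_or_gt |t - (c' + d') / 2| Real.pi with h3 | h3
      · exact Real.cos_le_cos_of_nonneg_of_le_pi (by linarith) h3 h1
      · rw [← Real.cos_two_pi_sub |t - (c' + d') / 2|]
        exact Real.cos_le_cos_of_nonneg_of_le_pi (by linarith) (by linarith) (by linarith)
  · have : t ∉ Set.Ioo (c : ℝ) d := fun h => hcd ((hiff.1 h).1.trans (hiff.1 h).2)
    simp [this]

theorem countable_bumps (A : ℚ → ℚ → ℕ → ℝ → ℝ) : {f | ∃ c d k, f = A c d k}.Countable := by
  have : {f | ∃ c d k, f = A c d k} = Set.range fun q : ℚ × ℚ × ℕ => A q.1 q.2.1 q.2.2 := by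
    ext f
    constructor
    · rintro ⟨c, d, k, rfl⟩; exact ⟨(c, d, k), rfl⟩
    · rintro ⟨q, rfl⟩; exact ⟨_, _, _, rfl⟩
  rw [this]
  exact Set.countable_range _

/-- Smooth functions on `ℝ` with period `2π`, bounded by one. -/
def periodicFamily : Set (ℝ → ℝ) :=
  {A | ContDiff ℝ ∞ A ∧ (∀ x, A (x + 2 * Real.pi) = A x) ∧ ∀ x, |A x| ≤ 1}

/-- Smooth functions on `ℝ` with compact support in `(a, b)`, bounded by one. -/
def supportedFamily (a b : ℝ) : Set (ℝ → ℝ) :=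
  {A | ContDiff ℝ ∞ A ∧ (∃ a' b', a < a' ∧ b' < b ∧ ∀ t, (t ≤ a' ∨ b' ≤ t) → A t = 0) ∧
    ∀ x, |A x| ≤ 1}

theorem unitBounded_periodicFamily : UnitBounded periodicFamily :=
  fun _ hA => ⟨hA.1.continuous.measurable, hA.2.2⟩

theorem unitBounded_supportedFamily (a b : ℝ) : UnitBounded (supportedFamily a b) :=
  fun _ hA => ⟨hA.1.continuous.measurable, hA.2.2⟩

theorem periodicBumps_subset : {f | ∃ c d k, f = periodicBump c d k} ⊆ periodicFamily := by
  rintro _ ⟨c, d, k, rfl⟩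
  exact ⟨contDiff_periodicBump c d k, periodicBump_periodic c d k, abs_periodicBump_le c d k⟩

theorem bumps_subset {a b : ℝ} (hab : a < b) :
    {f | ∃ c d k, f = bump a b c d k} ⊆ supportedFamily a b := by
  rintro _ ⟨c, d, k, rfl⟩
  exact ⟨contDiff_bump a b c d k, bump_eq_zero a b hab c d k, abs_bump_le a b c d k⟩

theorem determining_supportedFamily {a b : ℝ} (hab : a < b) :
    Determining (volume.restrict (Set.Ioo a b)) (supportedFamily a b) :=
  (determining_bump a b).mono (bumps_subset hab)

theorem prodFamily_mono {X Y : Type*} {𝒜 𝒜' : Set (X → ℝ)} {ℬ ℬ' : Set (Y → ℝ)} (hA : 𝒜 ⊆ 𝒜')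
    (hB : ℬ ⊆ ℬ') : prodFamily 𝒜 ℬ ⊆ prodFamily 𝒜' ℬ' := by
  rintro _ ⟨A, h, B, h', rfl⟩
  exact ⟨A, hA h, B, hB h', rfl⟩

theorem Determining.prod_periodicFamily {Y : Type*} [MeasurableSpace Y] {ν : Measure Y}
    [SFinite ν] {ℬ : Set (Y → ℝ)} (hν : Determining ν ℬ) (hB : UnitBounded ℬ) :
    Determining ((volume.restrict (Set.Ioo 0 (2 * Real.pi))).prod ν)
      (prodFamily periodicFamily ℬ) :=
  (determining_periodicBump.prod hν (countable_bumps _)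
    (fun A hA => unitBounded_periodicFamily A (periodicBumps_subset hA)) hB).mono
    (prodFamily_mono periodicBumps_subset subset_rfl)

theorem Determining.prod_supportedFamily {Y : Type*} [MeasurableSpace Y] {ν : Measure Y}
    [SFinite ν] {ℬ : Set (Y → ℝ)} (hν : Determining ν ℬ) (hB : UnitBounded ℬ) {a b : ℝ}
    (hab : a < b) :
    Determining ((volume.restrict (Set.Ioo a b)).prod ν) (prodFamily (supportedFamily a b) ℬ) :=
  ((determining_bump a b).prod hν (countable_bumps _)
    (fun A hA => unitBounded_supportedFamily a b A (bumps_subset hab hA)) hB).mono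
    (prodFamily_mono (bumps_subset hab) subset_rfl)

/-- Product test functions of the variables `(y, z)`. -/
def sectionFamily : Set (ℝ × ℝ → ℝ) := prodFamily periodicFamily (supportedFamily (-1) 1)

/-- Product test functions on the cell. -/
def cellFamily : Set (Pt → ℝ) := prodFamily periodicFamily sectionFamily

theorem unitBounded_sectionFamily : UnitBounded sectionFamily :=
  unitBounded_periodicFamily.prodFamily (unitBounded_supportedFamily _ _)

theorem determining_sectionFamily :
    Determining ((volume.restrict (Set.Ioo 0 (2 * Real.pi))).prod
      (volume.restrict (Set.Ioo (-1 : ℝ) 1))) sectionFamily :=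
  (determining_supportedFamily (by norm_num)).prod_periodicFamily (unitBounded_supportedFamily _ _)

theorem determining_cellFamily : Determining volΩ cellFamily := by
  rw [volΩ_eq]
  exact determining_sectionFamily.prod_periodicFamily unitBounded_sectionFamily

theorem isInteriorTest_of_prod {A B C : ℝ → ℝ} (hA : ContDiff ℝ ∞ A) (hB : ContDiff ℝ ∞ B)
    (hC : ContDiff ℝ ∞ C) (hAp : ∀ x, A (x + 2 * Real.pi) = A x)
    (hBp : ∀ x, B (x + 2 * Real.pi) = B x)
    (hs : ∃ a' b', -1 < a' ∧ b' < 1 ∧ ∀ t, (t ≤ a' ∨ b' ≤ t) → C t = 0) :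
    IsInteriorTest fun p => A p.1 * (B p.2.1 * C p.2.2) := by
  obtain ⟨a', b', ha, hb, hC0⟩ := hs
  refine ⟨⟨by fun_prop, fun x y z => ⟨by simp [hAp], by simp [hBp]⟩⟩, max (-a') b',
    max_lt (by linarith) hb, fun x y z hz => ?_⟩
  have : C z = 0 := hC0 z (by
    rcases abs_cases z with h | h
    · right; rw [← h.1]; exact (le_max_right _ _).trans hz
    · left; have := (le_max_left (-a') b').trans hz; linarith)
  simp [this]

theorem isInteriorTest_of_mem_cellFamily {φ : Pt → ℝ} (h : φ ∈ cellFamily) :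
    IsInteriorTest φ := by
  obtain ⟨A, hA, _, ⟨B, hB, C, hC, rfl⟩, rfl⟩ := h
  exact isInteriorTest_of_prod hA.1 hB.1 hC.1 hA.2.1 hB.2.1 hC.2.1

/-- Fundamental lemma of the calculus of variations on the periodicity cell. -/
theorem ae_eq_zero_of_forall_isInteriorTest {F : Pt → ℝ} (hF : Integrable F volΩ)
    (h : ∀ φ, IsInteriorTest φ → ∫ p, F p * φ p ∂volΩ = 0) : F =ᵐ[volΩ] 0 :=
  determining_cellFamily F hF fun φ hφ => h φ (isInteriorTest_of_mem_cellFamily hφ)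

end NSChannel

namespace NSChannel

/-! ### Orthogonality of a periodic function and its derivative -/

/-- For real `w` the coefficient is the cosine integral minus `i` times the sine integral, divided
by `2π`; only its modulus enters the Parseval argument. -/
theorem normSq_fourierCoeffOn {w : ℝ → ℝ}
    (hw : IntegrableOn w (Set.Ioo 0 (2 * Real.pi))) (n : ℤ) :
    ‖fourierCoeffOn Real.two_pi_pos (fun x => (w x : ℂ)) n‖ ^ 2 =
      (1 / (2 * Real.pi)) ^ 2 *
        ((∫ x in Set.Ioo 0 (2 * Real.pi), w x * Real.cos (n * x)) ^ 2 +
          (∫ x in Set.Ioo 0 (2 * Real.pi), w x * Real.sin (n * x)) ^ 2) := by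
  have hcos : IntegrableOn (fun x => w x * Real.cos (n * x)) (Set.Ioo 0 (2 * Real.pi)) :=
    hw.mul_bdd (c := 1) (by fun_prop) (Eventually.of_forall fun x => Real.abs_cos_le_one _)
  have hsin : IntegrableOn (fun x => w x * Real.sin (n * x)) (Set.Ioo 0 (2 * Real.pi)) :=
    hw.mul_bdd (c := 1) (by fun_prop) (Eventually.of_forall fun x => Real.abs_sin_le_one _)
  have hf : ∀ x : ℝ, fourier (-n) (x : AddCircle (2 * Real.pi - 0)) • (w x : ℂ) =
      ((w x * Real.cos (n * x) : ℝ) : ℂ) - ((w x * Real.sin (n * x) : ℝ) : ℂ) * Complex.I := by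
    intro x
    rw [fourier_coe_apply]
    have hpi : (Real.pi : ℂ) ≠ 0 := by exact_mod_cast Real.pi_ne_zero
    have : 2 * (Real.pi : ℂ) * Complex.I * ((-n : ℤ) : ℂ) * x / ((2 * Real.pi - 0 : ℝ) : ℂ) =
        ((-(n * x) : ℝ) : ℂ) * Complex.I := by
      push_cast
      rw [sub_zero]
      field_simp
    rw [this, Complex.exp_mul_I, ← Complex.ofReal_cos, ← Complex.ofReal_sin, Real.cos_neg,
      Real.sin_neg, smul_eq_mul]
    push_cast
    ring
  rw [fourierCoeffOn_eq_integral, intervalIntegral.integral_of_le Real.two_pi_pos.le,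
    integral_Ioc_eq_integral_Ioo]
  simp only [hf]
  have h1 : IntegrableOn (fun x => ((w x * Real.cos (n * x) : ℝ) : ℂ))
    (Set.Ioo 0 (2 * Real.pi)) := hcos.ofReal
  have h2 : IntegrableOn (fun x => ((w x * Real.sin (n * x) : ℝ) : ℂ) * Complex.I)
    (Set.Ioo 0 (2 * Real.pi)) := hsin.ofReal.mul_const _
  rw [integral_sub h1 h2, integral_mul_const, integral_complex_ofReal, integral_complex_ofReal,
    norm_smul, mul_pow, Complex.sq_norm, Complex.normSq_apply]
  simp [abs_of_pos Real.pi_pos]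
  ring

/-- If the Fourier coefficients of `g` are those of the derivative of `h`, then `g` and `h` are
orthogonal. -/
theorem integral_mul_eq_zero_of_fourier {h g : ℝ → ℝ}
    (hh : MemLp h 2 (volume.restrict (Set.Ioo 0 (2 * Real.pi))))
    (hg : MemLp g 2 (volume.restrict (Set.Ioo 0 (2 * Real.pi))))
    (hc : ∀ n : ℤ, ∫ x in Set.Ioo 0 (2 * Real.pi), g x * Real.cos (n * x) =
      n * ∫ x in Set.Ioo 0 (2 * Real.pi), h x * Real.sin (n * x))
    (hs : ∀ n : ℤ, ∫ x in Set.Ioo 0 (2 * Real.pi), g x * Real.sin (n * x) =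
      -n * ∫ x in Set.Ioo 0 (2 * Real.pi), h x * Real.cos (n * x)) :
    ∫ x in Set.Ioo 0 (2 * Real.pi), h x * g x = 0 := by
  have hhi := hh.integrable one_le_two
  have hgi := hg.integrable one_le_two
  have bc : ∀ {f : ℝ → ℝ}, IntegrableOn f (Set.Ioo 0 (2 * Real.pi)) → ∀ n : ℤ,
      IntegrableOn (fun x => f x * Real.cos (n * x)) (Set.Ioo 0 (2 * Real.pi)) := fun hf n =>
    hf.mul_bdd (c := 1) (by fun_prop) (Eventually.of_forall fun x => Real.abs_cos_le_one _)
  have bs : ∀ {f : ℝ → ℝ}, IntegrableOn f (Set.Ioo 0 (2 * Real.pi)) → ∀ n : ℤ,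
      IntegrableOn (fun x => f x * Real.sin (n * x)) (Set.Ioo 0 (2 * Real.pi)) := fun hf n =>
    hf.mul_bdd (c := 1) (by fun_prop) (Eventually.of_forall fun x => Real.abs_sin_le_one _)
  have parseval : ∀ {w : ℝ → ℝ}, MemLp w 2 (volume.restrict (Set.Ioo 0 (2 * Real.pi))) →
      HasSum (fun n => ‖fourierCoeffOn Real.two_pi_pos (fun x => (w x : ℂ)) n‖ ^ 2)
        ((2 * Real.pi)⁻¹ * ∫ x in Set.Ioo 0 (2 * Real.pi), w x ^ 2) := by
    intro w hw
    have := hasSum_sq_fourierCoeffOn Real.two_pi_pos (f := fun x => (w x : ℂ))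
      (by rw [← restrict_Ioo_eq_restrict_Ioc]; exact hw.ofReal)
    rw [intervalIntegral.integral_of_le Real.two_pi_pos.le, integral_Ioc_eq_integral_Ioo] at this
    simpa [Complex.norm_real] using this
  -- Polarization: `ĝ(n) = i n ĥ(n)` differs from `ĥ(n)` by an imaginary factor, so `|ĝ + ĥ| = |ĝ -
  -- ĥ|` at every frequency. Parseval gives `‖g + h‖ = ‖g - h‖`, that is, `4 ∫ h g = 0`.
  have hp := parseval (hg.add hh)
  have hm := parseval (hg.sub hh)
  have heq : ∀ n : ℤ, ‖fourierCoeffOn Real.two_pi_pos (fun x => (((g + h) x : ℝ) : ℂ)) n‖ ^ 2 =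
      ‖fourierCoeffOn Real.two_pi_pos (fun x => (((g - h) x : ℝ) : ℂ)) n‖ ^ 2 := by
    intro n
    rw [normSq_fourierCoeffOn (hgi.add hhi), normSq_fourierCoeffOn (hgi.sub hhi)]
    simp only [Pi.add_apply, Pi.sub_apply, add_mul, sub_mul]
    rw [integral_add (bc hgi n) (bc hhi n), integral_add (bs hgi n) (bs hhi n),
      integral_sub (bc hgi n) (bc hhi n), integral_sub (bs hgi n) (bs hhi n), hc, hs]
    ring
  simp only [heq] at hp
  have h1 := mul_left_cancel₀ (by positivity) (hp.unique hm)
  have hi : ∀ {w : ℝ → ℝ}, MemLp w 2 (volume.restrict (Set.Ioo 0 (2 * Real.pi))) →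
      IntegrableOn (fun x => w x ^ 2) (Set.Ioo 0 (2 * Real.pi)) := fun hw => hw.integrable_sq
  have h2 : ∫ x in Set.Ioo 0 (2 * Real.pi), ((g + h) x ^ 2 - (g - h) x ^ 2) = 0 := by
    rw [integral_sub (hi (hg.add hh)) (hi (hg.sub hh)), h1, sub_self]
  have h3 : ∀ x, (g + h) x ^ 2 - (g - h) x ^ 2 = 4 * (h x * g x) := fun x => by
    simp only [Pi.add_apply, Pi.sub_apply]; ring
  simp only [h3, integral_const_mul] at h2
  linarith

theorem ae_memLp_slice {X Y : Type*} [MeasurableSpace X] [MeasurableSpace Y] {μ : Measure X}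
    {ν : Measure Y} [IsFiniteMeasure μ] [IsFiniteMeasure ν] {h : X × Y → ℝ}
    (hh : MemLp h 2 (μ.prod ν)) : ∀ᵐ y ∂ν, MemLp (fun x => h (x, y)) 2 μ := by
  filter_upwards [(hh.integrable one_le_two).prod_left_ae, hh.integrable_sq.prod_left_ae]
    with y h1 h2
  exact (memLp_two_iff_integrable_sq h1.aestronglyMeasurable).2 h2

/-- `∫ h ∂ₓh f = 0` if `f` does not depend on `x`. -/
theorem HasWeakPD.integral_mul_self_mul {h g : Pt → ℝ} (hw : HasWeakPD 0 h g)
    (hh : MemLp h 2 volΩ) (hg : MemLp g 2 volΩ) {f : Pt → ℝ} (hf : Continuous f)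
    (hfx : ∀ x y z, f (x, y, z) = f (0, y, z)) :
    ∫ p, h p * g p * f p ∂volΩ = 0 := by
  have hint : Integrable (fun p => h p * g p * f p) volΩ :=
    integrable_mul_continuous (hh.integrable_mul hg) hf
  have hhi := hh.integrable one_le_two
  have hgi := hg.integrable one_le_two
  -- Product test functions `A(x)B(y)C(z)`, with `B` and `C` used to separate the variables `(y,
  -- z)`, turn the weak derivative into integration by parts on almost every line parallel to the
  -- `x` axis.
  have trig : ∀ (A A' : ℝ → ℝ), ContDiff ℝ ∞ A → (∀ x, A (x + 2 * Real.pi) = A x) →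
      (∀ x, HasDerivAt A (A' x) x) → Continuous A' →
      ∀ᵐ s ∂(volume.restrict (Set.Ioo 0 (2 * Real.pi))).prod
        (volume.restrict (Set.Ioo (-1 : ℝ) 1)),
        ∫ x in Set.Ioo 0 (2 * Real.pi), h (x, s) * A' x =
          - ∫ x in Set.Ioo 0 (2 * Real.pi), g (x, s) * A x := by
    intro A A' hA hAp hAd hA'
    have h1 : Integrable (fun p : Pt => h p * A' p.1) volΩ :=
      integrable_mul_continuous hhi (by fun_prop)
    have h2 : Integrable (fun p : Pt => g p * A p.1) volΩ :=
      integrable_mul_continuous hgi (hA.continuous.comp continuous_fst)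
    have h3 : Integrable (fun p : Pt => h p * A' p.1 + g p * A p.1) volΩ := h1.add h2
    have hd : ∀ B ∈ sectionFamily,
        ∫ p : Pt, (h p * A' p.1 + g p * A p.1) * B p.2 ∂volΩ = 0 := by
      rintro _ ⟨B, hB, C, hC, rfl⟩
      have ht := isInteriorTest_of_prod hA hB.1 hC.1 hAp hB.2.1 hC.2.1
      have hpd : ∀ p : Pt, pd 0 (fun p => A p.1 * (B p.2.1 * C p.2.2)) p =
          A' p.1 * (B p.2.1 * C p.2.2) := fun ⟨x, y, z⟩ =>
        (hasDerivAt_fst ht.1.differentiable x y z).unique 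
          ((hAd x).mul_const (B y * C z))
      have := hw _ ht
      simp only [hpd] at this
      have e1 : Integrable (fun p : Pt => h p * (A' p.1 * (B p.2.1 * C p.2.2))) volΩ := by
        have := hB.1.continuous
        have := hC.1.continuous
        exact integrable_mul_continuous hhi (by fun_prop)
      have e2 := integrable_mul_continuous hgi ht.1.continuous
      rw [← sub_eq_zero, sub_neg_eq_add, ← integral_add e1 e2] at this
      rw [← this]
      exact integral_congr_ae (Eventually.of_forall fun p => by simp only; ring)
    rw [volΩ_eq] at h1 h2 h3 hd
    have hae := determining_sectionFamily _ h3.integral_prod_right (fun B hB => by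
      have hb := unitBounded_sectionFamily B hB
      have h4 : Integrable (fun p : Pt => (h p * A' p.1 + g p * A p.1) * B p.2) _ :=
        h3.mul_bdd (c := 1)
          (hb.1.comp measurable_snd).aestronglyMeasurable (Eventually.of_forall fun p => hb.2 _)
      refine Eq.trans ?_ (hd B hB)
      rw [integral_prod_symm _ h4]
      refine integral_congr_ae (Eventually.of_forall fun s => ?_)
      simp only [← integral_mul_const])
    filter_upwards [hae, h1.prod_left_ae, h2.prod_left_ae] with s hs i1 i2
    simp only [Pi.zero_apply] at hs
    rw [integral_add i1 i2] at hs
    linarith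
  have hcos : ∀ n : ℤ, ContDiff ℝ ∞ (fun x : ℝ => Real.cos (n * x)) := fun n => by fun_prop
  have hsin : ∀ n : ℤ, ContDiff ℝ ∞ (fun x : ℝ => Real.sin (n * x)) := fun n => by fun_prop
  have dcos : ∀ (n : ℤ) (x : ℝ), HasDerivAt (fun x : ℝ => Real.cos (n * x))
      (-n * Real.sin (n * x)) x := fun n x => by
    have := ((hasDerivAt_id x).const_mul (n : ℝ)).cos
    simpa [mul_comm] using this
  have dsin : ∀ (n : ℤ) (x : ℝ), HasDerivAt (fun x : ℝ => Real.sin (n * x))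
      (n * Real.cos (n * x)) x := fun n x => by
    have := ((hasDerivAt_id x).const_mul (n : ℝ)).sin
    simpa [mul_comm] using this
  have pcos : ∀ (n : ℤ) (x : ℝ), Real.cos (n * (x + 2 * Real.pi)) = Real.cos (n * x) :=
    fun n x => by rw [mul_add, Real.cos_add_int_mul_two_pi]
  have psin : ∀ (n : ℤ) (x : ℝ), Real.sin (n * (x + 2 * Real.pi)) = Real.sin (n * x) :=
    fun n x => by rw [mul_add, Real.sin_add_int_mul_two_pi]
  -- There are countably many frequencies, so almost every line carries the relations for all of
  -- them; on such a line `f` is a constant factor.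
  have hc := ae_all_iff.2 fun n : ℤ => trig _ _ (hcos n) (pcos n) (dcos n) (by fun_prop)
  have hs := ae_all_iff.2 fun n : ℤ => trig _ _ (hsin n) (psin n) (dsin n) (by fun_prop)
  rw [volΩ_eq] at hint hh hg ⊢
  rw [integral_prod_symm _ hint]
  refine integral_eq_zero_of_ae ?_
  filter_upwards [hc, hs, ae_memLp_slice hh, ae_memLp_slice hg] with s h1 h2 h3 h4
  have := integral_mul_eq_zero_of_fourier h3 h4 (fun n => ?_) fun n => ?_
  · simp only [Pi.zero_apply]
    have e : ∀ x, f (x, s) = f (0, s) := fun x => hfx x s.1 s.2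
    simp only [e, integral_mul_const, this, zero_mul]
  · rw [← neg_inj, ← h1 n, ← neg_mul, ← integral_const_mul]
    congr 1; ext x; ring
  · rw [← neg_inj, ← h2 n, neg_mul, neg_neg, ← integral_const_mul]
    congr 1; ext x; ring

end NSChannel

namespace NSChannel

/-! ### Fields with a single non-vanishing component -/

/-- The field `(f, 0, 0)`. -/
def scalarField (f : Pt → ℝ) : Field := fun i p => if i = 0 then f p else 0

/-- The gradient of `(f, 0, 0)` if `g` is the gradient of `f`. -/
def scalarGrad (g : Fin 3 → Pt → ℝ) : MField := fun i j p => if i = 0 then g j p else 0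

/-- The boundary field `(t, 0, 0)`. -/
def scalarTrace (t : Bool → ℝ × ℝ → ℝ) : BField := fun b i s => if i = 0 then t b s else 0

/-- The vertical coordinate of the faces of `Γ`. -/
def height (b : Bool) : ℝ := if b then 1 else -1

/-- Boundary values of a continuous function. -/
def boundaryValue (f : Pt → ℝ) : Bool → ℝ × ℝ → ℝ := fun b s => f (s.1, s.2, height b)

/-- The symmetric bilinear form of the Stokes operator with Navier boundary conditions. -/
noncomputable def form (β : ℝ) (G : MField) (τ : BField) (Φ : MField) (σ : BField) : ℝ :=
  2 * ipM (strain G) (strain Φ) + β * ipΓ τ σ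

theorem ip_scalarField_left (f : Pt → ℝ) (φ : Field) :
    ip (scalarField f) φ = ∫ p, f p * φ 0 p ∂volΩ := by
  simp [ip, scalarField]

theorem ip_scalarField_right (f : Pt → ℝ) (φ : Field) :
    ip φ (scalarField f) = ∫ p, φ 0 p * f p ∂volΩ := by
  simp [ip, scalarField]

theorem ipΓ_scalarTrace_left (t : Bool → ℝ × ℝ → ℝ) (σ : BField) :
    ipΓ (scalarTrace t) σ = ∑ b, ∫ s, t b s * σ b 0 s ∂volΓ := by
  simp [ipΓ, scalarTrace]

theorem two_mul_ipM_strain_scalarGrad {g : Fin 3 → Pt → ℝ} (h0 : ∀ p, g 0 p = 0) (Φ : MField) :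
    2 * ipM (strain (scalarGrad g)) (strain Φ) =
      ∫ p, (g 1 p * (Φ 0 1 p + Φ 1 0 p) + g 2 p * (Φ 0 2 p + Φ 2 0 p)) ∂volΩ := by
  rw [ipM, ← integral_const_mul]
  congr 1; ext p
  simp [strain, scalarGrad, Fin.sum_univ_three, h0]
  ring

theorem memLp_scalarField {f : Pt → ℝ} (hf : MemLp f 2 volΩ) (i : Fin 3) :
    MemLp (scalarField f i) 2 volΩ := by
  by_cases hi : i = 0
  · subst hi; exact hf
  · rw [show scalarField f i = fun _ => 0 from funext fun p => if_neg hi]; exact MemLp.zero'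

theorem memLp_scalarGrad {g : Fin 3 → Pt → ℝ} (hg : ∀ j, MemLp (g j) 2 volΩ) (i j : Fin 3) :
    MemLp (scalarGrad g i j) 2 volΩ := by
  by_cases hi : i = 0
  · subst hi; exact hg j
  · rw [show scalarGrad g i j = fun _ => 0 from funext fun p => if_neg hi]; exact MemLp.zero'

theorem memLp_scalarTrace {t : Bool → ℝ × ℝ → ℝ} (ht : ∀ b, MemLp (t b) 2 volΓ) (b : Bool)
    (i : Fin 3) : MemLp (scalarTrace t b i) 2 volΓ := by
  by_cases hi : i = 0
  · subst hi; exact ht b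
  · rw [show scalarTrace t b i = fun _ => 0 from funext fun p => if_neg hi]; exact MemLp.zero'

theorem isVP_scalar {f : Pt → ℝ} {g : Fin 3 → Pt → ℝ} {t : Bool → ℝ × ℝ → ℝ}
    (hf : MemLp f 2 volΩ) (hg : ∀ j, MemLp (g j) 2 volΩ) (ht : ∀ b, MemLp (t b) 2 volΓ)
    (hdiv : ∀ φ, IsTest φ → ∫ p, f p * pd 0 φ p ∂volΩ = 0)
    (hgrad : ∀ j, HasWeakPD j f (g j))
    (htr : ∀ φ, IsTest φ → ∫ p, (f p * pd 2 φ p + g 2 p * φ p) ∂volΩ =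
      ∫ s, (t true s * φ (s.1, s.2, 1) - t false s * φ (s.1, s.2, -1)) ∂volΓ) :
    IsVP (scalarField f) (scalarGrad g) (scalarTrace t) := by
  refine ⟨⟨memLp_scalarField hf, fun φ hφ => ?_⟩,
    ⟨memLp_scalarField hf, memLp_scalarGrad hg, fun i j φ hφ => ?_⟩,
    memLp_scalarTrace ht, fun i φ hφ => ?_⟩
  · simp [Fin.sum_univ_three, scalarField, hdiv φ hφ]
  · by_cases hi : i = 0
    · simpa [scalarField, scalarGrad, hi] using hgrad j φ hφ
    · simp [scalarField, scalarGrad, hi]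
  · by_cases hi : i = 0
    · simpa [scalarField, scalarGrad, scalarTrace, hi] using htr φ hφ
    · simp [scalarField, scalarGrad, scalarTrace, hi]

theorem pd_zero_of_indep {f : Pt → ℝ} (hf : Differentiable ℝ f)
    (h : ∀ x y z, f (x, y, z) = f (0, y, z)) (p : Pt) : pd 0 f p = 0 := by
  obtain ⟨x, y, z⟩ := p
  have h1 := hasDerivAt_fst hf x y z
  simp only [h _ y z] at h1
  exact h1.unique (hasDerivAt_const x _)

theorem pd_indep {f : Pt → ℝ} (h : ∀ x y z, f (x, y, z) = f (0, y, z)) (j : Fin 3)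
    (x y z : ℝ) : pd j f (x, y, z) = pd j f (0, y, z) := by
  have h' : (fun p : Pt => f (p + (x, 0, 0))) = f := by
    ext ⟨a, y, z⟩; simp [h (a + x) y z, h a y z]
  have := fderiv_comp_add_right (𝕜 := ℝ) (f := f) (x := (0, y, z)) (x, 0, 0)
  rw [h'] at this
  simp only [pd, this]
  simp

/-- `f` depends on `(y, z)` only, `-Δf = h`, and `(f, 0, 0)` satisfies the Navier boundary
conditions. -/
structure IsRobin (β : ℝ) (f h : Pt → ℝ) : Prop where
  isTest : IsTest f
  indep : ∀ x y z, f (x, y, z) = f (0, y, z)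
  laplace : ∀ p, pd 1 (pd 1 f) p + pd 2 (pd 2 f) p = -h p
  top : ∀ x y, pd 2 f (x, y, 1) = -β * f (x, y, 1)
  bot : ∀ x y, pd 2 f (x, y, -1) = β * f (x, y, -1)

theorem isVP_of_isTest {f : Pt → ℝ} (hf : IsTest f) (hi : ∀ x y z, f (x, y, z) = f (0, y, z)) :
    IsVP (scalarField f) (scalarGrad fun j => pd j f) (scalarTrace (boundaryValue f)) := by
  refine isVP_scalar (memLp_of_continuous hf.continuous)
    (fun j => memLp_of_continuous (hf.continuous_pd j))
    (fun b => memLp_of_continuous_square (hf.continuous.comp (by fun_prop)))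
    (fun φ hφ => ?_) hf.hasWeakPD fun φ hφ => ?_
  · rw [integral_mul_pd_of_ne_two hf hφ (by decide)]
    simp [pd_zero_of_indep hf.differentiable hi]
  · simpa [boundaryValue, height] using integral_mul_pd_two hf hφ

theorem IsRobin.isVP {β : ℝ} {f h : Pt → ℝ} (hf : IsRobin β f h) :
    IsVP (scalarField f) (scalarGrad fun j => pd j f) (scalarTrace (boundaryValue f)) :=
  isVP_of_isTest hf.isTest hf.indep

theorem IsRobin.sum {β : ℝ} {ι : Type*} {f h : ι → Pt → ℝ} (s : Finset ι) (α : ι → ℝ)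
    (hf : ∀ m, IsRobin β (f m) (h m)) :
    IsRobin β (fun p => ∑ m ∈ s, α m * f m p) fun p => ∑ m ∈ s, α m * h m p := by
  have hpd : ∀ (k : ι → Pt → ℝ), (∀ m, IsTest (k m)) → ∀ j,
      pd j (fun p => ∑ m ∈ s, α m * k m p) = fun p => ∑ m ∈ s, α m * pd j (k m) p := by
    intro k hk j
    ext p
    rw [pd_sum s fun m _ => ((hk m).const_mul (α m)).differentiable]
    exact Finset.sum_congr rfl fun m _ => pd_const_mul (hk m).differentiable _ _ _
  refine ⟨IsTest.sum s fun m _ => (hf m).isTest.const_mul _, fun x y z => ?_, fun p => ?_,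
    fun x y => ?_, fun x y => ?_⟩
  · exact Finset.sum_congr rfl fun m _ => by rw [(hf m).indep]
  · rw [hpd f (fun m => (hf m).isTest), hpd f (fun m => (hf m).isTest),
      hpd _ (fun m => (hf m).isTest.pd 1), hpd _ (fun m => (hf m).isTest.pd 2),
      ← Finset.sum_add_distrib, ← Finset.sum_neg_distrib]
    exact Finset.sum_congr rfl fun m _ => by rw [← mul_add, (hf m).laplace]; ring
  · rw [hpd f fun m => (hf m).isTest, Finset.mul_sum]
    exact Finset.sum_congr rfl fun m _ => by rw [(hf m).top]; ring
  · rw [hpd f fun m => (hf m).isTest, Finset.mul_sum]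
    exact Finset.sum_congr rfl fun m _ => by rw [(hf m).bot]; ring

/-- Green's formula for the Stokes form. -/
theorem IsRobin.form_eq {β : ℝ} {f h : Pt → ℝ} (hf : IsRobin β f h) {φ : Field} {Φ : MField}
    {σ : BField} (hφ : IsH1 φ Φ) (hσ : HasTrace φ Φ σ) :
    form β (scalarGrad fun j => pd j f) (scalarTrace (boundaryValue f)) Φ σ =
      ∫ p, h p * φ 0 p ∂volΩ := by
  have ft := hf.isTest
  have iφ : ∀ i, Integrable (φ i) volΩ := fun i => (hφ.1 i).integrable one_le_two
  have iΦ : ∀ i j, Integrable (Φ i j) volΩ := fun i j => (hφ.2.1 i j).integrable one_le_two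
  have iσ : ∀ b i, Integrable (σ b i) volΓ := fun b i => (hσ.1 b i).integrable one_le_two
  -- The derivatives `∂ₓ∂ⱼf` vanish, so integration by parts in `x` removes the transposed entries
  -- `Φ 1 0` and `Φ 2 0`. Only the Laplacian of `f` survives, although the form contains the
  -- symmetrized gradient; no divergence condition on `φ` is used.
  have hx : ∀ j p, pd 0 (pd j f) p = 0 := fun j =>
    pd_zero_of_indep (ft.pd j).differentiable (pd_indep hf.indep j)
  have h01 := (hφ.2.2 0 1).integral_mul_pd (by decide) (iφ 0) (iΦ 0 1) (ft.pd 1)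
  have h10 := (hφ.2.2 1 0).integral_mul_pd (by decide) (iφ 1) (iΦ 1 0) (ft.pd 1)
  have h20 := (hφ.2.2 2 0).integral_mul_pd (by decide) (iφ 2) (iΦ 2 0) (ft.pd 2)
  have h02 := hσ.2 0 _ (ft.pd 2)
  simp only [hx, mul_zero, integral_zero] at h10 h20
  have I01 := integrable_mul_continuous (iΦ 0 1) (ft.continuous_pd 1)
  have I10 := integrable_mul_continuous (iΦ 1 0) (ft.continuous_pd 1)
  have I20 := integrable_mul_continuous (iΦ 2 0) (ft.continuous_pd 2)
  have I02 := integrable_mul_continuous (iΦ 0 2) (ft.continuous_pd 2)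
  have J1 := integrable_mul_continuous (iφ 0) ((ft.pd 1).continuous_pd 1)
  have J2 := integrable_mul_continuous (iφ 0) ((ft.pd 2).continuous_pd 2)
  have bd : ∀ b, Integrable (fun s => boundaryValue f b s * σ b 0 s) volΓ := fun b =>
    (memLp_of_continuous_square (q := 2) (ft.continuous.comp
      (g := f) (f := fun s : ℝ × ℝ => (s.1, s.2, height b)) (by fun_prop))).integrable_mul (hσ.1 b 0)
  rw [integral_add J2 I02] at h02
  rw [form, two_mul_ipM_strain_scalarGrad (pd_zero_of_indep ft.differentiable hf.indep),
    ipΓ_scalarTrace_left, Fintype.sum_bool]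
  have e1 : ∫ p, (pd 1 f p * (Φ 0 1 p + Φ 1 0 p) + pd 2 f p * (Φ 0 2 p + Φ 2 0 p)) ∂volΩ =
      ∫ p, Φ 0 1 p * pd 1 f p ∂volΩ + ∫ p, Φ 1 0 p * pd 1 f p ∂volΩ +
        (∫ p, Φ 0 2 p * pd 2 f p ∂volΩ + ∫ p, Φ 2 0 p * pd 2 f p ∂volΩ) := by
    have K1 : Integrable (fun p => Φ 0 1 p * pd 1 f p + Φ 1 0 p * pd 1 f p) volΩ := I01.add I10
    have K2 : Integrable (fun p => Φ 0 2 p * pd 2 f p + Φ 2 0 p * pd 2 f p) volΩ := I02.add I20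
    rw [← integral_add I01 I10, ← integral_add I02 I20, ← integral_add K1 K2]
    exact integral_congr_ae (Eventually.of_forall fun p => by simp only; ring)
  have e2 : ∫ p, h p * φ 0 p ∂volΩ =
      - (∫ p, φ 0 p * pd 1 (pd 1 f) p ∂volΩ + ∫ p, φ 0 p * pd 2 (pd 2 f) p ∂volΩ) := by
    rw [← integral_add J1 J2, ← integral_neg]
    refine integral_congr_ae (Eventually.of_forall fun p => ?_)
    simp only
    rw [← mul_add, hf.laplace]; ring
  -- By the Robin conditions the trace term of Green's formula in `z` is cancelled by the boundary
  -- part of the form.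
  have e3 : ∫ s, (σ true 0 s * pd 2 f (s.1, s.2, 1) - σ false 0 s * pd 2 f (s.1, s.2, -1)) ∂volΓ =
      -β * (∫ s, boundaryValue f true s * σ true 0 s ∂volΓ +
        ∫ s, boundaryValue f false s * σ false 0 s ∂volΓ) := by
    rw [← integral_add (bd true) (bd false), ← integral_const_mul]
    refine integral_congr_ae (Eventually.of_forall fun s => ?_)
    simp only [hf.top, hf.bot, boundaryValue, height]
    simp
    ring
  rw [e3] at h02
  rw [e1, e2]
  linarith

/-! ### Quadratic forms of differences and the convective estimate -/

theorem memLp_strain {G : MField} (hG : ∀ i j, MemLp (G i j) 2 volΩ) (i j : Fin 3) :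
    MemLp (strain G i j) 2 volΩ := by
  have := ((hG i j).add (hG j i)).const_mul (1 / 2 : ℝ)
  refine this.ae_eq (Eventually.of_forall fun p => ?_)
  simp [strain]; ring

theorem integrable_ipM {M N : MField} (hM : ∀ i j, MemLp (M i j) 2 volΩ)
    (hN : ∀ i j, MemLp (N i j) 2 volΩ) :
    Integrable (fun p => ∑ i, ∑ j, M i j p * N i j p) volΩ :=
  integrable_finsetSum _ fun i _ => integrable_finsetSum _ fun j _ =>
    (hM i j).integrable_mul (hN i j)

theorem integrable_ip {u φ : Field} (hu : ∀ i, MemLp (u i) 2 volΩ)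
    (hφ : ∀ i, MemLp (φ i) 2 volΩ) : Integrable (fun p => ∑ i, u i p * φ i p) volΩ :=
  integrable_finsetSum _ fun i _ => (hu i).integrable_mul (hφ i)

theorem integrable_ipΓ {τ σ : BField} (hτ : ∀ b i, MemLp (τ b i) 2 volΓ)
    (hσ : ∀ b i, MemLp (σ b i) 2 volΓ) (b : Bool) :
    Integrable (fun s => τ b 0 s * σ b 0 s + τ b 1 s * σ b 1 s) volΓ :=
  ((hτ b 0).integrable_mul (hσ b 0)).add ((hτ b 1).integrable_mul (hσ b 1))

theorem ipM_self_nonneg (G : MField) : 0 ≤ ipM G G :=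
  integral_nonneg fun _ => Finset.sum_nonneg fun _ _ => Finset.sum_nonneg fun _ _ =>
    mul_self_nonneg _

theorem ip_self_nonneg (u : Field) : 0 ≤ ip u u :=
  integral_nonneg fun _ => Finset.sum_nonneg fun _ _ => mul_self_nonneg _

theorem ipΓ_self_nonneg (τ : BField) : 0 ≤ ipΓ τ τ :=
  Finset.sum_nonneg fun _ _ => integral_nonneg fun _ =>
    add_nonneg (mul_self_nonneg _) (mul_self_nonneg _)

theorem integral_sub_two_mul_add {X : Type*} [MeasurableSpace X] {μ : Measure X}
    {f g h k : X → ℝ} (hf : Integrable f μ) (hg : Integrable g μ) (hh : Integrable h μ)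
    (e : ∀ x, k x = f x - 2 * g x + h x) :
    ∫ x, k x ∂μ = ∫ x, f x ∂μ - 2 * ∫ x, g x ∂μ + ∫ x, h x ∂μ := by
  have h1 : Integrable (fun x => f x - 2 * g x) μ := hf.sub (hg.const_mul 2)
  rw [funext e, integral_add h1 hh, integral_sub hf (hg.const_mul 2), integral_const_mul]

theorem ipM_sub_self {M N : MField} (hM : ∀ i j, MemLp (M i j) 2 volΩ)
    (hN : ∀ i j, MemLp (N i j) 2 volΩ) :
    ipM (fun i j p => M i j p - N i j p) (fun i j p => M i j p - N i j p) =
      ipM M M - 2 * ipM N M + ipM N N := by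
  simp only [ipM]
  exact integral_sub_two_mul_add (integrable_ipM hM hM) (integrable_ipM hN hM)
    (integrable_ipM hN hN) fun p => by simp only [Fin.sum_univ_three]; ring

theorem ip_sub_self {u φ : Field} (hu : ∀ i, MemLp (u i) 2 volΩ)
    (hφ : ∀ i, MemLp (φ i) 2 volΩ) :
    ip (fun i p => u i p - φ i p) (fun i p => u i p - φ i p) =
      ip u u - 2 * ip u φ + ip φ φ := by
  simp only [ip]
  exact integral_sub_two_mul_add (integrable_ip hu hu) (integrable_ip hu hφ)
    (integrable_ip hφ hφ) fun p => by simp only [Fin.sum_univ_three]; ring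

theorem ipΓ_sub_self {τ σ : BField} (hτ : ∀ b i, MemLp (τ b i) 2 volΓ)
    (hσ : ∀ b i, MemLp (σ b i) 2 volΓ) :
    ipΓ (fun b i s => τ b i s - σ b i s) (fun b i s => τ b i s - σ b i s) =
      ipΓ τ τ - 2 * ipΓ σ τ + ipΓ σ σ := by
  simp only [ipΓ]
  rw [Finset.mul_sum, ← Finset.sum_sub_distrib, ← Finset.sum_add_distrib]
  refine Finset.sum_congr rfl fun b _ => ?_
  exact integral_sub_two_mul_add (integrable_ipΓ hτ hτ b) (integrable_ipΓ hσ hτ b)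
    (integrable_ipΓ hσ hσ b) fun s => by ring

theorem form_sub_self (β : ℝ) {M N : MField} {τ σ : BField}
    (hM : ∀ i j, MemLp (M i j) 2 volΩ) (hN : ∀ i j, MemLp (N i j) 2 volΩ)
    (hτ : ∀ b i, MemLp (τ b i) 2 volΓ) (hσ : ∀ b i, MemLp (σ b i) 2 volΓ) :
    form β (fun i j p => M i j p - N i j p) (fun b i s => τ b i s - σ b i s)
      (fun i j p => M i j p - N i j p) (fun b i s => τ b i s - σ b i s) =
      form β M τ M τ - 2 * form β N σ M τ + form β N σ N σ := by
  have hs : strain (fun i j p => M i j p - N i j p) =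
      fun i j p => strain M i j p - strain N i j p := by
    ext i j p; simp only [strain]; ring
  rw [form, hs, ipM_sub_self (memLp_strain hM) (memLp_strain hN), ipΓ_sub_self hτ hσ, form, form,
    form]
  ring

theorem form_self_nonneg {β : ℝ} (hβ : 0 < β) (G : MField) (τ : BField) : 0 ≤ form β G τ G τ :=
  add_nonneg (mul_nonneg zero_le_two (ipM_self_nonneg _)) (mul_nonneg hβ.le (ipΓ_self_nonneg _))

/-- Expansion of the energy of the difference of a field and `(f, 0, 0)`. -/
theorem IsRobin.form_sub_self {β : ℝ} {f h : Pt → ℝ} (hf : IsRobin β f h) {u : Field} {G : MField}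
    {τ : BField} (hu : IsVP u G τ) :
    form β (fun i j p => G i j p - scalarGrad (fun j => pd j f) i j p)
      (fun b i s => τ b i s - scalarTrace (boundaryValue f) b i s)
      (fun i j p => G i j p - scalarGrad (fun j => pd j f) i j p)
      (fun b i s => τ b i s - scalarTrace (boundaryValue f) b i s) =
      form β G τ G τ - 2 * ∫ p, h p * u 0 p ∂volΩ + ∫ p, h p * f p ∂volΩ := by
  have hv := hf.isVP
  rw [NSChannel.form_sub_self β hu.2.1.2.1 hv.2.1.2.1 hu.2.2.1 hv.2.2.1,
    hf.form_eq hu.2.1 hu.2.2, hf.form_eq hv.2.1 hv.2.2]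
  simp [scalarField]

theorem HasWeakPD.sub {i : Fin 3} {f g f' g' : Pt → ℝ} (hf : HasWeakPD i f f')
    (hg : HasWeakPD i g g') (If : Integrable f volΩ) (Ig : Integrable g volΩ)
    (If' : Integrable f' volΩ) (Ig' : Integrable g' volΩ) :
    HasWeakPD i (fun p => f p - g p) fun p => f' p - g' p := by
  intro φ hφ
  simp only [sub_mul]
  rw [integral_sub (integrable_mul_continuous If (hφ.1.continuous_pd i))
    (integrable_mul_continuous Ig (hφ.1.continuous_pd i)),
    integral_sub (integrable_mul_continuous If' hφ.1.continuous)
    (integrable_mul_continuous Ig' hφ.1.continuous), hf φ hφ, hg φ hφ]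
  ring

/-- Estimate of the convective term tested with a field `(f, 0, 0)` depending on `(y, z)` only. -/
theorem IsRobin.ip_conv_le {β : ℝ} (hβ : 0 < β) {f h : Pt → ℝ} (hf : IsRobin β f h) {u : Field}
    {G : MField} {τ : BField} (hu : IsVP u G τ) {M : ℝ} (hM : ∀ p, |f p| ≤ M) :
    ip (conv u G) (scalarField f) ≤
      form β G τ G τ - 2 * (∫ p, h p * u 0 p ∂volΩ) + ∫ p, h p * f p ∂volΩ +
      M ^ 2 / 2 * (ip u u - 2 * (∫ p, u 0 p * f p ∂volΩ) + ∫ p, f p * f p ∂volΩ) := by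
  have ft := hf.isTest
  have hv := hf.isVP
  have hM0 : 0 ≤ M := (abs_nonneg _).trans (hM 0)
  rw [← hf.form_sub_self hu]
  have hip := ip_sub_self hu.1.1 hv.1.1
  rw [ip_scalarField_right, ip_scalarField_left] at hip
  simp only [show scalarField f 0 = f from rfl] at hip
  rw [← hip]
  set v := scalarField f with hvdef
  set Γ := scalarGrad fun j => pd j f with hΓdef
  set z : Field := fun i p => u i p - v i p with hz
  set D : MField := fun i j p => G i j p - Γ i j p with hD
  have zL : ∀ i, MemLp (z i) 2 volΩ := fun i => (hu.1.1 i).sub (hv.1.1 i)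
  have DL : ∀ i j, MemLp (D i j) 2 volΩ := fun i j => (hu.2.1.2.1 i j).sub (hv.2.1.2.1 i j)
  have hzw : ∀ i j, HasWeakPD j (z i) (D i j) := fun i j =>
    (hu.2.1.2.2 i j).sub (hv.2.1.2.2 i j) ((hu.1.1 i).integrable one_le_two)
      ((hv.1.1 i).integrable one_le_two) ((hu.2.1.2.1 i j).integrable one_le_two)
      ((hv.2.1.2.1 i j).integrable one_le_two)
  have f0 : ∀ p, pd 0 f p = 0 := pd_zero_of_indep ft.differentiable hf.indep
  -- Integration by parts in `x`: `f²` does not depend on `x`.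
  have I3 : ∫ p, G 0 0 p * (f p * f p) ∂volΩ = 0 := by
    have := (hu.2.1.2.2 0 0).integral_mul_pd (by decide) ((hu.1.1 0).integrable one_le_two)
      ((hu.2.1.2.1 0 0).integrable one_le_two) (ft.mul ft)
    simp only [pd_mul ft.differentiable ft.differentiable, f0, mul_zero, zero_mul, add_zero,
      integral_zero] at this
    linarith
  have hzc : ∀ j, Integrable (fun p => z j p * (f p * pd j f p)) volΩ := fun j =>
    integrable_mul_continuous ((zL j).integrable one_le_two) (ft.continuous.mul (ft.continuous_pd j))
  -- Both `u` and `(f, 0, 0)` lie in `H`, so their difference is orthogonal to `∇(f²)/2 = f ∇f`.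
  have I2 : ∑ j, ∫ p, z j p * (f p * pd j f p) ∂volΩ = 0 := by
    have h1 := hu.1.2 _ (ft.mul ft)
    have h2 := hv.1.2 _ (ft.mul ft)
    have h3 : ∀ j, ∫ p, z j p * (f p * pd j f p) ∂volΩ = 1 / 2 *
        (∫ p, u j p * pd j (fun p => f p * f p) p ∂volΩ -
          ∫ p, v j p * pd j (fun p => f p * f p) p ∂volΩ) := by
      intro j
      rw [← integral_sub (integrable_mul_continuous ((hu.1.1 j).integrable one_le_two)
        ((ft.mul ft).continuous_pd j)) (integrable_mul_continuous ((hv.1.1 j).integrable one_le_two)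
        ((ft.mul ft).continuous_pd j)), ← integral_const_mul]
      congr 1; ext p
      rw [pd_mul ft.differentiable ft.differentiable, hz]
      ring
    rw [Finset.sum_congr rfl fun j _ => h3 j, ← Finset.mul_sum, Finset.sum_sub_distrib, h1, h2]
    ring
  -- The integrand is `½ ∂ₓ(zⱼ²)` times a function of `(y, z)`.
  have I1 : ∀ j, ∫ p, z j p * D j 0 p * f p ∂volΩ = 0 := fun j =>
    (hzw j 0).integral_mul_self_mul (zL j) (DL j 0) ft.continuous hf.indep
  have hzD : ∀ j, Integrable (fun p => z j p * D j 0 p * f p) volΩ := fun j =>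
    integrable_mul_continuous ((zL j).integrable_mul (DL j 0)) ft.continuous
  have hzS : ∀ j, Integrable (fun p => z j p * strain D 0 j p * f p) volΩ := fun j =>
    integrable_mul_continuous ((zL j).integrable_mul (memLp_strain DL 0 j)) ft.continuous
  have hGf : Integrable (fun p => G 0 0 p * (f p * f p)) volΩ :=
    integrable_mul_continuous ((hu.2.1.2.1 0 0).integrable one_le_two)
      (ft.continuous.mul ft.continuous)
  -- Write `u = z + (f, 0, 0)` and replace `∂ⱼz₀` by twice the strain minus `∂ₓzⱼ`. All terms but
  -- the first integrate to zero, so only the strain of `z` has to be controlled.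
  have hpt : ∀ p, ∑ i, conv u G i p * v i p = 2 * (∑ j, z j p * strain D 0 j p * f p) -
      (∑ j, z j p * D j 0 p * f p) + (∑ j, z j p * (f p * pd j f p)) +
      G 0 0 p * (f p * f p) := by
    intro p
    simp [conv, hvdef, hz, hD, hΓdef, scalarField, scalarGrad, strain, Fin.sum_univ_three, f0]
    ring
  have key : ip (conv u G) v = ∫ p, 2 * (∑ j, z j p * strain D 0 j p * f p) ∂volΩ := by
    have s1 : Integrable (fun p => 2 * ∑ j, z j p * strain D 0 j p * f p) volΩ :=
      (integrable_finsetSum _ fun j _ => hzS j).const_mul 2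
    have s2 : Integrable (fun p => ∑ j, z j p * D j 0 p * f p) volΩ :=
      integrable_finsetSum _ fun j _ => hzD j
    have s3 : Integrable (fun p => ∑ j, z j p * (f p * pd j f p)) volΩ :=
      integrable_finsetSum _ fun j _ => hzc j
    simp only [ip, hpt]
    rw [integral_add ((s1.sub s2).add s3 : Integrable (fun p => _ - _ + _) _) hGf,
      integral_add (s1.sub s2 : Integrable (fun p => _ - _) _) s3, integral_sub s1 s2, I3,
      integral_finsetSum _ fun j _ => hzc j, I2, integral_finsetSum _ fun j _ => hzD j]
    simp [I1]
  rw [key]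
  have hle : ∫ p, 2 * (∑ j, z j p * strain D 0 j p * f p) ∂volΩ ≤
      ∫ p, (2 * (∑ i, ∑ j, strain D i j p * strain D i j p) +
        M ^ 2 / 2 * ∑ i, z i p * z i p) ∂volΩ := by
    refine integral_mono ((integrable_finsetSum _ fun j _ => hzS j).const_mul 2)
      (((integrable_ipM (memLp_strain DL) (memLp_strain DL)).const_mul 2).add
        ((integrable_ip zL zL).const_mul _)) fun p => ?_
    -- Young's inequality with the constant that matches the factor `2` in front of the squared
    -- strain in `form`; the other two rows of the strain are simply added, being nonnegative.
    have hj : ∀ j, 2 * (z j p * strain D 0 j p * f p) ≤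
        2 * (strain D 0 j p * strain D 0 j p) + M ^ 2 / 2 * (z j p * z j p) := by
      intro j
      have hf2 : f p ^ 2 ≤ M ^ 2 := sq_le_sq' (by linarith [(abs_le.1 (hM p)).1])
        (abs_le.1 (hM p)).2
      nlinarith [sq_nonneg (2 * strain D 0 j p - z j p * f p),
        mul_nonneg (sub_nonneg.2 hf2) (sq_nonneg (z j p))]
    have h0 : 0 ≤ ∑ j, strain D 1 j p * strain D 1 j p :=
      Finset.sum_nonneg fun j _ => mul_self_nonneg _
    have h1 : 0 ≤ ∑ j, strain D 2 j p * strain D 2 j p :=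
      Finset.sum_nonneg fun j _ => mul_self_nonneg _
    have hsum := Finset.sum_le_sum fun j (_ : j ∈ Finset.univ) => hj j
    rw [← Finset.mul_sum, Finset.sum_add_distrib, ← Finset.mul_sum, ← Finset.mul_sum] at hsum
    simp only [Fin.sum_univ_three (fun i => ∑ j, strain D i j p * strain D i j p)]
    linarith
  refine hle.trans ?_
  rw [integral_add ((integrable_ipM (memLp_strain DL) (memLp_strain DL)).const_mul 2)
    ((integrable_ip zL zL).const_mul _), integral_const_mul, integral_const_mul, form, ipM, ip]
  have := mul_nonneg hβ.le (ipΓ_self_nonneg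
    fun b i s => τ b i s - scalarTrace (boundaryValue f) b i s)
  linarith

end NSChannel

namespace NSChannel

/-! ### Families of eigenfunctions -/

/-- An orthonormal family of eigenfunctions `(E m, 0, 0)` of the Stokes operator, depending on
`(y, z)` only. -/
structure ModeFamily (β : ℝ) {ι : Type*} (E : ι → Pt → ℝ) (Λ : ι → ℝ) : Prop where
  robin : ∀ m, IsRobin β (E m) fun p => Λ m * E m p
  bound : ∀ m p, |E m p| ≤ 1
  bound_pd : ∀ m j p, |pd j (E m) p| ≤ Λ m
  one_le : ∀ m, 1 ≤ Λ m
  summable : Summable fun m => ((Λ m) ^ 2)⁻¹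
  norm_eq : ∀ m, ∫ p, E m p * E m p ∂volΩ = 1
  ortho : ∀ m m', m ≠ m' → ∫ p, E m p * E m' p ∂volΩ = 0

/-- Fourier coefficients with respect to a family of functions. -/
noncomputable def coeff {ι : Type*} (E : ι → Pt → ℝ) (f : Pt → ℝ) (m : ι) : ℝ :=
  ∫ p, E m p * f p ∂volΩ

variable {β : ℝ} {ι : Type*} {E : ι → Pt → ℝ} {Λ : ι → ℝ}

theorem ModeFamily.continuous (hE : ModeFamily β E Λ) (m : ι) : Continuous (E m) :=
  (hE.robin m).isTest.continuous

theorem ModeFamily.integrable_mul (hE : ModeFamily β E Λ) (m : ι) {f : Pt → ℝ}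
    (hf : Integrable f volΩ) : Integrable (fun p => E m p * f p) volΩ := by
  simpa only [mul_comm] using integrable_mul_continuous hf (hE.continuous m)

theorem ModeFamily.integral_sum_mul (hE : ModeFamily β E Λ) (F : Finset ι) (α : ι → ℝ)
    {f : Pt → ℝ} (hf : Integrable f volΩ) :
    ∫ p, (∑ m ∈ F, α m * E m p) * f p ∂volΩ = ∑ m ∈ F, α m * coeff E f m := by
  simp only [Finset.sum_mul, mul_assoc, coeff]
  rw [integral_finsetSum _ fun m _ => (hE.integrable_mul m hf).const_mul _]
  simp only [integral_const_mul]

theorem ModeFamily.coeff_sum (hE : ModeFamily β E Λ) (F : Finset ι) (α : ι → ℝ) {m : ι}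
    (hm : m ∈ F) : coeff E (fun p => ∑ m ∈ F, α m * E m p) m = α m := by
  classical
  rw [coeff]
  simp only [mul_comm (E m _)]
  rw [hE.integral_sum_mul F α (integrable_of_continuous (hE.continuous m)),
    Finset.sum_eq_single_of_mem m hm fun m' _ h => by
      rw [coeff, hE.ortho _ _ h, mul_zero], coeff, hE.norm_eq, mul_one]

theorem ModeFamily.continuous_sum (hE : ModeFamily β E Λ) (F : Finset ι) (α : ι → ℝ) :
    Continuous fun p => ∑ m ∈ F, α m * E m p :=
  continuous_finsetSum _ fun m _ => continuous_const.mul (hE.continuous m)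

theorem ModeFamily.integral_sum_mul_sum (hE : ModeFamily β E Λ) (F : Finset ι) (a α : ι → ℝ) :
    ∫ p, (∑ m ∈ F, a m * E m p) * (∑ m ∈ F, α m * E m p) ∂volΩ = ∑ m ∈ F, a m * α m := by
  rw [hE.integral_sum_mul F a (integrable_of_continuous (hE.continuous_sum F α))]
  exact Finset.sum_congr rfl fun m hm => by rw [hE.coeff_sum F α hm]

theorem ModeFamily.integral_sub_sum (hE : ModeFamily β E Λ) (F : Finset ι) (α : ι → ℝ)
    {f : Pt → ℝ} (hf : MemLp f 2 volΩ) :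
    ∫ p, (f p - ∑ m ∈ F, α m * E m p) * (f p - ∑ m ∈ F, α m * E m p) ∂volΩ =
      ∫ p, f p * f p ∂volΩ - 2 * ∑ m ∈ F, α m * coeff E f m + ∑ m ∈ F, α m * α m := by
  have hS : MemLp (fun p => ∑ m ∈ F, α m * E m p) 2 volΩ :=
    memLp_of_continuous (hE.continuous_sum F α)
  rw [← hE.integral_sum_mul F α (hf.integrable one_le_two), ← hE.integral_sum_mul_sum F α α]
  exact integral_sub_two_mul_add (hf.integrable_mul hf) (hS.integrable_mul hf)
    (hS.integrable_mul hS) fun p => by ring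

theorem integral_mul_self_nonneg {X : Type*} [MeasurableSpace X] {μ : Measure X} (f : X → ℝ) :
    0 ≤ ∫ x, f x * f x ∂μ := integral_nonneg fun _ => mul_self_nonneg _

/-- Bessel's inequality. -/
theorem ModeFamily.bessel (hE : ModeFamily β E Λ) (F : Finset ι) {f : Pt → ℝ}
    (hf : MemLp f 2 volΩ) : ∑ m ∈ F, coeff E f m ^ 2 ≤ ∫ p, f p * f p ∂volΩ := by
  have h := hE.integral_sub_sum F (coeff E f) hf
  have h0 := integral_mul_self_nonneg (μ := volΩ) fun p => f p - ∑ m ∈ F, coeff E f m * E m p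
  rw [h] at h0
  simp only [← sq] at h0 ⊢
  linarith

theorem ModeFamily.summable_sq (hE : ModeFamily β E Λ) {f : Pt → ℝ} (hf : MemLp f 2 volΩ) :
    Summable fun m => coeff E f m ^ 2 :=
  summable_of_sum_le (fun _ => sq_nonneg _) fun F => hE.bessel F hf

theorem ModeFamily.sq_coeff_le (hE : ModeFamily β E Λ) {f : Pt → ℝ} (hf : MemLp f 2 volΩ)
    (m : ι) : coeff E f m ^ 2 ≤ ∫ p, f p * f p ∂volΩ := by
  simpa using hE.bessel {m} hf

theorem ModeFamily.isRobin_sum (hE : ModeFamily β E Λ) (F : Finset ι) (α : ι → ℝ) :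
    IsRobin β (fun p => ∑ m ∈ F, α m * E m p) fun p => ∑ m ∈ F, (α m * Λ m) * E m p := by
  simpa only [mul_assoc] using IsRobin.sum F α hE.robin

/-- Bessel's inequality for the energy. -/
theorem ModeFamily.bessel_form (hE : ModeFamily β E Λ) (hβ : 0 < β) (F : Finset ι) {u : Field}
    {G : MField} {τ : BField} (hu : IsVP u G τ) :
    ∑ m ∈ F, Λ m * coeff E (u 0) m ^ 2 ≤ form β G τ G τ := by
  -- The energy of `u` minus its projection onto the modes is nonnegative. Green's formula turns the
  -- cross term and the energy of the projection into the same weighted sum of squares.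
  have h := (hE.isRobin_sum F (coeff E (u 0))).form_sub_self hu
  have h0 := form_self_nonneg hβ
    (fun i j p => G i j p -
      scalarGrad (fun j => pd j fun p => ∑ m ∈ F, coeff E (u 0) m * E m p) i j p)
    (fun b i s => τ b i s -
      scalarTrace (boundaryValue fun p => ∑ m ∈ F, coeff E (u 0) m * E m p) b i s)
  rw [h, hE.integral_sum_mul F _ ((hu.1.1 0).integrable one_le_two), hE.integral_sum_mul_sum] at h0
  have e1 : ∑ m ∈ F, coeff E (u 0) m * Λ m * coeff E (u 0) m =
      ∑ m ∈ F, Λ m * coeff E (u 0) m ^ 2 := Finset.sum_congr rfl fun m _ => by ring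
  rw [e1] at h0
  linarith

/-- Estimate of the convective term tested with a combination of eigenfunctions. -/
theorem ModeFamily.ip_conv_le (hE : ModeFamily β E Λ) (hβ : 0 < β) (F : Finset ι) (α : ι → ℝ)
    {u : Field} {G : MField} {τ : BField} (hu : IsVP u G τ) {M : ℝ}
    (hM : ∀ p, |∑ m ∈ F, α m * E m p| ≤ M) :
    ip (conv u G) (scalarField fun p => ∑ m ∈ F, α m * E m p) ≤
      form β G τ G τ - 2 * (∑ m ∈ F, α m * Λ m * coeff E (u 0) m) + ∑ m ∈ F, α m * Λ m * α m +
      M ^ 2 / 2 * (ip u u - 2 * (∑ m ∈ F, α m * coeff E (u 0) m) + ∑ m ∈ F, α m * α m) := by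
  have h := (hE.isRobin_sum F α).ip_conv_le hβ hu hM
  rw [hE.integral_sum_mul F _ ((hu.1.1 0).integrable one_le_two), hE.integral_sum_mul_sum,
    hE.integral_sum_mul_sum] at h
  simp only [mul_comm (u 0 _)] at h
  rwa [hE.integral_sum_mul F _ ((hu.1.1 0).integrable one_le_two)] at h

theorem toReal_eLpNorm_sq {X : Type*} [MeasurableSpace X] {μ : Measure X} {f : X → ℝ}
    (hf : MemLp f 2 μ) : (eLpNorm f 2 μ).toReal ^ 2 = ∫ x, f x * f x ∂μ := by
  rw [hf.eLpNorm_eq_integral_rpow_norm two_ne_zero ENNReal.ofNat_ne_top]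
  have h0 : 0 ≤ ∫ x, ‖f x‖ ^ (2 : ENNReal).toReal ∂μ := integral_nonneg fun x => by positivity
  rw [ENNReal.toReal_ofReal (by positivity)]
  simp only [ENNReal.toReal_ofNat] at h0 ⊢
  rw [← Real.rpow_natCast, ← Real.rpow_mul h0]
  simp [sq]

theorem tendsto_integral_of_tendsto_eLpNorm {X : Type*} [MeasurableSpace X] {μ : Measure X}
    {g : ℕ → X → ℝ} (hg : ∀ N, MemLp (g N) 2 μ)
    (h : Tendsto (fun N => eLpNorm (g N) 2 μ) atTop (𝓝 0)) :
    Tendsto (fun N => ∫ x, g N x * g N x ∂μ) atTop (𝓝 0) := by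
  have := ((ENNReal.tendsto_toReal ENNReal.zero_ne_top).comp h).pow 2
  simp only [Function.comp_def, toReal_eLpNorm_sq (hg _)] at this
  simpa using this

/-- One inequality is Bessel's. For the other, every combination of modes is at squared distance at
least `‖f‖² - ∑ c²` from `f`, and the hypothesis makes this distance tend to zero. -/
theorem ModeFamily.tendsto_sum_sq (hE : ModeFamily β E Λ) {f : Pt → ℝ} (hf : MemLp f 2 volΩ)
    {F : ℕ → Finset ι} {α : ℕ → ι → ℝ}
    (h : Tendsto (fun N => eLpNorm (fun p => f p - ∑ m ∈ F N, α N m * E m p) 2 volΩ)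
      atTop (𝓝 0)) : HasSum (fun m => coeff E f m ^ 2) (∫ p, f p * f p ∂volΩ) := by
  have hS := tendsto_integral_of_tendsto_eLpNorm
    (fun N => hf.sub (memLp_of_continuous (hE.continuous_sum (F N) (α N)))) h
  have hle : ∫ p, f p * f p ∂volΩ ≤ ∑' m, coeff E f m ^ 2 := by
    refine le_of_tendsto' (hS.const_sub (∫ p, f p * f p ∂volΩ)) (fun N => ?_) |> fun h => by
      simpa using h
    simp only [Pi.sub_apply]
    rw [hE.integral_sub_sum (F N) (α N) hf]
    refine le_trans ?_ ((hE.summable_sq hf).sum_le_tsum (F N) fun m _ => sq_nonneg _)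
    rw [Finset.mul_sum]
    have : 0 ≤ ∑ m ∈ F N, (coeff E f m - α N m) ^ 2 := Finset.sum_nonneg fun m _ => sq_nonneg _
    have e : ∑ m ∈ F N, (coeff E f m - α N m) ^ 2 = ∑ m ∈ F N, coeff E f m ^ 2 -
        ∑ m ∈ F N, 2 * (α N m * coeff E f m) + ∑ m ∈ F N, α N m * α N m := by
      rw [← Finset.sum_sub_distrib, ← Finset.sum_add_distrib]
      exact Finset.sum_congr rfl fun m _ => by ring
    linarith
  have hge : ∑' m, coeff E f m ^ 2 ≤ ∫ p, f p * f p ∂volΩ :=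
    (hE.summable_sq hf).tsum_le_of_sum_le fun F => hE.bessel F hf
  rw [hle.antisymm hge]
  exact (hE.summable_sq hf).hasSum

theorem abs_integral_mul_le {X : Type*} [MeasurableSpace X] {μ : Measure X} {f g : X → ℝ}
    (hf : MemLp f 2 μ) (hg : MemLp g 2 μ) :
    |∫ x, f x * g x ∂μ| ≤ √(∫ x, f x * f x ∂μ) * √(∫ x, g x * g x ∂μ) := by
  have h := integral_mul_norm_le_Lp_mul_Lq (μ := μ) (f := f) (g := g) Real.HolderConjugate.two_two
    (by simpa using hf) (by simpa using hg)
  refine (abs_integral_le_integral_abs).trans ?_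
  simp only [abs_mul]
  simpa [Real.sqrt_eq_rpow, sq] using h

/-- Parseval's identity, for functions in the closed span of the family. -/
theorem ModeFamily.hasSum_coeff_mul (hE : ModeFamily β E Λ) {f φ : Pt → ℝ} (hf : MemLp f 2 volΩ)
    (hφ : MemLp φ 2 volΩ) (h : HasSum (fun m => coeff E f m ^ 2) (∫ p, f p * f p ∂volΩ)) :
    HasSum (fun m => coeff E f m * coeff E φ m) (∫ p, f p * φ p ∂volΩ) := by
  rw [HasSum, SummationFilter.unconditional_filter] at h ⊢
  rw [tendsto_iff_dist_tendsto_zero]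
  have h1 : Tendsto (fun F : Finset ι => √(∫ p, f p * f p ∂volΩ - ∑ m ∈ F, coeff E f m ^ 2) *
      √(∫ p, φ p * φ p ∂volΩ)) atTop (𝓝 0) := by
    have := (((h.const_sub (∫ p, f p * f p ∂volΩ)).sqrt).mul_const (√(∫ p, φ p * φ p ∂volΩ)))
    simpa using this
  refine squeeze_zero (fun _ => dist_nonneg) (fun F => ?_) h1
  have hS : MemLp (fun p => ∑ m ∈ F, coeff E f m * E m p) 2 volΩ :=
    memLp_of_continuous (hE.continuous_sum F _)
  rw [Real.dist_eq, abs_sub_comm]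
  have e1 : ∫ p, f p * φ p ∂volΩ - ∑ m ∈ F, coeff E f m * coeff E φ m =
      ∫ p, (f p - ∑ m ∈ F, coeff E f m * E m p) * φ p ∂volΩ := by
    rw [← hE.integral_sum_mul F _ (hφ.integrable one_le_two),
      ← integral_sub (f := fun p => f p * φ p) (g := fun p => (∑ m ∈ F, coeff E f m * E m p) * φ p)
        (hf.integrable_mul hφ) (hS.integrable_mul hφ)]
    exact integral_congr_ae (Eventually.of_forall fun p => by simp only; ring)
  have e2 : ∫ p, f p * f p ∂volΩ - ∑ m ∈ F, coeff E f m ^ 2 =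
      ∫ p, (f p - ∑ m ∈ F, coeff E f m * E m p) * (f p - ∑ m ∈ F, coeff E f m * E m p) ∂volΩ := by
    rw [hE.integral_sub_sum F _ hf]
    simp only [← sq]
    ring
  rw [e1, e2]
  exact abs_integral_mul_le (hf.sub hS) hφ

/-! ### Series of decaying modes -/

/-- The series `∑ c_m exp(-Λ_m t) H_m`. -/
noncomputable def heatSeries {X : Type*} (Λ c : ι → ℝ) (H : ι → X → ℝ) (t : ℝ) (x : X) : ℝ :=
  ∑' m, c m * Real.exp (-Λ m * t) * H m x

/-- The third power turns `Λ exp(-Λt)` into a multiple of `Λ⁻²`, which is summable over the modes.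
-/
theorem exp_le_inv_cube {x : ℝ} (hx : 0 < x) : Real.exp (-x) ≤ 6 * (x ^ 3)⁻¹ := by
  have h := Real.pow_div_factorial_le_exp x hx.le 3
  rw [Real.exp_neg, inv_le_comm₀ (Real.exp_pos _) (by positivity)]
  calc (6 * (x ^ 3)⁻¹)⁻¹ = x ^ 3 / (Nat.factorial 3 : ℕ) := by
        simp [Nat.factorial, div_eq_mul_inv, mul_comm]
    _ ≤ _ := h

theorem ModeFamily.summable_mul_exp (hE : ModeFamily β E Λ) {t : ℝ} (ht : 0 < t) :
    Summable fun m => Λ m * Real.exp (-Λ m * t) := by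
  refine Summable.of_nonneg_of_le (fun m => ?_) (fun m => ?_)
    (hE.summable.mul_left (6 * (t ^ 3)⁻¹))
  · have := hE.one_le m
    positivity
  · have h1 : 0 < Λ m := zero_lt_one.trans_le (hE.one_le m)
    rw [neg_mul]
    calc _ ≤ Λ m * (6 * ((Λ m * t) ^ 3)⁻¹) := by
          gcongr; exact exp_le_inv_cube (by positivity)
      _ = _ := by field_simp

section Series

variable {X : Type*} {c : ι → ℝ} {A : ℝ} {H : ι → X → ℝ} {t : ℝ}

/-- The bound `Λ` holds for the modes, their first derivatives and their boundary values, so a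
single majorant serves the velocity, its gradient and its trace. -/
theorem abs_heat_term_le (hc : ∀ m, |c m| ≤ A) (hH : ∀ m x, |H m x| ≤ Λ m) (m : ι) (x : X) :
    |c m * Real.exp (-Λ m * t) * H m x| ≤ A * (Λ m * Real.exp (-Λ m * t)) := by
  have hA : 0 ≤ A := (abs_nonneg _).trans (hc m)
  rw [abs_mul, abs_mul, Real.abs_exp]
  calc _ ≤ A * Real.exp (-Λ m * t) * Λ m := by gcongr; exacts [hc m, hH m x]
    _ = _ := by ring

theorem ModeFamily.summable_heat (hE : ModeFamily β E Λ) (hc : ∀ m, |c m| ≤ A)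
    (hH : ∀ m x, |H m x| ≤ Λ m) (ht : 0 < t) (x : X) :
    Summable fun m => c m * Real.exp (-Λ m * t) * H m x :=
  Summable.of_norm_bounded ((hE.summable_mul_exp ht).mul_left A) fun m => abs_heat_term_le hc hH m x

theorem ModeFamily.abs_heatSeries_le (hE : ModeFamily β E Λ) (hc : ∀ m, |c m| ≤ A)
    (hH : ∀ m x, |H m x| ≤ Λ m) (ht : 0 < t) (x : X) :
    |heatSeries Λ c H t x| ≤ A * ∑' m, Λ m * Real.exp (-Λ m * t) := by
  rw [← tsum_mul_left]
  exact tsum_of_norm_bounded (f := fun m => c m * Real.exp (-Λ m * t) * H m x) ((hE.summable_mul_exp ht).mul_left A).hasSum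
    fun m => abs_heat_term_le hc hH m x

theorem ModeFamily.measurable_heatSeries [Countable ι] [TopologicalSpace X] [MeasurableSpace X]
    [OpensMeasurableSpace X] (hE : ModeFamily β E Λ) (hc : ∀ m, |c m| ≤ A)
    (hH : ∀ m x, |H m x| ≤ Λ m) (hm : ∀ m, Continuous (H m)) (ht : 0 < t) :
    Measurable (heatSeries Λ c H t) := by
  refine measurable_of_tendsto_metrizable' (f := fun (F : Finset ι) x =>
    ∑ m ∈ F, c m * Real.exp (-Λ m * t) * H m x) atTop (fun F => ?_) ?_
  · exact (continuous_finsetSum _ fun m _ => continuous_const.mul (hm m)).measurable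
  · rw [tendsto_pi_nhds]
    intro x
    exact (hE.summable_heat hc hH ht x).hasSum

/-- Term by term integration. -/
theorem ModeFamily.hasSum_integral_heatSeries [Countable ι] [MeasurableSpace X]
    {μ : Measure X} (hE : ModeFamily β E Λ) (hc : ∀ m, |c m| ≤ A)
    (hH : ∀ m x, |H m x| ≤ Λ m) (hm : ∀ m, Measurable (H m)) (ht : 0 < t) {ψ : X → ℝ}
    (hψ : Integrable ψ μ) :
    HasSum (fun m => c m * Real.exp (-Λ m * t) * ∫ x, H m x * ψ x ∂μ)
      (∫ x, heatSeries Λ c H t x * ψ x ∂μ) := by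
  have hi : ∀ m, Integrable (fun x => c m * Real.exp (-Λ m * t) * (H m x * ψ x)) μ := fun m =>
    (hψ.bdd_mul (c := Λ m) (hm m).aestronglyMeasurable
      (Eventually.of_forall fun x => hH m x)).const_mul _
  have hle : ∀ m x, ‖c m * Real.exp (-Λ m * t) * (H m x * ψ x)‖ ≤
      A * (Λ m * Real.exp (-Λ m * t)) * |ψ x| := by
    intro m x
    rw [← mul_assoc, norm_mul, Real.norm_eq_abs, Real.norm_eq_abs]
    exact mul_le_mul_of_nonneg_right (abs_heat_term_le hc hH m x) (abs_nonneg _)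
  have hs : Summable fun m => ∫ x, ‖c m * Real.exp (-Λ m * t) * (H m x * ψ x)‖ ∂μ := by
    refine Summable.of_nonneg_of_le (fun m => integral_nonneg fun x => norm_nonneg _) (fun m => ?_)
      (((hE.summable_mul_exp ht).mul_left A).mul_right (∫ x, |ψ x| ∂μ))
    rw [← integral_const_mul]
    exact integral_mono (hi m).norm (hψ.abs.const_mul _) (hle m)
  have := hasSum_integral_of_summable_integral_norm hi hs
  simp only [integral_const_mul] at this
  have e : ∫ x, heatSeries Λ c H t x * ψ x ∂μ =
      ∫ x, ∑' m, c m * Real.exp (-Λ m * t) * (H m x * ψ x) ∂μ := by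
    refine integral_congr_ae (Eventually.of_forall fun x => ?_)
    simp only [heatSeries, ← tsum_mul_right, mul_assoc]
  rwa [e]

end Series

end NSChannel

namespace NSChannel

variable {β : ℝ} {ι : Type*} {E : ι → Pt → ℝ} {Λ : ι → ℝ}

/-! ### Integrability in time -/

theorem integrable_mul_of_memLp {X : Type*} [MeasurableSpace X] {μ : Measure X} {f g : X → ℝ}
    (hf : MemLp f 2 μ) (hg : MemLp g 2 μ) : Integrable (fun x => f x * g x) μ :=
  hf.integrable_mul hg

theorem ae_volT_mem (T : ℝ) : ∀ᵐ t ∂volT T, t ∈ Set.Ioo 0 T := ae_restrict_mem measurableSet_Ioo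

theorem memLp_strain_time {T : ℝ} {G : ℝ → MField}
    (hG : ∀ i j, MemLp (fun P : ℝ × Pt => G P.1 i j P.2) 2 ((volT T).prod volΩ)) (i j : Fin 3) :
    MemLp (fun P : ℝ × Pt => strain (G P.1) i j P.2) 2 ((volT T).prod volΩ) := by
  have := ((hG i j).add (hG j i)).const_mul (1 / 2 : ℝ)
  refine this.ae_eq (Eventually.of_forall fun p => ?_)
  simp [strain]; ring

theorem integrable_time_ipM {T : ℝ} {G : ℝ → MField}
    (hG : ∀ i j, MemLp (fun P : ℝ × Pt => G P.1 i j P.2) 2 ((volT T).prod volΩ)) :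
    Integrable (fun t => ipM (strain (G t)) (strain (G t))) (volT T) := by
  have h : Integrable (fun P : ℝ × Pt => ∑ i, ∑ j,
      strain (G P.1) i j P.2 * strain (G P.1) i j P.2) ((volT T).prod volΩ) :=
    integrable_finsetSum _ fun i _ => integrable_finsetSum _ fun j _ =>
      (memLp_strain_time hG i j).integrable_mul (memLp_strain_time hG i j)
  exact h.integral_prod_left

theorem integrable_time_ip {T : ℝ} {v : ℝ → Field}
    (hv : ∀ i, MemLp (fun P : ℝ × Pt => v P.1 i P.2) 2 ((volT T).prod volΩ)) :
    Integrable (fun t => ip (v t) (v t)) (volT T) := by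
  have h : Integrable (fun P : ℝ × Pt => ∑ i, v P.1 i P.2 * v P.1 i P.2)
      ((volT T).prod volΩ) :=
    integrable_finsetSum _ fun i _ => (hv i).integrable_mul (hv i)
  exact h.integral_prod_left

theorem integrable_time_ipΓ {T : ℝ} {τ : ℝ → BField}
    (hτ : ∀ b i, MemLp (fun P : ℝ × (ℝ × ℝ) => τ P.1 b i P.2) 2 ((volT T).prod volΓ)) :
    Integrable (fun t => ipΓ (τ t) (τ t)) (volT T) := by
  simp only [ipΓ]
  refine integrable_finsetSum _ fun b _ => ?_
  have h : Integrable (fun P : ℝ × (ℝ × ℝ) => τ P.1 b 0 P.2 * τ P.1 b 0 P.2 +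
      τ P.1 b 1 P.2 * τ P.1 b 1 P.2) ((volT T).prod volΓ) :=
    ((hτ b 0).integrable_mul (hτ b 0)).add ((hτ b 1).integrable_mul (hτ b 1))
  exact h.integral_prod_left

theorem integrable_time_form {β T : ℝ} {G : ℝ → MField} {τ : ℝ → BField}
    (hG : ∀ i j, MemLp (fun P : ℝ × Pt => G P.1 i j P.2) 2 ((volT T).prod volΩ))
    (hτ : ∀ b i, MemLp (fun P : ℝ × (ℝ × ℝ) => τ P.1 b i P.2) 2 ((volT T).prod volΓ)) :
    Integrable (fun t => form β (G t) (τ t) (G t) (τ t)) (volT T) :=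
  ((integrable_time_ipM hG).const_mul 2).add ((integrable_time_ipΓ hτ).const_mul β)

theorem volT_mono {t T : ℝ} (h : t ≤ T) : volT t ≤ volT T :=
  Measure.restrict_mono (Set.Ioo_subset_Ioo_right h) le_rfl

/-- The dissipation integral in terms of the form. -/
theorem integral_dissipation {β T t : ℝ} (ht : t ≤ T) {G : ℝ → MField} {τ : ℝ → BField}
    (hG : ∀ i j, MemLp (fun P : ℝ × Pt => G P.1 i j P.2) 2 ((volT T).prod volΩ))
    (hτ : ∀ b i, MemLp (fun P : ℝ × (ℝ × ℝ) => τ P.1 b i P.2) 2 ((volT T).prod volΓ)) :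
    (∫ s in Set.Ioo 0 t, 2 * ipM (strain (G s)) (strain (G s))) +
      β * (∫ s in Set.Ioo 0 t, ipΓ (τ s) (τ s)) = ∫ s, form β (G s) (τ s) (G s) (τ s) ∂volT t := by
  have h1 := ((integrable_time_ipM hG).mono_measure (volT_mono ht)).const_mul 2
  have h2 := ((integrable_time_ipΓ hτ).mono_measure (volT_mono ht)).const_mul β
  simp only [form]
  rw [integral_add h1 h2, integral_const_mul β]
  rfl

/-- Slicewise norms bounded uniformly in `t` are square integrable over a time interval of finite
length. -/
theorem memLp_time_of_bound {X : Type*} [MeasurableSpace X] {μ : Measure X} [IsFiniteMeasure μ]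
    {T C : ℝ} {F : ℝ × X → ℝ} (hm : AEStronglyMeasurable F ((volT T).prod μ))
    (hF : ∀ t ∈ Set.Ioo 0 T, MemLp (fun x => F (t, x)) 2 μ)
    (hC : ∀ t ∈ Set.Ioo 0 T, ∫ x, F (t, x) * F (t, x) ∂μ ≤ C) :
    MemLp F 2 ((volT T).prod μ) := by
  have hm2 : AEStronglyMeasurable (fun P => F P ^ 2) ((volT T).prod μ) := hm.pow 2
  rw [memLp_two_iff_integrable_sq hm, integrable_prod_iff hm2]
  refine ⟨(ae_volT_mem T).mono fun t ht => (hF t ht).integrable_sq, ?_⟩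
  refine Integrable.of_bound (C := C) hm2.norm.integral_prod_right' ?_
  filter_upwards [ae_volT_mem T] with t ht
  rw [Real.norm_of_nonneg (integral_nonneg fun x => norm_nonneg _)]
  refine le_trans (le_of_eq ?_) (hC t ht)
  congr 1; ext x
  rw [Real.norm_of_nonneg (sq_nonneg _), sq]

/-- Joint measurability comes from a limit of continuous partial sums over finite sets, valid where
`t > 0`; countability of `ι` makes this a limit along a countably generated filter. -/
theorem ModeFamily.aestronglyMeasurable_heatSeries [Countable ι] {X : Type*} [TopologicalSpace X]
    [SecondCountableTopology X] [MeasurableSpace X] [OpensMeasurableSpace X] {μ : Measure X}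
    [SFinite μ] {T A : ℝ} {c : ι → ℝ}
    {H : ι → X → ℝ} (hE : ModeFamily β E Λ) (hc : ∀ m, |c m| ≤ A)
    (hH : ∀ m x, |H m x| ≤ Λ m) (hm : ∀ m, Continuous (H m)) :
    AEStronglyMeasurable (fun P : ℝ × X => heatSeries Λ c H P.1 P.2) ((volT T).prod μ) := by
  refine aestronglyMeasurable_of_tendsto_ae (u := atTop) (f := fun (F : Finset ι) P =>
    ∑ m ∈ F, c m * Real.exp (-Λ m * P.1) * H m P.2) (fun F => ?_) ?_
  · have : Continuous fun P : ℝ × X => ∑ m ∈ F, c m * Real.exp (-Λ m * P.1) * H m P.2 :=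
      continuous_finsetSum _ fun m _ => by have := hm m; fun_prop
    exact this.aestronglyMeasurable
  · have : ∀ᵐ P ∂(volT T).prod μ, P.1 ∈ Set.Ioo 0 T :=
      Measure.quasiMeasurePreserving_fst.ae (ae_volT_mem T)
    filter_upwards [this] with P hP
    exact (hE.summable_heat hc hH hP.1 P.2).hasSum

/-! ### The solution given by the series -/

/-- The velocity field `∑ c_m exp(-Λ_m t) (E_m, 0, 0)`. -/
noncomputable def vel (E : ι → Pt → ℝ) (Λ c : ι → ℝ) (t : ℝ) : Field :=
  scalarField (heatSeries Λ c E t)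

/-- The gradient of `vel`. -/
noncomputable def velGrad (E : ι → Pt → ℝ) (Λ c : ι → ℝ) (t : ℝ) : MField :=
  scalarGrad fun j => heatSeries Λ c (fun m => pd j (E m)) t

/-- The trace of `vel`. -/
noncomputable def velTrace (E : ι → Pt → ℝ) (Λ c : ι → ℝ) (t : ℝ) : BField :=
  scalarTrace fun b => heatSeries Λ c (fun m => boundaryValue (E m) b) t

theorem ModeFamily.bound' (hE : ModeFamily β E Λ) (m : ι) (p : Pt) : |E m p| ≤ Λ m :=
  (hE.bound m p).trans (hE.one_le m)

theorem ModeFamily.bound_boundaryValue (hE : ModeFamily β E Λ) (b : Bool) (m : ι) (s : ℝ × ℝ) :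
    |boundaryValue (E m) b s| ≤ Λ m := hE.bound' m _

theorem ModeFamily.continuous_boundaryValue (hE : ModeFamily β E Λ) (b : Bool) (m : ι) :
    Continuous (boundaryValue (E m) b) :=
  (hE.continuous m).comp (by fun_prop)

theorem ModeFamily.continuous_pd (hE : ModeFamily β E Λ) (j : Fin 3) (m : ι) :
    Continuous (pd j (E m)) := (hE.robin m).isTest.continuous_pd j

theorem ModeFamily.pd_zero (hE : ModeFamily β E Λ) (m : ι) (p : Pt) : pd 0 (E m) p = 0 :=
  pd_zero_of_indep (hE.robin m).isTest.differentiable (hE.robin m).indep p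

variable {c : ι → ℝ} {A t : ℝ}

theorem ModeFamily.heatSeries_pd_zero (hE : ModeFamily β E Λ) (p : Pt) :
    heatSeries Λ c (fun m => pd 0 (E m)) t p = 0 := by
  simp [heatSeries, hE.pd_zero]

/-- The only nonzero velocity component multiplies `∂ₓ`, and nothing depends on `x`. -/
theorem ModeFamily.conv_vel (hE : ModeFamily β E Λ) : conv (vel E Λ c t) (velGrad E Λ c t) = 0 := by
  ext i p
  simp [conv, vel, velGrad, scalarField, scalarGrad, hE.heatSeries_pd_zero]

theorem exp_neg_two_mul_le (hE : ModeFamily β E Λ) (ht : 0 < t) (m : ι) :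
    Real.exp (-2 * Λ m * t) ≤ 1 := by
  have := hE.one_le m
  rw [Real.exp_le_one_iff]
  nlinarith

/-- For a single component with vanishing `x` derivative the symmetrized gradient loses nothing, so
the Stokes form controls the full gradient without Korn's inequality. -/
theorem ModeFamily.ipM_velGrad (hE : ModeFamily β E Λ) :
    ipM (velGrad E Λ c t) (velGrad E Λ c t) =
      2 * ipM (strain (velGrad E Λ c t)) (strain (velGrad E Λ c t)) := by
  rw [velGrad, two_mul_ipM_strain_scalarGrad fun p => hE.heatSeries_pd_zero p, ipM]
  congr 1; ext p
  simp [scalarGrad, Fin.sum_univ_three, hE.heatSeries_pd_zero]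

section
variable [Countable ι]

theorem ModeFamily.memLp_heatSeries {X : Type*} [TopologicalSpace X] [MeasurableSpace X]
    [OpensMeasurableSpace X] {μ : Measure X} [IsFiniteMeasure μ] {H : ι → X → ℝ} {q : ENNReal}
    (hE : ModeFamily β E Λ) (hc : ∀ m, |c m| ≤ A) (hH : ∀ m x, |H m x| ≤ Λ m)
    (hm : ∀ m, Continuous (H m)) (ht : 0 < t) : MemLp (heatSeries Λ c H t) q μ :=
  MemLp.of_bound (hE.measurable_heatSeries hc hH hm ht).aestronglyMeasurable _
    (Eventually.of_forall fun x => hE.abs_heatSeries_le hc hH ht x)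

/-- Each defining identity is Green's formula for a single mode, summed term by term; uniqueness of
sums identifies the two sides. -/
theorem ModeFamily.isVP_vel (hE : ModeFamily β E Λ) (hc : ∀ m, |c m| ≤ A) (ht : 0 < t) :
    IsVP (vel E Λ c t) (velGrad E Λ c t) (velTrace E Λ c t) := by
  have hf : ∀ {ψ : Pt → ℝ}, Integrable ψ volΩ → HasSum (fun m => c m * Real.exp (-Λ m * t) *
      ∫ p, E m p * ψ p ∂volΩ) (∫ p, heatSeries Λ c E t p * ψ p ∂volΩ) := fun hψ =>
    hE.hasSum_integral_heatSeries hc hE.bound' (fun m => (hE.continuous m).measurable) ht hψ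
  have hg : ∀ (j : Fin 3) {ψ : Pt → ℝ}, Integrable ψ volΩ →
      HasSum (fun m => c m * Real.exp (-Λ m * t) * ∫ p, pd j (E m) p * ψ p ∂volΩ)
        (∫ p, heatSeries Λ c (fun m => pd j (E m)) t p * ψ p ∂volΩ) := fun j _ hψ =>
    hE.hasSum_integral_heatSeries hc (fun m => hE.bound_pd m j)
      (fun m => (hE.continuous_pd j m).measurable) ht hψ
  have hb : ∀ (b : Bool) {ψ : ℝ × ℝ → ℝ}, Integrable ψ volΓ →
      HasSum (fun m => c m * Real.exp (-Λ m * t) * ∫ s, boundaryValue (E m) b s * ψ s ∂volΓ)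
        (∫ s, heatSeries Λ c (fun m => boundaryValue (E m) b) t s * ψ s ∂volΓ) := fun b _ hψ =>
    hE.hasSum_integral_heatSeries hc (hE.bound_boundaryValue b)
      (fun m => (hE.continuous_boundaryValue b m).measurable) ht hψ
  have mf : MemLp (heatSeries Λ c E t) 2 volΩ := hE.memLp_heatSeries hc hE.bound' hE.continuous ht
  have mg : ∀ j, MemLp (heatSeries Λ c (fun m => pd j (E m)) t) 2 volΩ := fun j =>
    hE.memLp_heatSeries hc (fun m => hE.bound_pd m j) (hE.continuous_pd j) ht
  have mb : ∀ b, MemLp (heatSeries Λ c (fun m => boundaryValue (E m) b) t) 2 volΓ := fun b =>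
    hE.memLp_heatSeries hc (hE.bound_boundaryValue b) (hE.continuous_boundaryValue b) ht
  refine isVP_scalar mf mg mb (fun φ hφ => ?_) (fun j φ hφ => ?_) fun φ hφ => ?_
  · refine (hf (integrable_of_continuous (hφ.continuous_pd 0))).unique ?_
    have : ∀ m, ∫ p, E m p * pd 0 φ p ∂volΩ = 0 := fun m => by
      rw [integral_mul_pd_of_ne_two (hE.robin m).isTest hφ (by decide)]
      simp [hE.pd_zero]
    simp only [this, mul_zero]
    exact hasSum_zero
  · refine (hf (integrable_of_continuous (hφ.1.continuous_pd j))).unique ?_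
    have e : ∀ m, ∫ p, E m p * pd j φ p ∂volΩ = -∫ p, pd j (E m) p * φ p ∂volΩ := fun m =>
      (hE.robin m).isTest.hasWeakPD j φ hφ
    simp only [e, mul_neg]
    exact (hg j (integrable_of_continuous hφ.1.continuous)).neg
  · have c1 : Continuous fun s : ℝ × ℝ => φ (s.1, s.2, 1) := hφ.continuous.comp (by fun_prop)
    have c2 : Continuous fun s : ℝ × ℝ => φ (s.1, s.2, -1) := hφ.continuous.comp (by fun_prop)
    rw [integral_add (integrable_mul_continuous (mf.integrable one_le_two) (hφ.continuous_pd 2))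
      (integrable_mul_continuous ((mg 2).integrable one_le_two) hφ.continuous),
      integral_sub (integrable_mul_of_memLp (mb true) (memLp_of_continuous_square c1))
        (integrable_mul_of_memLp (mb false) (memLp_of_continuous_square c2))]
    have h1 := (hf (integrable_of_continuous (hφ.continuous_pd 2))).add
      (hg 2 (integrable_of_continuous hφ.continuous))
    have h2 := (hb true (integrable_of_continuous_square c1)).sub
      (hb false (integrable_of_continuous_square c2))
    refine h1.unique (Eq.mp (congrArg (HasSum · _) (funext fun m => ?_)) h2)
    have ft := (hE.robin m).isTest
    have i1 : Integrable (fun p => E m p * pd 2 φ p) volΩ :=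
      integrable_of_continuous (ft.continuous.mul (hφ.continuous_pd 2))
    have i2 : Integrable (fun p => pd 2 (E m) p * φ p) volΩ :=
      integrable_of_continuous ((ft.continuous_pd 2).mul hφ.continuous)
    have j1 : Integrable (fun s => boundaryValue (E m) true s * φ (s.1, s.2, 1)) volΓ :=
      integrable_of_continuous_square ((hE.continuous_boundaryValue true m).mul c1)
    have j2 : Integrable (fun s => boundaryValue (E m) false s * φ (s.1, s.2, -1)) volΓ :=
      integrable_of_continuous_square ((hE.continuous_boundaryValue false m).mul c2)
    rw [← mul_add, ← mul_sub, ← integral_add i1 i2, ← integral_sub j1 j2,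
      integral_mul_pd_two ft hφ]
    rfl

theorem ModeFamily.hasSum_ip_vel (hE : ModeFamily β E Λ) (hc : ∀ m, |c m| ≤ A) (ht : 0 < t)
    {φ : Field} (hφ : Integrable (φ 0) volΩ) :
    HasSum (fun m => c m * Real.exp (-Λ m * t) * coeff E (φ 0) m) (ip (vel E Λ c t) φ) := by
  rw [vel, ip_scalarField_left]
  exact hE.hasSum_integral_heatSeries hc hE.bound' (fun m => (hE.continuous m).measurable) ht hφ

theorem ModeFamily.hasSum_form_vel (hE : ModeFamily β E Λ) (hc : ∀ m, |c m| ≤ A) (ht : 0 < t)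
    {φ : Field} {Φ : MField} {σ : BField} (hφ : IsH1 φ Φ) (hσ : HasTrace φ Φ σ) :
    HasSum (fun m => c m * Real.exp (-Λ m * t) * (Λ m * coeff E (φ 0) m))
      (form β (velGrad E Λ c t) (velTrace E Λ c t) Φ σ) := by
  have iΦ : ∀ i j, Integrable (Φ i j) volΩ := fun i j => (hφ.2.1 i j).integrable one_le_two
  have iσ : ∀ b i, Integrable (σ b i) volΓ := fun b i => (hσ.1 b i).integrable one_le_two
  have hg : ∀ (j : Fin 3) {ψ : Pt → ℝ}, Integrable ψ volΩ →
      HasSum (fun m => c m * Real.exp (-Λ m * t) * ∫ p, pd j (E m) p * ψ p ∂volΩ)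
        (∫ p, heatSeries Λ c (fun m => pd j (E m)) t p * ψ p ∂volΩ) := fun j _ hψ =>
    hE.hasSum_integral_heatSeries hc (fun m => hE.bound_pd m j)
      (fun m => (hE.continuous_pd j m).measurable) ht hψ
  have hb : ∀ (b : Bool) {ψ : ℝ × ℝ → ℝ}, Integrable ψ volΓ →
      HasSum (fun m => c m * Real.exp (-Λ m * t) * ∫ s, boundaryValue (E m) b s * ψ s ∂volΓ)
        (∫ s, heatSeries Λ c (fun m => boundaryValue (E m) b) t s * ψ s ∂volΓ) := fun b _ hψ =>
    hE.hasSum_integral_heatSeries hc (hE.bound_boundaryValue b)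
      (fun m => (hE.continuous_boundaryValue b m).measurable) ht hψ
  have mg : ∀ j, MemLp (heatSeries Λ c (fun m => pd j (E m)) t) 2 volΩ := fun j =>
    hE.memLp_heatSeries hc (fun m => hE.bound_pd m j) (hE.continuous_pd j) ht
  have i1 : Integrable (fun p => Φ 0 1 p + Φ 1 0 p) volΩ := (iΦ 0 1).add (iΦ 1 0)
  have i2 : Integrable (fun p => Φ 0 2 p + Φ 2 0 p) volΩ := (iΦ 0 2).add (iΦ 2 0)
  have m1 : MemLp (fun p => Φ 0 1 p + Φ 1 0 p) 2 volΩ := (hφ.2.1 0 1).add (hφ.2.1 1 0)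
  have m2 : MemLp (fun p => Φ 0 2 p + Φ 2 0 p) 2 volΩ := (hφ.2.1 0 2).add (hφ.2.1 2 0)
  rw [form, velGrad, velTrace, two_mul_ipM_strain_scalarGrad fun p => hE.heatSeries_pd_zero p,
    ipΓ_scalarTrace_left, integral_add (integrable_mul_of_memLp (mg 1) m1)
      (integrable_mul_of_memLp (mg 2) m2),
    Fintype.sum_bool]
  convert ((hg 1 i1).add (hg 2 i2)).add (((hb true (iσ true 0)).add (hb false (iσ false 0))).mul_left β)
    using 2 with m
  have h := (hE.robin m).form_eq hφ hσ
  simp only [mul_assoc, integral_const_mul] at h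
  have n1 : Integrable (fun p => pd 1 (E m) p * (Φ 0 1 p + Φ 1 0 p)) volΩ :=
    integrable_mul_of_memLp (memLp_of_continuous (hE.continuous_pd 1 m)) m1
  have n2 : Integrable (fun p => pd 2 (E m) p * (Φ 0 2 p + Φ 2 0 p)) volΩ :=
    integrable_mul_of_memLp (memLp_of_continuous (hE.continuous_pd 2 m)) m2
  rw [coeff, ← h, form, two_mul_ipM_strain_scalarGrad fun p => hE.pd_zero m p,
    ipΓ_scalarTrace_left, integral_add n1 n2, Fintype.sum_bool]
  ring

theorem ModeFamily.coeff_heatSeries (hE : ModeFamily β E Λ) (hc : ∀ m, |c m| ≤ A) (ht : 0 < t)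
    (m : ι) : coeff E (heatSeries Λ c E t) m = c m * Real.exp (-Λ m * t) := by
  classical
  have h := hE.hasSum_integral_heatSeries hc hE.bound' (fun m => (hE.continuous m).measurable) ht
    (integrable_of_continuous (hE.continuous m))
  have h2 := hasSum_single (f := fun m' => c m' * Real.exp (-Λ m' * t) *
    ∫ p, E m' p * E m p ∂volΩ) m fun m' hm' => by rw [hE.ortho m' m hm', mul_zero]
  have := h.unique h2
  rw [hE.norm_eq, mul_one] at this
  rw [← this, coeff]
  simp only [mul_comm]

theorem ModeFamily.hasSum_ip_vel_self (hE : ModeFamily β E Λ) (hc : ∀ m, |c m| ≤ A) (ht : 0 < t) :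
    HasSum (fun m => c m ^ 2 * Real.exp (-2 * Λ m * t)) (ip (vel E Λ c t) (vel E Λ c t)) := by
  convert hE.hasSum_ip_vel hc ht (φ := vel E Λ c t)
    ((hE.isVP_vel hc ht).1.1 0 |>.integrable one_le_two) using 2 with m
  rw [show vel E Λ c t 0 = heatSeries Λ c E t from rfl, hE.coeff_heatSeries hc ht,
    show -2 * Λ m * t = -Λ m * t + -Λ m * t by ring, Real.exp_add]
  ring

theorem ModeFamily.hasSum_form_vel_self (hE : ModeFamily β E Λ) (hc : ∀ m, |c m| ≤ A)
    (ht : 0 < t) : HasSum (fun m => Λ m * c m ^ 2 * Real.exp (-2 * Λ m * t))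
      (form β (velGrad E Λ c t) (velTrace E Λ c t) (velGrad E Λ c t) (velTrace E Λ c t)) := by
  have hv := hE.isVP_vel hc ht
  convert hE.hasSum_form_vel hc ht hv.2.1 hv.2.2 using 2 with m
  rw [show vel E Λ c t 0 = heatSeries Λ c E t from rfl, hE.coeff_heatSeries hc ht,
    show -2 * Λ m * t = -Λ m * t + -Λ m * t by ring, Real.exp_add]
  ring

theorem ModeFamily.ip_vel_self_le (hE : ModeFamily β E Λ) (hc : ∀ m, |c m| ≤ A) (ht : 0 < t)
    {B : ℝ} (hB : ∀ F : Finset ι, ∑ m ∈ F, c m ^ 2 ≤ B) :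
    ip (vel E Λ c t) (vel E Λ c t) ≤ B := by
  refine hasSum_le_of_sum_le (hE.hasSum_ip_vel_self hc ht) fun F => le_trans ?_ (hB F)
  exact Finset.sum_le_sum fun m _ =>
    mul_le_of_le_one_right (sq_nonneg _) (exp_neg_two_mul_le hE ht m)

/-- Dropping the exponentials bounds the energy at every positive time by a bound for the weighted
sums of the initial coefficients. -/
theorem ModeFamily.form_vel_self_le (hE : ModeFamily β E Λ) (hc : ∀ m, |c m| ≤ A) (ht : 0 < t)
    {B : ℝ} (hB : ∀ F : Finset ι, ∑ m ∈ F, Λ m * c m ^ 2 ≤ B) :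
    form β (velGrad E Λ c t) (velTrace E Λ c t) (velGrad E Λ c t) (velTrace E Λ c t) ≤ B := by
  refine hasSum_le_of_sum_le (hE.hasSum_form_vel_self hc ht) fun F => le_trans ?_ (hB F)
  refine Finset.sum_le_sum fun m _ => mul_le_of_le_one_right ?_ (exp_neg_two_mul_le hE ht m)
  exact mul_nonneg (zero_le_one.trans (hE.one_le m)) (sq_nonneg _)

end

end NSChannel

/-! ### The series as a Leray–Hopf solution -/

namespace NSChannel

variable {β : ℝ} {ι : Type*} {E : ι → Pt → ℝ} {Λ : ι → ℝ} {c : ι → ℝ} {A : ℝ}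

theorem integrable_volT_of_continuous {f : ℝ → ℝ} (hf : Continuous f) (T : ℝ) :
    Integrable f (volT T) :=
  (hf.integrableOn_Icc (a := 0) (b := T)).mono_set Set.Ioo_subset_Icc_self

theorem hasDerivAt_exp_mul (a t : ℝ) :
    HasDerivAt (fun t => Real.exp (a * t)) (a * Real.exp (a * t)) t := by
  have := ((hasDerivAt_id t).const_mul a).exp
  simpa [mul_comm] using this

theorem integral_exp_mul_volT {T : ℝ} (hT : 0 ≤ T) (a : ℝ) :
    ∫ t, a * Real.exp (a * t) ∂volT T = Real.exp (a * T) - 1 := by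
  have := integral_Ioo_deriv hT (hasDerivAt_exp_mul a) (by fun_prop)
  simpa [volT] using this

/-- Integration by parts in time for a decaying mode. -/
theorem integral_exp_mul_deriv {T : ℝ} (hT : 0 ≤ T) {θ : ℝ → ℝ} (hθ : ContDiff ℝ ∞ θ)
    (h0 : θ T = 0) (l : ℝ) :
    (∫ t, Real.exp (-l * t) * deriv θ t ∂volT T) + θ 0 =
      ∫ t, Real.exp (-l * t) * l * θ t ∂volT T := by
  have hd : ∀ t, HasDerivAt θ (deriv θ t) t := fun t =>
    (hθ.differentiable (by simp) t).hasDerivAt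
  have hc' : Continuous (deriv θ) := hθ.continuous_deriv (by simp)
  have hc := hθ.continuous
  have h := integral_Ioo_deriv hT (fun t => (hasDerivAt_exp_mul (-l) t).mul (hd t)) (by fun_prop)
  have i1 : Integrable (fun t => -l * Real.exp (-l * t) * θ t) (volT T) :=
    integrable_volT_of_continuous (by fun_prop) T
  have i2 : Integrable (fun t => Real.exp (-l * t) * deriv θ t) (volT T) :=
    integrable_volT_of_continuous (by fun_prop) T
  change ∫ t, (-l * Real.exp (-l * t) * θ t + Real.exp (-l * t) * deriv θ t) ∂volT T = _ at h
  rw [integral_add i1 i2] at h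
  simp only [Pi.mul_apply, h0, mul_zero, Real.exp_zero, one_mul, zero_sub] at h
  have e : ∫ t, -l * Real.exp (-l * t) * θ t ∂volT T =
      -∫ t, Real.exp (-l * t) * l * θ t ∂volT T := by
    rw [← integral_neg]; congr 1; ext t; ring
  linarith

theorem exp_neg_mul_le_one {l t : ℝ} (hl : 0 ≤ l) (ht : 0 ≤ t) : Real.exp (-l * t) ≤ 1 := by
  rw [Real.exp_le_one_iff, neg_mul, neg_nonpos]
  exact mul_nonneg hl ht

theorem exists_bound_volT {θ : ℝ → ℝ} (hθ : Continuous θ) (T : ℝ) :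
    ∃ M, 0 ≤ M ∧ ∀ t ∈ Set.Ioo 0 T, |θ t| ≤ M := by
  obtain ⟨C, hC⟩ := (isCompact_Icc (a := (0 : ℝ)) (b := T)).exists_bound_of_continuousOn
    hθ.continuousOn
  exact ⟨max C 0, le_max_right _ _, fun t ht =>
    (hC t (Set.Ioo_subset_Icc_self ht)).trans (le_max_left _ _)⟩

/-- The weak formulation of the decay of a series of modes. -/
theorem weak_heat [Countable ι] (hΛ : ∀ m, 1 ≤ Λ m) {K : ι → ℝ} {s₀ : ℝ}
    (hK : HasSum K s₀) {S S' : ℝ → ℝ}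
    (hS : ∀ t, 0 < t → HasSum (fun m => K m * Real.exp (-Λ m * t)) (S t))
    (hS' : ∀ t, 0 < t → HasSum (fun m => K m * Real.exp (-Λ m * t) * Λ m) (S' t)) {T : ℝ}
    (hT : 0 ≤ T) {θ : ℝ → ℝ} (hθ : ContDiff ℝ ∞ θ) (h0 : θ T = 0) :
    (∫ t, S t * deriv θ t ∂volT T) + s₀ * θ 0 = ∫ t, S' t * θ t ∂volT T := by
  have hc' : Continuous (deriv θ) := hθ.continuous_deriv (by simp)
  have hc := hθ.continuous
  have hl : ∀ m, 0 ≤ Λ m := fun m => zero_le_one.trans (hΛ m)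
  obtain ⟨M, hM0, hM⟩ := exists_bound_volT hc T
  have i1 : ∀ m, Integrable (fun t => K m * (Real.exp (-Λ m * t) * deriv θ t)) (volT T) :=
    fun m => integrable_volT_of_continuous (by fun_prop) T
  have i2 : ∀ m, Integrable (fun t => K m * (Real.exp (-Λ m * t) * Λ m * θ t)) (volT T) :=
    fun m => integrable_volT_of_continuous (by fun_prop) T
  have s1 : Summable fun m => ∫ t, ‖K m * (Real.exp (-Λ m * t) * deriv θ t)‖ ∂volT T := by
    refine Summable.of_nonneg_of_le (fun m => integral_nonneg fun t => norm_nonneg _) (fun m => ?_)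
      (hK.summable.abs.mul_right (∫ t, |deriv θ t| ∂volT T))
    rw [← integral_const_mul]
    refine integral_mono_ae (i1 m).norm
      ((integrable_volT_of_continuous hc' T).abs.const_mul _) ?_
    filter_upwards [ae_volT_mem T] with t ht
    rw [norm_mul, norm_mul, Real.norm_eq_abs, Real.norm_eq_abs, Real.norm_eq_abs, Real.abs_exp]
    exact mul_le_mul_of_nonneg_left (mul_le_of_le_one_left (abs_nonneg _)
      (exp_neg_mul_le_one (hl m) ht.1.le)) (abs_nonneg _)
  -- The unbounded factor `Λ` is paid for by `∫ Λ exp(-Λt) dt ≤ 1`, so summability of `K` suffices,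
  -- without decay of `Λ K`.
  have s2 : Summable fun m => ∫ t, ‖K m * (Real.exp (-Λ m * t) * Λ m * θ t)‖ ∂volT T := by
    refine Summable.of_nonneg_of_le (fun m => integral_nonneg fun t => norm_nonneg _) (fun m => ?_)
      (hK.summable.abs.mul_right M)
    have h1 : ∫ t, Λ m * Real.exp (-Λ m * t) ∂volT T ≤ 1 := by
      have := integral_exp_mul_volT hT (-Λ m)
      simp only [neg_mul (Λ m) (Real.exp _), integral_neg] at this
      linarith [Real.exp_pos (-Λ m * T)]
    calc _ ≤ ∫ t, |K m| * M * (Λ m * Real.exp (-Λ m * t)) ∂volT T := by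
          refine integral_mono_ae (i2 m).norm
            (integrable_volT_of_continuous (by fun_prop) T) ?_
          filter_upwards [ae_volT_mem T] with t ht
          rw [norm_mul, norm_mul, norm_mul, Real.norm_eq_abs, Real.norm_eq_abs, Real.norm_eq_abs,
            Real.norm_eq_abs, Real.abs_exp, abs_of_nonneg (hl m)]
          calc _ ≤ |K m| * (Real.exp (-Λ m * t) * Λ m * M) := by
                have := hl m
                gcongr
                exact hM t ht
            _ = _ := by ring
      _ ≤ |K m| * M * 1 := by rw [integral_const_mul]; gcongr
      _ = _ := by ring
  have t1 := hasSum_integral_of_summable_integral_norm i1 s1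
  have t2 := hasSum_integral_of_summable_integral_norm i2 s2
  have e1 : ∫ t, ∑' m, K m * (Real.exp (-Λ m * t) * deriv θ t) ∂volT T =
      ∫ t, S t * deriv θ t ∂volT T := by
    refine integral_congr_ae ?_
    filter_upwards [ae_volT_mem T] with t ht
    simp only [← (hS t ht.1).tsum_eq, ← tsum_mul_right, mul_assoc]
  have e2 : ∫ t, ∑' m, K m * (Real.exp (-Λ m * t) * Λ m * θ t) ∂volT T =
      ∫ t, S' t * θ t ∂volT T := by
    refine integral_congr_ae ?_
    filter_upwards [ae_volT_mem T] with t ht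
    simp only [← (hS' t ht.1).tsum_eq, ← tsum_mul_right, mul_assoc]
  rw [e1] at t1
  rw [e2] at t2
  refine (t1.add (hK.mul_right (θ 0))).unique
    (Eq.mp (congrArg (HasSum · _) (funext fun m => ?_)) t2)
  rw [integral_const_mul, integral_const_mul, ← mul_add, integral_exp_mul_deriv hT hθ h0]

/-- The dissipation of a series of modes. -/
theorem integral_dissipation_heat [Countable ι] (hΛ : ∀ m, 1 ≤ Λ m)
    (hc : Summable fun m => c m ^ 2) {S : ℝ → ℝ}
    (hS : ∀ t, 0 < t → HasSum (fun m => Λ m * c m ^ 2 * Real.exp (-2 * Λ m * t)) (S t)) {t : ℝ}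
    (ht : 0 ≤ t) :
    HasSum (fun m => 1 / 2 * (c m ^ 2 - c m ^ 2 * Real.exp (-2 * Λ m * t)))
      (∫ s, S s ∂volT t) := by
  have e : ∀ m, ∫ s, Λ m * c m ^ 2 * Real.exp (-2 * Λ m * s) ∂volT t =
      1 / 2 * (c m ^ 2 - c m ^ 2 * Real.exp (-2 * Λ m * t)) := by
    intro m
    have h := integral_exp_mul_volT ht (-2 * Λ m)
    rw [integral_const_mul] at h
    rw [integral_const_mul]
    linear_combination (-1 / 2 * c m ^ 2) * h
  have hi : ∀ m, Integrable (fun s => Λ m * c m ^ 2 * Real.exp (-2 * Λ m * s)) (volT t) :=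
    fun m => integrable_volT_of_continuous (by fun_prop) t
  have hn : ∀ m s, 0 ≤ Λ m * c m ^ 2 * Real.exp (-2 * Λ m * s) := fun m s => by
    have := hΛ m
    positivity
  have hs : Summable fun m => ∫ s, ‖Λ m * c m ^ 2 * Real.exp (-2 * Λ m * s)‖ ∂volT t := by
    simp only [Real.norm_of_nonneg (hn _ _), e]
    refine Summable.of_nonneg_of_le (fun m => ?_) (fun m => ?_) hc
    · rw [← e]; exact integral_nonneg fun s => hn m s
    · have : 0 ≤ c m ^ 2 * Real.exp (-2 * Λ m * t) := by positivity
      nlinarith [sq_nonneg (c m)]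
  have h := hasSum_integral_of_summable_integral_norm hi hs
  simp only [e] at h
  have e2 : ∫ s, S s ∂volT t = ∫ s, ∑' m, Λ m * c m ^ 2 * Real.exp (-2 * Λ m * s) ∂volT t := by
    refine integral_congr_ae ?_
    filter_upwards [ae_volT_mem t] with s hs
    exact (hS s hs.1).tsum_eq.symm
  rwa [e2]

theorem memLp_scalar_time {X : Type*} [MeasurableSpace X] {μ : Measure (ℝ × X)} {f : ℝ × X → ℝ}
    (hf : MemLp f 2 μ) (i : Fin 3) : MemLp (fun P => if i = 0 then f P else 0) 2 μ := by
  by_cases hi : i = 0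
  · simpa [hi] using hf
  · simp [hi]

/-- The series of decaying modes is a Leray-Hopf solution. -/
theorem ModeFamily.isLerayHopf [Countable ι] (hE : ModeFamily β E Λ) (hβ : 0 < β) {v₀ : Field}
    (hv₀ : ∀ i, MemLp (v₀ i) 2 volΩ) (h1 : v₀ 1 =ᵐ[volΩ] 0) (h2 : v₀ 2 =ᵐ[volΩ] 0)
    (hsq : HasSum (fun m => coeff E (v₀ 0) m ^ 2) (∫ p, v₀ 0 p * v₀ 0 p ∂volΩ))
    (hc : ∀ m, |coeff E (v₀ 0) m| ≤ A) {B : ℝ}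
    (hB : ∀ F : Finset ι, ∑ m ∈ F, Λ m * coeff E (v₀ 0) m ^ 2 ≤ B)
    {v : ℝ → Field} {G : ℝ → MField} {τ : ℝ → BField}
    (hv : ∀ t, 0 < t → v t = vel E Λ (coeff E (v₀ 0)) t)
    (hG : ∀ t, 0 < t → G t = velGrad E Λ (coeff E (v₀ 0)) t)
    (hτ : ∀ t, 0 < t → τ t = velTrace E Λ (coeff E (v₀ 0)) t) {T : ℝ} (hT : 0 < T) :
    IsLerayHopf β T v₀ v G τ := by
  set c := coeff E (v₀ 0) with hcdef
  have hBs : ∀ F : Finset ι, ∑ m ∈ F, c m ^ 2 ≤ ∫ p, v₀ 0 p * v₀ 0 p ∂volΩ := fun F =>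
    hE.bessel F (hv₀ 0)
  have hip0 : ∀ φ : Field, ip v₀ φ = ∫ p, v₀ 0 p * φ 0 p ∂volΩ := by
    intro φ
    refine integral_congr_ae ?_
    filter_upwards [h1, h2] with p hp1 hp2
    simp [Fin.sum_univ_three, hp1, hp2]
  have hpos : ∀ {X : Type} [MeasurableSpace X] (μ : Measure X) [SFinite μ],
      ∀ᵐ P ∂(volT T).prod μ, P.1 ∈ Set.Ioo 0 T := fun μ =>
    Measure.quasiMeasurePreserving_fst.ae (ae_volT_mem T)
  have mv : MemLp (fun P : ℝ × Pt => heatSeries Λ c E P.1 P.2) 2 ((volT T).prod volΩ) := by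
    refine memLp_time_of_bound
      (hE.aestronglyMeasurable_heatSeries hc hE.bound' hE.continuous)
      (fun t ht => hE.memLp_heatSeries hc hE.bound' hE.continuous ht.1)
      (C := ∫ p, v₀ 0 p * v₀ 0 p ∂volΩ) fun t ht => ?_
    have := hE.ip_vel_self_le hc ht.1 hBs
    rwa [vel, ip_scalarField_left] at this
  have mg : ∀ j, MemLp (fun P : ℝ × Pt => heatSeries Λ c (fun m => pd j (E m)) P.1 P.2) 2
      ((volT T).prod volΩ) := by
    intro j
    refine memLp_time_of_bound
      (hE.aestronglyMeasurable_heatSeries hc (fun m => hE.bound_pd m j) (hE.continuous_pd j))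
      (fun t ht => hE.memLp_heatSeries hc (fun m => hE.bound_pd m j) (hE.continuous_pd j) ht.1)
      (C := B) fun t ht => ?_
    -- The gradient norm equals the strain part of the form, which is bounded by `B` uniformly in
    -- time.
    refine le_trans ?_ (hE.form_vel_self_le hc ht.1 hB)
    rw [form, ← hE.ipM_velGrad]
    refine le_trans ?_ (le_add_of_nonneg_right (mul_nonneg hβ.le (ipΓ_self_nonneg _)))
    have hg := (hE.isVP_vel hc ht.1).2.1.2.1
    refine integral_mono ((hg 0 j).integrable_mul (hg 0 j)) (integrable_ipM hg hg) fun p => ?_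
    refine le_trans ?_ (Finset.single_le_sum (f := fun i => ∑ j, velGrad E Λ c t i j p *
      velGrad E Λ c t i j p) (fun i _ => Finset.sum_nonneg fun j _ => mul_self_nonneg _)
      (Finset.mem_univ 0))
    exact Finset.single_le_sum (f := fun j => velGrad E Λ c t 0 j p * velGrad E Λ c t 0 j p)
      (fun j _ => mul_self_nonneg _) (Finset.mem_univ j)
  have mt : ∀ b, MemLp (fun P : ℝ × (ℝ × ℝ) =>
      heatSeries Λ c (fun m => boundaryValue (E m) b) P.1 P.2) 2 ((volT T).prod volΓ) := by
    intro b
    refine memLp_time_of_bound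
      (hE.aestronglyMeasurable_heatSeries hc (hE.bound_boundaryValue b)
        (hE.continuous_boundaryValue b))
      (fun t ht => hE.memLp_heatSeries hc (hE.bound_boundaryValue b)
        (hE.continuous_boundaryValue b) ht.1)
      (C := B / β) fun t ht => ?_
    have h := hE.form_vel_self_le hc ht.1 hB
    rw [form, velTrace, ipΓ_scalarTrace_left] at h
    have h3 := Finset.single_le_sum (f := fun b => ∫ s,
      heatSeries Λ c (fun m => boundaryValue (E m) b) t s *
        heatSeries Λ c (fun m => boundaryValue (E m) b) t s ∂volΓ)
      (fun b _ => integral_mul_self_nonneg _) (Finset.mem_univ b)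
    have h4 := ipM_self_nonneg (strain (velGrad E Λ c t))
    rw [le_div_iff₀ hβ, mul_comm]
    refine (mul_le_mul_of_nonneg_left h3 hβ.le).trans ?_
    change _ + β * ∑ b, ∫ s, heatSeries Λ c (fun m => boundaryValue (E m) b) t s *
        heatSeries Λ c (fun m => boundaryValue (E m) b) t s ∂volΓ ≤ B at h
    linarith
  have mv' : ∀ i, MemLp (fun P : ℝ × Pt => v P.1 i P.2) 2 ((volT T).prod volΩ) := fun i =>
    (memLp_scalar_time mv i).ae_eq <| (hpos volΩ).mono fun P hP => by simp only [hv P.1 hP.1]; rfl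
  have mG' : ∀ i j, MemLp (fun P : ℝ × Pt => G P.1 i j P.2) 2 ((volT T).prod volΩ) := fun i j =>
    (memLp_scalar_time (mg j) i).ae_eq <| (hpos volΩ).mono fun P hP => by simp only [hG P.1 hP.1]; rfl
  have mτ' : ∀ b i, MemLp (fun P : ℝ × (ℝ × ℝ) => τ P.1 b i P.2) 2 ((volT T).prod volΓ) :=
    fun b i => (memLp_scalar_time (mt b) i).ae_eq <|
      (hpos volΓ).mono fun P hP => by simp only [hτ P.1 hP.1]; rfl
  refine ⟨?_, mv', mG', mτ', ⟨∫ p, v₀ 0 p * v₀ 0 p ∂volΩ, ?_⟩, ?_, ?_⟩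
  · filter_upwards [ae_volT_mem T] with t ht
    rw [hv t ht.1, hG t ht.1, hτ t ht.1]
    exact hE.isVP_vel hc ht.1
  · filter_upwards [ae_volT_mem T] with t ht
    rw [hv t ht.1]
    exact hE.ip_vel_self_le hc ht.1 hBs
  · rintro φ Φ σ ⟨hφH, hφ1, hφσ⟩ θ hθ ⟨T', hT', hθ0⟩
    -- The constants `K` are products of the coefficients of `v₀` and of the test field, summable by
    -- Parseval's identity.
    have hw := weak_heat hE.one_le (hE.hasSum_coeff_mul (hv₀ 0) (hφ1.1 0) hsq)
      (S := fun t => ip (vel E Λ c t) φ)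
      (S' := fun t => form β (velGrad E Λ c t) (velTrace E Λ c t) Φ σ)
      (fun t ht => Eq.mp (congrArg (HasSum · _) (funext fun m => by ring))
        (hE.hasSum_ip_vel hc ht ((hφ1.1 0).integrable one_le_two)))
      (fun t ht => Eq.mp (congrArg (HasSum · _) (funext fun m => by ring))
        (hE.hasSum_form_vel hc ht hφ1 hφσ)) hT.le hθ (hθ0 T hT'.le)
    rw [hip0, show ∫ t, ip (v t) φ * deriv θ t ∂volT T =
      ∫ t, ip (vel E Λ c t) φ * deriv θ t ∂volT T from integral_congr_ae
        ((ae_volT_mem T).mono fun t ht => by simp only [hv t ht.1]), hw]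
    refine integral_congr_ae ((ae_volT_mem T).mono fun t ht => ?_)
    simp only [hv t ht.1, hG t ht.1, hτ t ht.1, hE.conv_vel, form]
    simp [ip]
  · filter_upwards [ae_volT_mem T] with t ht
    rw [add_assoc, integral_dissipation ht.2.le mG' mτ', hip0, hv t ht.1]
    have hd := integral_dissipation_heat hE.one_le hsq.summable
      (S := fun s => form β (G s) (τ s) (G s) (τ s)) (fun s hs => by
        rw [hG s hs, hτ s hs]; exact hE.hasSum_form_vel_self hc hs) ht.1.le
    have hs := (hE.hasSum_ip_vel_self hc ht.1).mul_left (1 / 2)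
    -- The energy balance is an equality: mode by mode, `½ c²` splits into the part remaining at
    -- time `t` and the part dissipated before.
    refine le_of_eq ((hs.add hd).unique ?_)
    exact Eq.mp (congrArg (HasSum · _) (funext fun m => by ring)) (hsq.mul_left (1 / 2))

end NSChannel

namespace NSChannel

variable {β : ℝ} {ι : Type*} {E : ι → Pt → ℝ} {Λ : ι → ℝ} {c : ι → ℝ} {A : ℝ}

/-! ### The momentum equation with constant pressure -/

theorem integrable_prod_of_continuous {f : ℝ × Pt → ℝ} (hf : Continuous f) (T : ℝ) :
    Integrable f ((volT T).prod volΩ) := by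
  have hK : IsCompact (Set.Icc 0 T ×ˢ closedCell) := isCompact_Icc.prod isCompact_closedCell
  have := hf.continuousOn.integrableOn_compact (μ := volume) hK
  rw [volT, volΩ, Measure.prod_restrict]
  exact this.mono_set (Set.prod_mono Set.Ioo_subset_Icc_self cell_subset_closedCell)

theorem exists_bound_prod {f : ℝ × Pt → ℝ} (hf : Continuous f) (T : ℝ) :
    ∃ C, 0 ≤ C ∧ ∀ P : ℝ × Pt, P.1 ∈ Set.Ioo 0 T → P.2 ∈ cell → |f P| ≤ C := by
  have hK : IsCompact (Set.Icc 0 T ×ˢ closedCell) := isCompact_Icc.prod isCompact_closedCell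
  obtain ⟨C, hC⟩ := hK.exists_bound_of_continuousOn hf.continuousOn
  exact ⟨max C 0, le_max_right _ _, fun P h1 h2 => (hC P
    ⟨Set.Ioo_subset_Icc_self h1, cell_subset_closedCell h2⟩).trans (le_max_left _ _)⟩

theorem ae_prod_mem (T : ℝ) :
    ∀ᵐ P ∂(volT T).prod volΩ, P.1 ∈ Set.Ioo 0 T ∧ P.2 ∈ cell :=
  (Measure.quasiMeasurePreserving_fst.ae (ae_volT_mem T)).and
    (Measure.quasiMeasurePreserving_snd.ae ae_mem_cell)

/-- The test functions for the momentum equation. -/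
def IsSpaceTimeTest (T : ℝ) (ψ : ℝ × Pt → ℝ) : Prop :=
  ContDiff ℝ ∞ ψ ∧ (∀ t, Periodic fun p => ψ (t, p)) ∧
    ∃ a b δ : ℝ, 0 < a ∧ b < T ∧ δ < 1 ∧
      ∀ t x y z : ℝ, (t ≤ a ∨ b ≤ t ∨ δ ≤ |z|) → ψ (t, x, y, z) = 0

section Test

variable {T : ℝ} {ψ : ℝ × Pt → ℝ}

theorem IsSpaceTimeTest.slice (hψ : IsSpaceTimeTest T ψ) (t : ℝ) :
    IsInteriorTest fun p => ψ (t, p) := by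
  obtain ⟨h1, h2, a, b, δ, ha, hb, hδ, h0⟩ := hψ
  exact ⟨⟨h1.comp (by fun_prop), h2 t⟩, δ, hδ, fun x y z hz => h0 t x y z (Or.inr (Or.inr hz))⟩

theorem pd_slice (hψ : ContDiff ℝ ∞ ψ) (j : Fin 3) (P : ℝ × Pt) :
    pd j (fun p => ψ (P.1, p)) P.2 = fderiv ℝ ψ P (0, dir j) := by
  have h1 : HasFDerivAt (fun p : Pt => (P.1, p)) (ContinuousLinearMap.inr ℝ ℝ Pt) P.2 :=
    hasFDerivAt_prodMk_right P.1 P.2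
  have h2 : HasFDerivAt ψ (fderiv ℝ ψ (P.1, P.2)) (P.1, P.2) :=
    (hψ.differentiable (by simp) _).hasFDerivAt
  have := (h2.comp P.2 h1).fderiv
  simp only [pd]
  rw [show (fun p => ψ (P.1, p)) = ψ ∘ fun p => (P.1, p) from rfl, this]
  rfl

theorem hasDerivAt_time (hψ : ContDiff ℝ ∞ ψ) (t : ℝ) (p : Pt) :
    HasDerivAt (fun t => ψ (t, p)) (fderiv ℝ ψ (t, p) (1, 0)) t :=
  ((hψ.differentiable (by simp) (t, p)).hasFDerivAt).comp_hasDerivAt t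
    ((hasDerivAt_id t).prodMk (hasDerivAt_const t p))

theorem continuous_fderiv_apply (hψ : ContDiff ℝ ∞ ψ) (e : ℝ × Pt) :
    Continuous fun P => fderiv ℝ ψ P e :=
  (hψ.continuous_fderiv (by simp)).clm_apply continuous_const

theorem fderiv_eq_zero_of_lt {a : ℝ} (h : ∀ t p, t ≤ a → ψ (t, p) = 0) {P : ℝ × Pt}
    (hP : P.1 < a) : fderiv ℝ ψ P = 0 := by
  have : ψ =ᶠ[𝓝 P] fun _ => 0 := by
    filter_upwards [(isOpen_lt continuous_fst continuous_const).mem_nhds hP] with Q hQ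
    exact h Q.1 Q.2 (le_of_lt hQ)
  rw [this.fderiv_eq]
  simp

theorem integral_pd_slice (hψ : IsSpaceTimeTest T ψ) (i : Fin 3) (t : ℝ) :
    ∫ p, fderiv ℝ ψ (t, p) (0, dir i) ∂volΩ = 0 := by
  have h1 : IsTest fun _ => (1 : ℝ) := ⟨contDiff_const, fun _ _ _ => ⟨rfl, rfl⟩⟩
  have := h1.hasWeakPD i _ (hψ.slice t)
  simp only [one_mul, pd_slice hψ.1 i (t, _)] at this
  rw [this]
  simp [pd]

theorem integral_heat_test_time (hψ : IsSpaceTimeTest T ψ) (hT : 0 ≤ T) (l : ℝ) (p : Pt) :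
    ∫ t, Real.exp (-l * t) * fderiv ℝ ψ (t, p) (1, 0) ∂volT T =
      ∫ t, Real.exp (-l * t) * l * ψ (t, p) ∂volT T := by
  obtain ⟨h1, h2, a, b, δ, ha, hb, hδ, h0⟩ := hψ
  have hs : ContDiff ℝ ∞ fun t => ψ (t, p) := h1.comp (by fun_prop)
  have h := integral_exp_mul_deriv hT hs (h0 T _ _ _ (Or.inr (Or.inl hb.le))) l
  have e0 : ψ (0, p) = 0 := h0 0 _ _ _ (Or.inl ha.le)
  rw [e0, add_zero] at h
  rw [← h]
  congr 1; ext t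
  rw [(hasDerivAt_time h1 t p).deriv]

/-- A decaying mode solves the momentum equation without pressure. -/
theorem ModeFamily.integral_mode_test (hE : ModeFamily β E Λ) (hψ : IsSpaceTimeTest T ψ)
    (hT : 0 ≤ T) (m : ι) :
    ∫ P : ℝ × Pt, Real.exp (-Λ m * P.1) * (E m P.2 * fderiv ℝ ψ P (1, 0) -
      ∑ j, pd j (E m) P.2 * fderiv ℝ ψ P (0, dir j)) ∂((volT T).prod volΩ) = 0 := by
  have ft := (hE.robin m).isTest
  have c0 := hψ.1.continuous
  have c1 := continuous_fderiv_apply hψ.1 (1, 0)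
  have c2 := fun j => continuous_fderiv_apply hψ.1 (0, dir j)
  have cE := hE.continuous m
  have cp := fun j => hE.continuous_pd j m
  have i1 : Integrable (fun P : ℝ × Pt => E m P.2 * (Real.exp (-Λ m * P.1) *
      fderiv ℝ ψ P (1, 0))) ((volT T).prod volΩ) := integrable_prod_of_continuous (by fun_prop) T
  have i2 : Integrable (fun P : ℝ × Pt => Real.exp (-Λ m * P.1) *
      ∑ j, pd j (E m) P.2 * fderiv ℝ ψ P (0, dir j)) ((volT T).prod volΩ) :=
    integrable_prod_of_continuous (by fun_prop) T
  have i3 : Integrable (fun P : ℝ × Pt => E m P.2 * (Real.exp (-Λ m * P.1) * Λ m * ψ P))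
      ((volT T).prod volΩ) := integrable_prod_of_continuous (by fun_prop) T
  -- Both terms of the equation equal `∫ Λ exp(-Λt) E ψ`: this one by parts in time, the other
  -- (`e2`) by parts in space and `-ΔE = ΛE`.
  have e1 : ∫ P : ℝ × Pt, E m P.2 * (Real.exp (-Λ m * P.1) * fderiv ℝ ψ P (1, 0))
      ∂((volT T).prod volΩ) = ∫ P : ℝ × Pt, E m P.2 * (Real.exp (-Λ m * P.1) * Λ m * ψ P)
      ∂((volT T).prod volΩ) := by
    rw [integral_prod_symm _ i1, integral_prod_symm _ i3]
    congr 1; ext p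
    simp only [integral_const_mul]
    rw [integral_heat_test_time hψ hT]
  have e2 : ∫ P : ℝ × Pt, Real.exp (-Λ m * P.1) *
      ∑ j, pd j (E m) P.2 * fderiv ℝ ψ P (0, dir j) ∂((volT T).prod volΩ) =
      ∫ P : ℝ × Pt, E m P.2 * (Real.exp (-Λ m * P.1) * Λ m * ψ P) ∂((volT T).prod volΩ) := by
    rw [integral_prod _ i2, integral_prod _ i3]
    congr 1; ext t
    have hs := hψ.slice t
    have hj : ∀ j, Integrable (fun p => pd j (E m) p * fderiv ℝ ψ (t, p) (0, dir j)) volΩ :=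
      fun j => integrable_of_continuous ((cp j).mul ((c2 j).comp (by fun_prop)))
    have hw : ∀ j, ∫ p, pd j (E m) p * fderiv ℝ ψ (t, p) (0, dir j) ∂volΩ =
        -∫ p, pd j (pd j (E m)) p * ψ (t, p) ∂volΩ := fun j => by
      have := (ft.pd j).hasWeakPD j _ hs
      simpa only [pd_slice hψ.1 j (t, _)] using this
    have hz : ∀ p, pd 0 (pd 0 (E m)) p = 0 := by
      intro p
      rw [show pd 0 (E m) = fun _ => 0 from funext (hE.pd_zero m)]
      simp [pd]
    have k1 : Integrable (fun p => pd 1 (pd 1 (E m)) p * ψ (t, p)) volΩ :=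
      integrable_of_continuous (((ft.pd 1).continuous_pd 1).mul hs.1.continuous)
    have k2 : Integrable (fun p => pd 2 (pd 2 (E m)) p * ψ (t, p)) volΩ :=
      integrable_of_continuous (((ft.pd 2).continuous_pd 2).mul hs.1.continuous)
    simp only [integral_const_mul]
    rw [integral_finsetSum _ fun j _ => hj j]
    simp only [hw, Fin.sum_univ_three, hz, zero_mul, integral_zero, neg_zero, zero_add]
    rw [← neg_add, ← integral_add k1 k2, ← integral_neg, ← integral_const_mul]
    congr 1; ext p
    rw [← add_mul, (hE.robin m).laplace]
    ring
  rw [← sub_eq_zero] at e1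
  calc _ = ∫ P : ℝ × Pt, (E m P.2 * (Real.exp (-Λ m * P.1) * fderiv ℝ ψ P (1, 0)) -
        Real.exp (-Λ m * P.1) * ∑ j, pd j (E m) P.2 * fderiv ℝ ψ P (0, dir j))
        ∂((volT T).prod volΩ) := by congr 1; ext P; ring
    _ = 0 := by rw [integral_sub i1 i2, e2, e1]

end Test

theorem ModeFamily.integral_heat_test [Countable ι] (hE : ModeFamily β E Λ)
    (hc : ∀ m, |c m| ≤ A) {T : ℝ} (hT : 0 ≤ T) {ψ : ℝ × Pt → ℝ} (hψ : IsSpaceTimeTest T ψ) :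
    ∫ P : ℝ × Pt, (heatSeries Λ c E P.1 P.2 * fderiv ℝ ψ P (1, 0) -
      ∑ j, heatSeries Λ c (fun m => pd j (E m)) P.1 P.2 * fderiv ℝ ψ P (0, dir j))
      ∂((volT T).prod volΩ) = 0 := by
  -- The test function vanishes for `t ≤ a` with `a > 0`, so `Λ exp(-Λa)` is a summable majorant and
  -- the limited regularity at `t = 0` does not matter.
  obtain ⟨a, ha, h0⟩ : ∃ a, 0 < a ∧ ∀ P : ℝ × Pt, P.1 < a → fderiv ℝ ψ P = 0 := by
    obtain ⟨_, _, a, b, δ, ha, hb, hδ, h0⟩ := hψ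
    exact ⟨a, ha, fun P hP =>
      fderiv_eq_zero_of_lt (fun t p ht => h0 t _ _ _ (Or.inl ht)) hP⟩
  have c1 := continuous_fderiv_apply hψ.1 (1, 0)
  have c2 := fun j => continuous_fderiv_apply hψ.1 (0, dir j)
  have hA : ∀ m, 0 ≤ A := fun m => (abs_nonneg _).trans (hc m)
  have hi : ∀ m, Integrable (fun P : ℝ × Pt => c m * (Real.exp (-Λ m * P.1) *
      (E m P.2 * fderiv ℝ ψ P (1, 0) - ∑ j, pd j (E m) P.2 * fderiv ℝ ψ P (0, dir j))))
      ((volT T).prod volΩ) := fun m => by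
    have cE := hE.continuous m
    have cp := fun j => hE.continuous_pd j m
    exact integrable_prod_of_continuous (by fun_prop) T
  have hbi : Integrable (fun P : ℝ × Pt => |fderiv ℝ ψ P (1, 0)| +
      ∑ j, |fderiv ℝ ψ P (0, dir j)|) ((volT T).prod volΩ) :=
    integrable_prod_of_continuous
      (c1.abs.add (continuous_finsetSum _ fun j _ => (c2 j).abs)) T
  have hle : ∀ m (P : ℝ × Pt), ‖c m * (Real.exp (-Λ m * P.1) *
      (E m P.2 * fderiv ℝ ψ P (1, 0) - ∑ j, pd j (E m) P.2 * fderiv ℝ ψ P (0, dir j)))‖ ≤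
      A * (Λ m * Real.exp (-Λ m * a)) *
        (|fderiv ℝ ψ P (1, 0)| + ∑ j, |fderiv ℝ ψ P (0, dir j)|) := by
    intro m P
    rcases lt_or_ge P.1 a with hP | hP
    · simp [h0 P hP]
    · have hl : 0 ≤ Λ m := zero_le_one.trans (hE.one_le m)
      rw [norm_mul, norm_mul, Real.norm_eq_abs, Real.norm_eq_abs, Real.norm_eq_abs, Real.abs_exp]
      have e1 : |E m P.2 * fderiv ℝ ψ P (1, 0) -
          ∑ j, pd j (E m) P.2 * fderiv ℝ ψ P (0, dir j)| ≤
          Λ m * (|fderiv ℝ ψ P (1, 0)| + ∑ j, |fderiv ℝ ψ P (0, dir j)|) := by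
        refine (abs_sub _ _).trans ?_
        rw [mul_add, Finset.mul_sum]
        refine add_le_add ?_ ((Finset.abs_sum_le_sum_abs _ _).trans
          (Finset.sum_le_sum fun j _ => ?_))
        · rw [abs_mul]; exact mul_le_mul_of_nonneg_right (hE.bound' m _) (abs_nonneg _)
        · rw [abs_mul]; exact mul_le_mul_of_nonneg_right (hE.bound_pd m j _) (abs_nonneg _)
      have e2 : Real.exp (-Λ m * P.1) ≤ Real.exp (-Λ m * a) := by
        apply Real.exp_le_exp.2
        nlinarith
      calc _ ≤ A * (Real.exp (-Λ m * a) *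
            (Λ m * (|fderiv ℝ ψ P (1, 0)| + ∑ j, |fderiv ℝ ψ P (0, dir j)|))) :=
            mul_le_mul (hc m) (mul_le_mul e2 e1 (abs_nonneg _) (Real.exp_pos _).le)
              (by positivity) (hA m)
        _ = _ := by ring
  have hs : Summable fun m => ∫ P : ℝ × Pt, ‖c m * (Real.exp (-Λ m * P.1) *
      (E m P.2 * fderiv ℝ ψ P (1, 0) - ∑ j, pd j (E m) P.2 * fderiv ℝ ψ P (0, dir j)))‖
      ∂((volT T).prod volΩ) := by
    refine Summable.of_nonneg_of_le (fun m => integral_nonneg fun P => norm_nonneg _) (fun m => ?_)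
      (((hE.summable_mul_exp ha).mul_left A).mul_right
        (∫ P : ℝ × Pt, (|fderiv ℝ ψ P (1, 0)| + ∑ j, |fderiv ℝ ψ P (0, dir j)|)
          ∂((volT T).prod volΩ)))
    rw [← integral_const_mul]
    exact integral_mono (hi m).norm (hbi.const_mul _) (hle m)
  have h := hasSum_integral_of_summable_integral_norm hi hs
  simp only [integral_const_mul, hE.integral_mode_test hψ hT, mul_zero] at h
  refine Eq.trans (integral_congr_ae ?_) (h.unique hasSum_zero)
  filter_upwards [ae_prod_mem T] with P hP
  have s1 := hE.summable_heat hc hE.bound' hP.1.1 P.2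
  have s2 := fun j => hE.summable_heat (H := fun m => pd j (E m)) hc
    (fun m => hE.bound_pd m j) hP.1.1 P.2
  refine (HasSum.tsum_eq ?_).symm
  refine Eq.mp (congrArg (HasSum · _) (funext fun m => ?_))
    ((s1.hasSum.mul_right (fderiv ℝ ψ P (1, 0))).sub
      (hasSum_sum fun j (_ : j ∈ Finset.univ) =>
        (s2 j).hasSum.mul_right (fderiv ℝ ψ P (0, dir j))))
  simp only [mul_sub, Finset.mul_sum]
  congr 1
  · ring
  · exact Finset.sum_congr rfl fun j _ => by ring

/-- The momentum equation holds with any constant pressure. -/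
theorem ModeFamily.isPressure [Countable ι] (hE : ModeFamily β E Λ) (hc : ∀ m, |c m| ≤ A)
    {v : ℝ → Field} {G : ℝ → MField} (hv : ∀ t, 0 < t → v t = vel E Λ c t)
    (hG : ∀ t, 0 < t → G t = velGrad E Λ c t) {T : ℝ} (hT : 0 < T)
    (mv : ∀ i, MemLp (fun P : ℝ × Pt => v P.1 i P.2) 2 ((volT T).prod volΩ))
    (mG : ∀ i j, MemLp (fun P : ℝ × Pt => G P.1 i j P.2) 2 ((volT T).prod volΩ)) (Q₀ : ℝ) :
    IsPressure T v G fun _ _ => Q₀ := by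
  refine ⟨fun a b δ _ _ _ => ?_, fun ψ h1 h2 h3 i => ?_⟩
  · have hfin : volume (Set.Ioo a b ×ˢ (cell ∩ {p : Pt | |p.2.2| < δ})) ≠ ⊤ := by
      rw [Measure.volume_eq_prod, Measure.prod_prod]
      refine ENNReal.mul_ne_top (by simp) (ne_top_of_le_ne_top ?_
        (measure_mono (Set.inter_subset_left.trans cell_subset_closedCell)))
      exact isCompact_closedCell.measure_ne_top
    exact integrableOn_const hfin
  · have hψ : IsSpaceTimeTest T ψ := ⟨h1, h2, h3⟩
    simp only [pd_slice h1]
    have c1 := continuous_fderiv_apply h1 (1, 0)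
    have c2 := fun j => continuous_fderiv_apply h1 (0, dir j)
    have bm : ∀ {f g : ℝ × Pt → ℝ}, Integrable f ((volT T).prod volΩ) → Continuous g →
        Integrable (fun P => f P * g P) ((volT T).prod volΩ) := by
      intro f g hf hg
      obtain ⟨C, -, hC⟩ := exists_bound_prod hg T
      exact hf.mul_bdd (c := C) hg.aestronglyMeasurable
        ((ae_prod_mem T).mono fun P hP => hC P hP.1 hP.2)
    have J : Integrable (fun P : ℝ × Pt => v P.1 i P.2 * fderiv ℝ ψ P (1, 0) -
        ∑ j, G P.1 i j P.2 * fderiv ℝ ψ P (0, dir j)) ((volT T).prod volΩ) :=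
      (bm ((mv i).integrable one_le_two) c1).sub (integrable_finsetSum _ fun j _ =>
        bm ((mG i j).integrable one_le_two) (c2 j))
    have JQ : Integrable (fun P : ℝ × Pt => Q₀ * fderiv ℝ ψ P (0, dir i))
        ((volT T).prod volΩ) :=
      (integrable_prod_of_continuous (c2 i) T).const_mul Q₀
    -- Spatial derivatives of a test function have zero integral over the cell at each time.
    have hQ : ∫ P : ℝ × Pt, Q₀ * fderiv ℝ ψ P (0, dir i) ∂((volT T).prod volΩ) = 0 := by
      rw [integral_prod _ JQ]
      simp only [integral_const_mul, integral_pd_slice hψ, mul_zero, integral_zero]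
    have hmain : ∫ P : ℝ × Pt, (v P.1 i P.2 * fderiv ℝ ψ P (1, 0) -
        ∑ j, G P.1 i j P.2 * fderiv ℝ ψ P (0, dir j)) ∂((volT T).prod volΩ) = 0 := by
      by_cases hi : i = 0
      · subst hi
        refine Eq.trans (integral_congr_ae ?_) (hE.integral_heat_test hc hT.le hψ)
        filter_upwards [ae_prod_mem T] with P hP
        simp only [hv P.1 hP.1.1, hG P.1 hP.1.1, vel, velGrad, scalarField, scalarGrad, if_true]
      · refine integral_eq_zero_of_ae ?_
        filter_upwards [ae_prod_mem T] with P hP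
        simp [hv P.1 hP.1.1, hG P.1 hP.1.1, vel, velGrad, scalarField, scalarGrad, hi]
    calc _ = ∫ P : ℝ × Pt, ((v P.1 i P.2 * fderiv ℝ ψ P (1, 0) -
          ∑ j, G P.1 i j P.2 * fderiv ℝ ψ P (0, dir j)) + Q₀ * fderiv ℝ ψ P (0, dir i))
          ∂((volT T).prod volΩ) := by
          refine integral_congr_ae ?_
          filter_upwards [ae_prod_mem T] with P hP
          rw [hv P.1 hP.1.1, hG P.1 hP.1.1, hE.conv_vel]
          simp
      _ = 0 := by rw [integral_add J JQ, hmain, hQ, add_zero]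

end NSChannel

namespace NSChannel

variable {β : ℝ} {ι : Type*} {E : ι → Pt → ℝ} {Λ : ι → ℝ} {A : ℝ}

/-! ### Uniqueness of Leray-Hopf solutions -/

/-- A function with an integrable weak derivative and prescribed initial value is given by
integration. -/
theorem ae_eq_of_weak_derivative {T : ℝ} (hT : 0 < T) {W K : ℝ → ℝ} {W₀ : ℝ}
    (hW : Integrable W (volT T)) (hK : Integrable K (volT T))
    (h : ∀ χ : ℝ → ℝ, ContDiff ℝ ∞ χ → (∃ T' < T, ∀ t, T' ≤ t → χ t = 0) →
      (∫ t, W t * deriv χ t ∂volT T) + W₀ * χ 0 = ∫ t, K t * χ t ∂volT T) :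
    ∀ᵐ t ∂volT T, W t = W₀ - ∫ s, K s ∂volT t := by
  have hmeas : AEStronglyMeasurable (fun P : ℝ × ℝ => if P.2 < P.1 then K P.2 else 0)
      ((volT T).prod (volT T)) := by
    have : (fun P : ℝ × ℝ => if P.2 < P.1 then K P.2 else 0) =
        Set.indicator {P : ℝ × ℝ | P.2 < P.1} fun P => K P.2 := rfl
    rw [this]
    exact hK.aestronglyMeasurable.comp_snd.indicator (measurableSet_lt measurable_snd measurable_fst)
  have hint : Integrable (fun P : ℝ × ℝ => if P.2 < P.1 then K P.2 else 0)
      ((volT T).prod (volT T)) := by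
    refine (hK.comp_snd (volT T)).mono hmeas (Eventually.of_forall fun P => ?_)
    split_ifs
    · exact le_rfl
    · simp
  -- The primitive is rewritten over the fixed interval `(0, T)` with an indicator, ready for Fubini
  -- on the triangle `s < t`.
  have hprim : ∀ t ∈ Set.Ioo 0 T, ∫ s, K s ∂volT t =
      ∫ s, (if s < t then K s else 0) ∂volT T := by
    intro t ht
    have : (fun s => if s < t then K s else 0) = Set.indicator (Set.Iio t) K := rfl
    rw [this, integral_indicator measurableSet_Iio]
    simp only [volT]
    rw [Measure.restrict_restrict measurableSet_Iio]
    congr 2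
    ext s
    simp only [Set.mem_Ioo, Set.mem_inter_iff, Set.mem_Iio]
    exact ⟨fun h => ⟨h.2, h.1, h.2.trans ht.2⟩, fun h => ⟨h.2.1, h.1⟩⟩
  set Y : ℝ → ℝ := fun t => W t - W₀ + ∫ s, (if s < t then K s else 0) ∂volT T with hY
  have hYi : Integrable Y (volT T) := (hW.sub (integrable_const W₀)).add hint.integral_prod_left
  have hY0 : Y =ᵐ[volT T] 0 := by
    refine determining_supportedFamily hT Y hYi fun η hη => ?_
    obtain ⟨hη, ⟨a', b', ha', hb', h0⟩, hη1⟩ := hη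
    -- The primitive of `η` that vanishes at `T` is an admissible test function, as `η` is zero near
    -- `T`; its value at `0` is minus the total integral of `η` and brings in the initial value
    -- `W₀`.
    set χ : ℝ → ℝ := fun t => ∫ s in T..t, η s with hχ
    have hd : ∀ t, HasDerivAt χ (η t) t := fun t =>
      intervalIntegral.integral_hasDerivAt_right (hη.continuous.intervalIntegrable _ _)
        (hη.continuous.stronglyMeasurableAtFilter _ _) hη.continuous.continuousAt
    have hdd : deriv χ = η := funext fun t => (hd t).deriv
    have hχs : ContDiff ℝ ∞ χ := by
      rw [contDiff_infty_iff_deriv, hdd]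
      exact ⟨fun t => (hd t).differentiableAt, hη⟩
    have hχ0 : ∀ t, b' ≤ t → χ t = 0 := by
      intro t ht
      refine intervalIntegral.integral_zero_ae (Eventually.of_forall fun s hs => ?_)
      refine h0 s (Or.inr ?_)
      rw [Set.uIoc, Set.mem_Ioc] at hs
      exact (lt_of_le_of_lt (le_min hb'.le ht) hs.1).le
    have hχe : ∀ s ∈ Set.Icc 0 T, ∫ t, (if s < t then η t else 0) ∂volT T = -χ s := by
      intro s hs
      have : (fun t => if s < t then η t else 0) = Set.indicator (Set.Ioi s) η := rfl
      rw [this, integral_indicator measurableSet_Ioi]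
      simp only [volT]
      rw [Measure.restrict_restrict measurableSet_Ioi, hχ]
      simp only
      rw [← intervalIntegral.integral_symm, intervalIntegral.integral_of_le hs.2,
        integral_Ioc_eq_integral_Ioo]
      congr 2
      ext t
      simp only [Set.mem_Ioo, Set.mem_inter_iff, Set.mem_Ioi]
      exact ⟨fun h => ⟨h.1, h.2.2⟩, fun h => ⟨h.1, lt_of_le_of_lt hs.1 h.1, h.2⟩⟩
    have hw := h χ hχs ⟨b', hb', hχ0⟩
    rw [hdd] at hw
    have hηi : Integrable η (volT T) := integrable_volT_of_continuous hη.continuous T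
    have e0 : ∫ t, η t ∂volT T = -χ 0 := by
      rw [← hχe 0 ⟨le_rfl, hT.le⟩]
      refine integral_congr_ae ((ae_volT_mem T).mono fun t ht => ?_)
      simp only [if_pos ht.1]
    have bη : ∀ {f : ℝ → ℝ}, Integrable f (volT T) → Integrable (fun t => f t * η t) (volT T) :=
      fun hf => hf.mul_bdd (c := 1) hη.continuous.aestronglyMeasurable (Eventually.of_forall hη1)
    have hint2 : Integrable (fun P : ℝ × ℝ => (if P.2 < P.1 then K P.2 else 0) * η P.1)
        ((volT T).prod (volT T)) :=
      hint.mul_bdd (c := 1) (hη.continuous.comp continuous_fst).aestronglyMeasurable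
        (Eventually.of_forall fun P => hη1 _)
    have e1 : ∫ t, (∫ s, (if s < t then K s else 0) ∂volT T) * η t ∂volT T =
        - ∫ t, K t * χ t ∂volT T := by
      simp only [← integral_mul_const]
      rw [integral_integral_swap hint2, ← integral_neg]
      refine integral_congr_ae ((ae_volT_mem T).mono fun s hs => ?_)
      simp only
      rw [← mul_neg, ← hχe s ⟨hs.1.le, hs.2.le⟩, ← integral_const_mul]
      congr 1; ext t
      split_ifs <;> simp
    have e2 : ∫ t, Y t * η t ∂volT T = ∫ t, W t * η t ∂volT T - ∫ t, W₀ * η t ∂volT T +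
        ∫ t, (∫ s, (if s < t then K s else 0) ∂volT T) * η t ∂volT T := by
      rw [← integral_sub (bη hW) (hηi.const_mul W₀), ← integral_add
        (f := fun t => W t * η t - W₀ * η t) ((bη hW).sub (hηi.const_mul W₀))
        (bη hint.integral_prod_left)]
      congr 1; ext t; simp only [hY]; ring
    change ∫ t, Y t * η t ∂volT T = 0
    rw [e2, e1, integral_const_mul, e0, ← hw]
    ring
  filter_upwards [hY0, ae_volT_mem T] with t ht htm
  rw [hprim t htm]
  simp only [hY, Pi.zero_apply] at ht
  linarith

/-- Gronwall's inequality for an integral inequality holding almost everywhere. -/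
theorem ae_le_of_gronwall {T : ℝ} {y g Γ : ℝ → ℝ} {ε C : ℝ} (hε : 0 ≤ ε)
    (hy : Integrable y (volT T)) (hC : ∀ᵐ t ∂volT T, y t ≤ C) (hC0 : 0 ≤ C)
    (hg : Continuous g) (hg0 : ∀ t, 0 ≤ g t) (hΓ : ∀ t, HasDerivAt Γ (g t) t) (hΓ0 : Γ 0 = 0)
    (h : ∀ᵐ t ∂volT T, y t ≤ ε + ∫ s, g s * y s ∂volT t) :
    ∀ᵐ t ∂volT T, y t ≤ 2 * ε * Real.exp (2 * Γ t) := by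
  have hΓm : ∀ t, 0 ≤ t → 0 ≤ Γ t := by
    intro t ht
    rw [← hΓ0]
    exact monotone_of_hasDerivAt_nonneg hΓ hg0 ht
  have hΓc : Continuous Γ := continuous_iff_continuousAt.2 fun t => (hΓ t).continuousAt
  -- Iteration in a weighted norm: the bound `S exp(2Γ)` improves to `(ε + S/2) exp(2Γ)`, because `∫
  -- 2g exp(2Γ) = exp(2Γ) - 1`. The fixed point is `S = 2ε`. Neither continuity nor a sign of `y` is
  -- needed.
  have step : ∀ k : ℕ, ∀ᵐ t ∂volT T, y t ≤ (2 * ε + C / 2 ^ k) * Real.exp (2 * Γ t) := by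
    intro k
    induction k with
    | zero =>
      filter_upwards [hC, ae_volT_mem T] with t ht htm
      have : 1 ≤ Real.exp (2 * Γ t) := Real.one_le_exp (by linarith [hΓm t htm.1.le])
      rw [pow_zero, div_one]
      nlinarith
    | succ k ih =>
      filter_upwards [h, ae_volT_mem T] with t ht htm
      have hle := volT_mono htm.2.le
      have ih' : ∀ᵐ s ∂volT t, y s ≤ (2 * ε + C / 2 ^ k) * Real.exp (2 * Γ s) :=
        ae_mono hle ih
      set S := 2 * ε + C / 2 ^ k with hS
      have hS0 : 0 ≤ S := by positivity
      have i1 : Integrable (fun s => g s * y s) (volT t) := by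
        obtain ⟨M, -, hM⟩ := exists_bound_volT hg t
        exact (hy.mono_measure hle).bdd_mul (c := M) hg.aestronglyMeasurable
          ((ae_volT_mem t).mono fun s hs => hM s hs)
      have i2 : Continuous fun s => g s * (2 * Real.exp (2 * Γ s)) := by fun_prop
      have e : ∫ s, g s * (2 * Real.exp (2 * Γ s)) ∂volT t = Real.exp (2 * Γ t) - 1 := by
        have := integral_Ioo_deriv htm.1.le
          (f := fun s => Real.exp (2 * Γ s)) (f' := fun s => g s * (2 * Real.exp (2 * Γ s)))
          (fun s => by
            have := ((hΓ s).const_mul 2).exp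
            convert this using 1; ring) i2
        simpa [hΓ0, volT] using this
      have hint : ∫ s, g s * y s ∂volT t ≤
          ∫ s, S / 2 * (g s * (2 * Real.exp (2 * Γ s))) ∂volT t := by
        refine integral_mono_ae i1 ((integrable_volT_of_continuous i2 t).const_mul _) ?_
        filter_upwards [ih'] with s hs
        calc g s * y s ≤ g s * (S * Real.exp (2 * Γ s)) := mul_le_mul_of_nonneg_left hs (hg0 s)
          _ = _ := by ring
      rw [integral_const_mul, e] at hint
      have h1 : 1 ≤ Real.exp (2 * Γ t) := Real.one_le_exp (by linarith [hΓm t htm.1.le])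
      have e2 : 2 * ε + C / 2 ^ (k + 1) = ε + S / 2 := by rw [hS, pow_succ]; field_simp; ring
      rw [e2]
      nlinarith
  have hall := ae_all_iff.2 step
  filter_upwards [hall] with t ht
  have hlim : Tendsto (fun k : ℕ => (2 * ε + C / 2 ^ k) * Real.exp (2 * Γ t)) atTop
      (𝓝 ((2 * ε + 0) * Real.exp (2 * Γ t))) := by
    refine (tendsto_const_nhds.add ?_).mul_const _
    have := (tendsto_pow_atTop_nhds_zero_of_lt_one (r := (1 / 2 : ℝ)) (by norm_num)
      (by norm_num)).const_mul C
    rw [mul_zero] at this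
    refine this.congr fun k => ?_
    rw [one_div, inv_pow]; rfl
  rw [add_zero] at hlim
  exact ge_of_tendsto' hlim ht

theorem form_comm (β : ℝ) (G Φ : MField) (τ σ : BField) :
    form β G τ Φ σ = form β Φ σ G τ := by
  simp only [form, ipM, ipΓ, mul_comm]

section

variable {T : ℝ} {v₀ : Field} {w : ℝ → Field} {G : ℝ → MField} {τ : ℝ → BField}

theorem IsLerayHopf.integrable_conv (hw : IsLerayHopf β T v₀ w G τ) (i : Fin 3) :
    Integrable (fun P : ℝ × Pt => conv (w P.1) (G P.1) i P.2) ((volT T).prod volΩ) :=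
  integrable_finsetSum _ fun j _ => (hw.memLp j).integrable_mul (hw.memLp_grad i j)

theorem ModeFamily.integrable_coeff_time (hE : ModeFamily β E Λ) {f : ℝ → Pt → ℝ}
    (hf : Integrable (fun P : ℝ × Pt => f P.1 P.2) ((volT T).prod volΩ)) (m : ι) :
    Integrable (fun t => coeff E (f t) m) (volT T) := by
  have : Integrable (fun P : ℝ × Pt => E m P.2 * f P.1 P.2) ((volT T).prod volΩ) :=
    hf.bdd_mul (c := 1) ((hE.continuous m).comp continuous_snd).aestronglyMeasurable
      (Eventually.of_forall fun P => hE.bound m _)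
  exact this.integral_prod_left

theorem integrable_continuous_mul_volT {f g : ℝ → ℝ} (hf : Integrable f (volT T))
    (hg : Continuous g) : Integrable (fun t => g t * f t) (volT T) := by
  obtain ⟨M, -, hM⟩ := exists_bound_volT hg T
  exact hf.bdd_mul (c := M) hg.aestronglyMeasurable ((ae_volT_mem T).mono fun s hs => hM s hs)

theorem IsLerayHopf.integrable_coeff (hE : ModeFamily β E Λ) (hw : IsLerayHopf β T v₀ w G τ)
    (m : ι) : Integrable (fun t => coeff E (w t 0) m) (volT T) :=
  hE.integrable_coeff_time (f := fun t => w t 0) ((hw.memLp 0).integrable one_le_two) m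

theorem IsLerayHopf.integrable_coeff_conv (hE : ModeFamily β E Λ)
    (hw : IsLerayHopf β T v₀ w G τ) (m : ι) :
    Integrable (fun t => coeff E (conv (w t) (G t) 0) m) (volT T) :=
  hE.integrable_coeff_time (f := fun t => conv (w t) (G t) 0) (hw.integrable_conv 0) m

/-- The equation for the Fourier coefficients of a Leray-Hopf solution. -/
theorem IsLerayHopf.coeff_eq (hT : 0 < T) (hE : ModeFamily β E Λ)
    (hw : IsLerayHopf β T v₀ w G τ) (m : ι) :
    ∀ᵐ t ∂volT T, Real.exp (-Λ m * t) * coeff E (w t 0) m = coeff E (v₀ 0) m -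
      ∫ s, Real.exp (-Λ m * s) * (2 * Λ m * coeff E (w s 0) m +
        coeff E (conv (w s) (G s) 0) m) ∂volT t := by
  have iw := hw.integrable_coeff hE m
  have iN := hw.integrable_coeff_conv hE m
  have cexp : Continuous fun t => Real.exp (-Λ m * t) := by fun_prop
  have iK : Integrable (fun s => 2 * Λ m * coeff E (w s 0) m +
        coeff E (conv (w s) (G s) 0) m) (volT T) := (iw.const_mul _).add iN
  refine ae_eq_of_weak_derivative hT (integrable_continuous_mul_volT iw cexp)
    (integrable_continuous_mul_volT iK cexp) fun χ hχ ⟨T', hT', hχ0⟩ => ?_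
  -- The test function carries `exp(-Λt)`, so the coefficient of `w` appears already paired with a
  -- decaying mode. One `Λ` in the result stems from the derivative of the exponential, the other
  -- from the Stokes form.
  have hθ : ContDiff ℝ ∞ fun t => Real.exp (-Λ m * t) * χ t := by fun_prop
  have hm := (hE.robin m).isVP
  have h := hw.weak _ _ _ hm _ hθ ⟨T', hT', fun t ht => by simp [hχ0 t ht]⟩
  have hd : ∀ t, deriv (fun t => Real.exp (-Λ m * t) * χ t) t =
      -Λ m * Real.exp (-Λ m * t) * χ t + Real.exp (-Λ m * t) * deriv χ t := fun t =>
    ((hasDerivAt_exp_mul (-Λ m) t).mul (hχ.differentiable (by simp) t).hasDerivAt).deriv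
  have hcoe : ∀ f : Field, ip f (scalarField (E m)) = coeff E (f 0) m := fun f => by
    rw [ip_scalarField_right, coeff]; simp only [mul_comm]
  have hform : ∀ᵐ t ∂volT T, 2 * ipM (strain (G t)) (strain (scalarGrad fun j => pd j (E m))) +
      β * ipΓ (τ t) (scalarTrace (boundaryValue (E m))) = Λ m * coeff E (w t 0) m := by
    filter_upwards [hw.memVP] with t ht
    have := (hE.robin m).form_eq ht.2.1 ht.2.2
    rw [form_comm] at this
    simp only [mul_assoc, integral_const_mul] at this
    exact this
  have hr : ∫ t, (2 * ipM (strain (G t)) (strain (scalarGrad fun j => pd j (E m))) +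
      β * ipΓ (τ t) (scalarTrace (boundaryValue (E m))) +
      ip (conv (w t) (G t)) (scalarField (E m))) * (Real.exp (-Λ m * t) * χ t) ∂volT T =
      ∫ t, (Λ m * coeff E (w t 0) m + coeff E (conv (w t) (G t) 0) m) *
        (Real.exp (-Λ m * t) * χ t) ∂volT T :=
    integral_congr_ae (hform.mono fun t ht => by simp only [ht, hcoe])
  rw [hr] at h
  simp only [hcoe, hd] at h
  have cχ := hχ.continuous
  have cχ' : Continuous (deriv χ) := hχ.continuous_deriv (by simp)
  have j1 : Integrable (fun t => Real.exp (-Λ m * t) * coeff E (w t 0) m * deriv χ t) (volT T) :=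
    (integrable_continuous_mul_volT iw (g := fun t => Real.exp (-Λ m * t) * deriv χ t)
      (by fun_prop)).congr (Eventually.of_forall fun t => by simp only; ring)
  have j2 : Integrable (fun t => coeff E (w t 0) m * (Λ m * Real.exp (-Λ m * t) * χ t))
      (volT T) :=
    (integrable_continuous_mul_volT iw (g := fun t => Λ m * Real.exp (-Λ m * t) * χ t)
      (by fun_prop)).congr (Eventually.of_forall fun t => by simp only; ring)
  have j3 : Integrable (fun t => (Λ m * coeff E (w t 0) m + coeff E (conv (w t) (G t) 0) m) *
        (Real.exp (-Λ m * t) * χ t)) (volT T) :=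
    (integrable_continuous_mul_volT ((iw.const_mul (Λ m)).add iN)
      (g := fun t => Real.exp (-Λ m * t) * χ t)
      (by fun_prop)).congr (Eventually.of_forall fun t => by simp only [Pi.add_apply]; ring)
  have l1 : ∫ t, coeff E (w t 0) m * (-Λ m * Real.exp (-Λ m * t) * χ t +
      Real.exp (-Λ m * t) * deriv χ t) ∂volT T =
      ∫ t, Real.exp (-Λ m * t) * coeff E (w t 0) m * deriv χ t ∂volT T -
      ∫ t, coeff E (w t 0) m * (Λ m * Real.exp (-Λ m * t) * χ t) ∂volT T := by
    rw [← integral_sub j1 j2]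
    congr 1; ext t; ring
  have l2 : ∫ t, Real.exp (-Λ m * t) * (2 * Λ m * coeff E (w t 0) m +
      coeff E (conv (w t) (G t) 0) m) * χ t ∂volT T =
      ∫ t, (Λ m * coeff E (w t 0) m + coeff E (conv (w t) (G t) 0) m) *
        (Real.exp (-Λ m * t) * χ t) ∂volT T +
      ∫ t, coeff E (w t 0) m * (Λ m * Real.exp (-Λ m * t) * χ t) ∂volT T := by
    rw [← integral_add j3 j2]
    congr 1; ext t; ring
  have hcv : ip v₀ (scalarField (E m)) = coeff E (v₀ 0) m := hcoe v₀
  rw [l1] at h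
  rw [l2]
  simp only [mul_zero, Real.exp_zero, one_mul] at h
  linarith

/-- Cauchy–Schwarz with weights `√Λ` separates the energy bound `B` from a factor whose time
integral is at most `½ ∑ Λ⁻²`, independently of `F`. -/
theorem abs_sum_mode_sq_le (hE : ModeFamily β E Λ) (F : Finset ι) (c : ι → ℝ) {B : ℝ}
    (hB : ∑ m ∈ F, Λ m * c m ^ 2 ≤ B) (t : ℝ) (p : Pt) :
    |∑ m ∈ F, c m * Real.exp (-Λ m * t) * E m p| ≤
      √(B * ∑ m ∈ F, Real.exp (-2 * Λ m * t) / Λ m) := by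
  have hl : ∀ m, 0 < Λ m := fun m => zero_lt_one.trans_le (hE.one_le m)
  rw [← Real.sqrt_sq_eq_abs]
  apply Real.sqrt_le_sqrt
  have h := Finset.sum_mul_sq_le_sq_mul_sq F (fun m => √(Λ m) * c m)
    (fun m => Real.exp (-Λ m * t) * E m p / √(Λ m))
  have e1 : ∑ m ∈ F, √(Λ m) * c m * (Real.exp (-Λ m * t) * E m p / √(Λ m)) =
      ∑ m ∈ F, c m * Real.exp (-Λ m * t) * E m p := by
    refine Finset.sum_congr rfl fun m _ => ?_
    have := (Real.sqrt_pos.2 (hl m)).ne'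
    field_simp
  have e2 : ∑ m ∈ F, (√(Λ m) * c m) ^ 2 = ∑ m ∈ F, Λ m * c m ^ 2 :=
    Finset.sum_congr rfl fun m _ => by rw [mul_pow, Real.sq_sqrt (hl m).le]
  rw [e1, e2] at h
  have h3 : 0 ≤ ∑ m ∈ F, (Real.exp (-Λ m * t) * E m p / √(Λ m)) ^ 2 :=
    Finset.sum_nonneg fun m _ => sq_nonneg _
  have h4 : ∑ m ∈ F, (Real.exp (-Λ m * t) * E m p / √(Λ m)) ^ 2 ≤
      ∑ m ∈ F, Real.exp (-2 * Λ m * t) / Λ m := by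
    refine Finset.sum_le_sum fun m _ => ?_
    rw [div_pow, Real.sq_sqrt (hl m).le, mul_pow, ← Real.exp_nat_mul]
    refine div_le_div_of_nonneg_right ?_ (hl m).le
    have hE1 : E m p ^ 2 ≤ 1 := by
      rw [← sq_abs]
      exact pow_le_one₀ (abs_nonneg _) (hE.bound m p)
    rw [show ((2 : ℕ) : ℝ) * (-Λ m * t) = -2 * Λ m * t by push_cast; ring]
    exact mul_le_of_le_one_right (Real.exp_pos _).le hE1
  have hB0 : 0 ≤ B := le_trans (Finset.sum_nonneg fun m _ =>
    mul_nonneg (hl m).le (sq_nonneg _)) hB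
  calc _ ≤ _ := h
    _ ≤ B * ∑ m ∈ F, (Real.exp (-Λ m * t) * E m p / √(Λ m)) ^ 2 :=
        mul_le_mul_of_nonneg_right hB h3
    _ ≤ _ := mul_le_mul_of_nonneg_left h4 hB0

/-- The squared distance of `u` to the combination of modes with coefficients `α`. -/
noncomputable def modeDist (E : ι → Pt → ℝ) (F : Finset ι) (α : ι → ℝ) (u : Field) : ℝ :=
  ip u u - 2 * ∑ m ∈ F, α m * coeff E (u 0) m + ∑ m ∈ F, α m * α m

/-- This is `‖a - b‖² ≤ 2‖a‖² + 2‖b‖²`; it supplies the a priori bound that starts the Gronwall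
iteration. -/
theorem ModeFamily.modeDist_le (hE : ModeFamily β E Λ) (F : Finset ι) (α : ι → ℝ) {u : Field}
    (hu : ∀ i, MemLp (u i) 2 volΩ) :
    modeDist E F α u ≤ 2 * ip u u + 2 * ∑ m ∈ F, α m * α m := by
  have h1 := hE.bessel F (hu 0)
  have h2 : ∫ p, u 0 p * u 0 p ∂volΩ ≤ ip u u :=
    integral_mono ((hu 0).integrable_mul (hu 0)) (integrable_ip hu hu) fun p =>
      Finset.single_le_sum (f := fun i => u i p * u i p) (fun i _ => mul_self_nonneg _)
        (Finset.mem_univ 0)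
  have h3 : 0 ≤ ∑ m ∈ F, (α m + coeff E (u 0) m) ^ 2 := Finset.sum_nonneg fun m _ => sq_nonneg _
  have h4 : ∑ m ∈ F, (α m + coeff E (u 0) m) ^ 2 = ∑ m ∈ F, α m * α m +
      2 * ∑ m ∈ F, α m * coeff E (u 0) m + ∑ m ∈ F, coeff E (u 0) m ^ 2 := by
    rw [Finset.mul_sum, ← Finset.sum_add_distrib, ← Finset.sum_add_distrib]
    exact Finset.sum_congr rfl fun m _ => by ring
  rw [modeDist]
  linarith

/-- The energy inequality for the difference of a Leray-Hopf solution and a combination of decaying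
modes. -/
theorem IsLerayHopf.modeDist_le_integral (hT : 0 < T) (hβ : 0 < β) (hE : ModeFamily β E Λ)
    (hw : IsLerayHopf β T v₀ w G τ) (F : Finset ι) {B : ℝ}
    (hB : ∑ m ∈ F, Λ m * coeff E (v₀ 0) m ^ 2 ≤ B) :
    ∀ᵐ t ∂volT T, modeDist E F (fun m => coeff E (v₀ 0) m * Real.exp (-Λ m * t)) (w t) ≤
      (ip v₀ v₀ - ∑ m ∈ F, coeff E (v₀ 0) m ^ 2) +
      ∫ s, (B * ∑ m ∈ F, Real.exp (-2 * Λ m * s) / Λ m) *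
        modeDist E F (fun m => coeff E (v₀ 0) m * Real.exp (-Λ m * s)) (w s) ∂volT t := by
  set c := coeff E (v₀ 0) with hc
  have hl : ∀ m, 0 < Λ m := fun m => zero_lt_one.trans_le (hE.one_le m)
  have hB0 : 0 ≤ B := le_trans (Finset.sum_nonneg fun m _ =>
    mul_nonneg (hl m).le (sq_nonneg _)) hB
  have hcoef : ∀ᵐ t ∂volT T, ∀ m ∈ F, Real.exp (-Λ m * t) * coeff E (w t 0) m = c m -
      ∫ s, Real.exp (-Λ m * s) * (2 * Λ m * coeff E (w s 0) m +
        coeff E (conv (w s) (G s) 0) m) ∂volT t :=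
    (ae_ball_iff F.countable_toSet).2 fun m _ => hw.coeff_eq hT hE m
  have hconv : ∀ᵐ t ∂volT T, Integrable (conv (w t) (G t) 0) volΩ :=
    (hw.integrable_conv 0).prod_right_ae
  filter_upwards [hcoef, hw.energy, ae_volT_mem T] with t h1 h2 htm
  have hle := volT_mono htm.2.le
  rw [add_assoc, integral_dissipation htm.2.le hw.memLp_grad hw.memLp_trace] at h2
  have iform := (integrable_time_form (β := β) hw.memLp_grad hw.memLp_trace).mono_measure hle
  have iw := fun m => (hw.integrable_coeff hE m).mono_measure hle
  have iN := fun m => (hw.integrable_coeff_conv hE m).mono_measure hle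
  have iip := (integrable_time_ip hw.memLp).mono_measure hle
  have iK : ∀ m, Integrable (fun s => c m * (Real.exp (-Λ m * s) * (2 * Λ m * coeff E (w s 0) m +
        coeff E (conv (w s) (G s) 0) m))) (volT t) := fun m =>
    (integrable_continuous_mul_volT (((iw m).const_mul _).add (iN m)) (by fun_prop)).const_mul _
  have iL : ∀ m, Integrable (fun s => c m ^ 2 * (Λ m * Real.exp (-2 * Λ m * s))) (volT t) :=
    fun m => integrable_volT_of_continuous (by fun_prop) t
  have imd : Integrable (fun s => modeDist E F (fun m => c m * Real.exp (-Λ m * s)) (w s))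
      (volT t) := by
    refine (iip.sub (Integrable.const_mul (integrable_finsetSum _ fun m _ => ?_) 2)).add
      (integrable_volT_of_continuous (by fun_prop) t)
    exact integrable_continuous_mul_volT (iw m) (by fun_prop)
  have eΛ : ∀ m, ∫ s, c m ^ 2 * (Λ m * Real.exp (-2 * Λ m * s)) ∂volT t =
      1 / 2 * (c m ^ 2 - c m ^ 2 * Real.exp (-2 * Λ m * t)) := by
    intro m
    have h := integral_exp_mul_volT htm.1.le (-2 * Λ m)
    rw [integral_const_mul] at h
    rw [integral_const_mul, integral_const_mul]
    linear_combination (-1 / 2 * c m ^ 2) * h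
  have hsq : ∀ m s, c m * Real.exp (-Λ m * s) * (c m * Real.exp (-Λ m * s)) =
      c m ^ 2 * Real.exp (-2 * Λ m * s) := fun m s => by
    rw [show -2 * Λ m * s = -Λ m * s + -Λ m * s by ring, Real.exp_add]; ring
  -- At almost every time the convective estimate is applied with `f` the partial sum. Its form
  -- terms are those subtracted on the left, and only the Gronwall term with its factor `1/2`
  -- remains.
  have main : ∫ s, (∑ m ∈ F, c m * (Real.exp (-Λ m * s) * (2 * Λ m * coeff E (w s 0) m +
        coeff E (conv (w s) (G s) 0) m)) - form β (G s) (τ s) (G s) (τ s) -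
        ∑ m ∈ F, c m ^ 2 * (Λ m * Real.exp (-2 * Λ m * s))) ∂volT t ≤
      ∫ s, 1 / 2 * ((B * ∑ m ∈ F, Real.exp (-2 * Λ m * s) / Λ m) *
        modeDist E F (fun m => c m * Real.exp (-Λ m * s)) (w s)) ∂volT t := by
    refine integral_mono_ae (((integrable_finsetSum _ fun m _ => iK m).sub iform).sub
      (integrable_finsetSum _ fun m _ => iL m))
      ((integrable_continuous_mul_volT imd (by fun_prop)).const_mul _) ?_
    filter_upwards [ae_mono hle hw.memVP, ae_mono hle hconv] with s hs hsc
    have hg0 : 0 ≤ B * ∑ m ∈ F, Real.exp (-2 * Λ m * s) / Λ m :=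
      mul_nonneg hB0 (Finset.sum_nonneg fun m _ => div_nonneg (Real.exp_pos _).le (hl m).le)
    have key := hE.ip_conv_le hβ F (fun m => c m * Real.exp (-Λ m * s)) hs
      (abs_sum_mode_sq_le hE F c hB s)
    rw [Real.sq_sqrt hg0, ip_scalarField_right] at key
    simp only [mul_comm (conv (w s) (G s) 0 _)] at key
    rw [hE.integral_sum_mul F _ hsc] at key
    have e1 : ∑ m ∈ F, c m * (Real.exp (-Λ m * s) * (2 * Λ m * coeff E (w s 0) m +
        coeff E (conv (w s) (G s) 0) m)) =
        2 * ∑ m ∈ F, c m * Real.exp (-Λ m * s) * Λ m * coeff E (w s 0) m +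
        ∑ m ∈ F, c m * Real.exp (-Λ m * s) * coeff E (conv (w s) (G s) 0) m := by
      rw [Finset.mul_sum, ← Finset.sum_add_distrib]
      exact Finset.sum_congr rfl fun m _ => by ring
    have e2 : ∑ m ∈ F, c m ^ 2 * (Λ m * Real.exp (-2 * Λ m * s)) =
        ∑ m ∈ F, c m * Real.exp (-Λ m * s) * Λ m * (c m * Real.exp (-Λ m * s)) :=
      Finset.sum_congr rfl fun m _ => by linear_combination (-Λ m) * hsq m s
    simp only [e1, e2, modeDist]
    linarith
  rw [integral_sub (f := fun s => _ - _) ((integrable_finsetSum _ fun m _ => iK m).sub iform)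
      (integrable_finsetSum _ fun m _ => iL m),
    integral_sub (integrable_finsetSum _ fun m _ => iK m) iform,
    integral_finsetSum _ fun m _ => iK m, integral_finsetSum _ fun m _ => iL m,
    integral_const_mul] at main
  have e3 : ∑ m ∈ F, ∫ s, c m * (Real.exp (-Λ m * s) * (2 * Λ m * coeff E (w s 0) m +
        coeff E (conv (w s) (G s) 0) m)) ∂volT t =
      ∑ m ∈ F, c m ^ 2 - ∑ m ∈ F, c m * Real.exp (-Λ m * t) * coeff E (w t 0) m := by
    rw [← Finset.sum_sub_distrib]
    refine Finset.sum_congr rfl fun m hm => ?_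
    rw [integral_const_mul]
    linear_combination (c m) * h1 m hm
  have e4 : ∑ m ∈ F, ∫ s, c m ^ 2 * (Λ m * Real.exp (-2 * Λ m * s)) ∂volT t =
      1 / 2 * ∑ m ∈ F, c m ^ 2 - 1 / 2 * ∑ m ∈ F, c m ^ 2 * Real.exp (-2 * Λ m * t) := by
    rw [Finset.mul_sum, Finset.mul_sum, ← Finset.sum_sub_distrib]
    exact Finset.sum_congr rfl fun m _ => by rw [eΛ]; ring
  rw [e3, e4] at main
  -- Twice the sum of the energy inequality for `w`, the coefficient equations (`e3`) and the exact
  -- decay of the modes (`e4`) gives the squared distance at time `t`.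
  rw [modeDist]
  simp only [hsq]
  linarith

/-- Uniqueness of the Leray-Hopf solution. -/
theorem IsLerayHopf.ae_eq_vel [Countable ι] (hT : 0 < T) (hβ : 0 < β) (hE : ModeFamily β E Λ)
    (hw : IsLerayHopf β T v₀ w G τ)
    (hsq : HasSum (fun m => coeff E (v₀ 0) m ^ 2) (ip v₀ v₀))
    (hc : ∀ m, |coeff E (v₀ 0) m| ≤ A) {B : ℝ}
    (hB : ∀ F : Finset ι, ∑ m ∈ F, Λ m * coeff E (v₀ 0) m ^ 2 ≤ B) :
    ∀ᵐ t ∂volT T, ∀ i, w t i =ᵐ[volΩ] vel E Λ (coeff E (v₀ 0)) t i := by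
  set c := coeff E (v₀ 0) with hcdef
  have hl : ∀ m, 0 < Λ m := fun m => zero_lt_one.trans_le (hE.one_le m)
  have hB0 : 0 ≤ B := by simpa using hB ∅
  obtain ⟨C, hC⟩ := hw.bounded
  -- `R` bounds twice the time integral of the Gronwall rate for every `F` and every `t`, so the
  -- exponential factor stays fixed while `F` grows.
  set R := B * ∑' m, ((Λ m) ^ 2)⁻¹ with hR
  have hgr : ∀ F : Finset ι, ∀ᵐ t ∂volT T,
      modeDist E F (fun m => c m * Real.exp (-Λ m * t)) (w t) ≤
        2 * (ip v₀ v₀ - ∑ m ∈ F, c m ^ 2) * Real.exp R := by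
    intro F
    have hε : 0 ≤ ip v₀ v₀ - ∑ m ∈ F, c m ^ 2 :=
      sub_nonneg.2 (sum_le_hasSum F (fun m _ => sq_nonneg _) hsq)
    have imd : Integrable (fun s => modeDist E F (fun m => c m * Real.exp (-Λ m * s)) (w s))
        (volT T) := by
      refine ((integrable_time_ip hw.memLp).sub (Integrable.const_mul
        (integrable_finsetSum _ fun m _ => ?_) 2)).add
        (integrable_volT_of_continuous (by fun_prop) T)
      exact integrable_continuous_mul_volT (hw.integrable_coeff hE m) (by fun_prop)
    have hbd : ∀ᵐ t ∂volT T, modeDist E F (fun m => c m * Real.exp (-Λ m * t)) (w t) ≤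
        2 * |C| + 2 * ∑ m ∈ F, c m ^ 2 := by
      filter_upwards [hC, hw.memVP, ae_volT_mem T] with t h1 h2 h3
      refine (hE.modeDist_le F _ h2.1.1).trans ?_
      have : ∑ m ∈ F, c m * Real.exp (-Λ m * t) * (c m * Real.exp (-Λ m * t)) ≤
          ∑ m ∈ F, c m ^ 2 := by
        refine Finset.sum_le_sum fun m _ => ?_
        have e1 := exp_neg_mul_le_one (hl m).le h3.1.le
        have e0 := Real.exp_pos (-Λ m * t)
        calc _ = c m ^ 2 * (Real.exp (-Λ m * t) * Real.exp (-Λ m * t)) := by ring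
          _ ≤ c m ^ 2 * 1 := by gcongr; exact mul_le_one₀ e1 e0.le e1
          _ = _ := mul_one _
      linarith [le_abs_self C]
    have h := ae_le_of_gronwall hε imd hbd (by positivity)
      (g := fun s => B * ∑ m ∈ F, Real.exp (-2 * Λ m * s) / Λ m)
      (Γ := fun s => B * ∑ m ∈ F, (1 - Real.exp (-2 * Λ m * s)) / (2 * Λ m ^ 2))
      (by fun_prop)
      (fun s => mul_nonneg hB0 (Finset.sum_nonneg fun m _ =>
        div_nonneg (Real.exp_pos _).le (hl m).le))
      (fun s => by
        refine HasDerivAt.const_mul B (HasDerivAt.fun_sum fun m _ => ?_)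
        have := ((hasDerivAt_exp_mul (-2 * Λ m) s).const_sub 1).div_const (2 * Λ m ^ 2)
        refine this.congr_deriv ?_
        rw [div_eq_div_iff (mul_ne_zero two_ne_zero (pow_ne_zero 2 (hl m).ne')) (hl m).ne']
        ring) (by simp)
      (hw.modeDist_le_integral hT hβ hE F (hB F))
    filter_upwards [h] with t ht
    refine ht.trans (mul_le_mul_of_nonneg_left (Real.exp_le_exp.2 ?_) (by positivity))
    have : ∑ m ∈ F, (1 - Real.exp (-2 * Λ m * t)) / (2 * Λ m ^ 2) ≤
        1 / 2 * ∑' m, ((Λ m) ^ 2)⁻¹ := by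
      refine le_trans ?_ (mul_le_mul_of_nonneg_left (hE.summable.sum_le_tsum F fun m _ => by
        have := hl m
        positivity) (by norm_num))
      rw [Finset.mul_sum]
      refine Finset.sum_le_sum fun m _ => ?_
      have := hl m
      have h0 := Real.exp_pos (-2 * Λ m * t)
      calc _ ≤ 1 / (2 * Λ m ^ 2) := by gcongr; linarith
        _ = _ := by field_simp
    have := mul_le_mul_of_nonneg_left this hB0
    rw [hR]
    linarith
  -- A sequence of finite sets exhausting the modes is chosen so that only countably many null sets
  -- of times are discarded.
  obtain ⟨Fs, hFs⟩ := exists_seq_tendsto (atTop : Filter (Finset ι))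
  filter_upwards [ae_all_iff.2 fun k => hgr (Fs k), hw.memVP, ae_volT_mem T] with t h1 h2 htm
  have hvp := hE.isVP_vel hc htm.1
  have s1 := (hE.hasSum_ip_vel hc htm.1 ((h2.1.1 0).integrable one_le_two)).comp hFs
  have s2 := (hE.hasSum_ip_vel_self hc htm.1).comp hFs
  have s3 := hsq.comp hFs
  have hlim : Tendsto (fun k => modeDist E (Fs k) (fun m => c m * Real.exp (-Λ m * t)) (w t))
      atTop (𝓝 (ip (w t) (w t) - 2 * ip (vel E Λ c t) (w t) +
        ip (vel E Λ c t) (vel E Λ c t))) := by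
    refine ((tendsto_const_nhds.sub (s1.const_mul 2)).add s2).congr fun k => ?_
    simp only [Function.comp_apply, modeDist]
    congr 1
    exact Finset.sum_congr rfl fun m _ => by
      rw [show -2 * Λ m * t = -Λ m * t + -Λ m * t by ring, Real.exp_add]; ring
  have hlim2 : Tendsto (fun k => 2 * (ip v₀ v₀ - ∑ m ∈ Fs k, c m ^ 2) * Real.exp R) atTop
      (𝓝 (2 * (ip v₀ v₀ - ip v₀ v₀) * Real.exp R)) :=
    ((tendsto_const_nhds.sub s3).const_mul 2).mul_const _
  have hle := le_of_tendsto_of_tendsto' hlim hlim2 h1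
  rw [sub_self, mul_zero, zero_mul] at hle
  have hcomm : ip (vel E Λ c t) (w t) = ip (w t) (vel E Λ c t) := by
    simp only [ip, mul_comm]
  rw [hcomm, ← ip_sub_self h2.1.1 hvp.1.1] at hle
  have h0 := le_antisymm hle (ip_self_nonneg _)
  have hd : ∀ i, MemLp (fun p => w t i p - vel E Λ c t i p) 2 volΩ := fun i =>
    (h2.1.1 i).sub (hvp.1.1 i)
  rw [ip, integral_eq_zero_iff_of_nonneg
    (fun p => Finset.sum_nonneg fun i _ => mul_self_nonneg _) (integrable_ip hd hd)] at h0
  intro i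
  filter_upwards [h0] with p hp
  have := (Finset.sum_eq_zero_iff_of_nonneg fun i _ => mul_self_nonneg _).1 hp i
    (Finset.mem_univ i)
  exact sub_eq_zero.1 (mul_self_eq_zero.1 this)

end

end NSChannel

namespace NSChannel

/-! ### Uniqueness of the pressure -/

theorem ae_eq_zero_of_ae_ae {X Y : Type*} [MeasurableSpace X] [MeasurableSpace Y]
    {μ : Measure X} {ν : Measure Y} [SFinite μ] [SFinite ν] {F : X × Y → ℝ}
    (hF : Integrable F (μ.prod ν)) (h : ∀ᵐ x ∂μ, ∀ᵐ y ∂ν, F (x, y) = 0) : F =ᵐ[μ.prod ν] 0 := by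
  have : ∫ p, ‖F p‖ ∂(μ.prod ν) = 0 := by
    rw [integral_prod _ hF.norm]
    exact integral_eq_zero_of_ae (h.mono fun x hx =>
      integral_eq_zero_of_ae (hx.mono fun y hy => by simp [hy]))
  rw [integral_eq_zero_iff_of_nonneg (fun p => norm_nonneg _) hF.norm] at this
  exact this.mono fun p hp => norm_eq_zero.1 hp

theorem HasWeakPD.ae_eq_zero {i : Fin 3} {f g : Pt → ℝ} (h : HasWeakPD i f g)
    (hg : Integrable g volΩ)
    (h0 : ∀ φ, IsInteriorTest φ → ∫ p, f p * pd i φ p ∂volΩ = 0) : g =ᵐ[volΩ] 0 :=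
  ae_eq_zero_of_forall_isInteriorTest hg fun φ hφ => by
    have := h φ hφ
    rw [h0 φ hφ] at this
    linarith

theorem HasWeakPD.ae_eq {i : Fin 3} {f f' g g' : Pt → ℝ} (h : HasWeakPD i f g)
    (h' : HasWeakPD i f' g') (hg : Integrable g volΩ) (hg' : Integrable g' volΩ)
    (hf : f =ᵐ[volΩ] f') : g =ᵐ[volΩ] g' := by
  have : (fun p => g p - g' p) =ᵐ[volΩ] 0 := by
    refine ae_eq_zero_of_forall_isInteriorTest (hg.sub hg') fun φ hφ => ?_
    simp only [sub_mul]
    rw [integral_sub (integrable_mul_continuous hg hφ.1.continuous)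
      (integrable_mul_continuous hg' hφ.1.continuous)]
    have e : ∫ p, f p * pd i φ p ∂volΩ = ∫ p, f' p * pd i φ p ∂volΩ :=
      integral_congr_ae (hf.mono fun p hp => by simp only [hp])
    have h1 := h φ hφ
    have h2 := h' φ hφ
    linarith
  exact this.mono fun p hp => sub_eq_zero.1 hp

/-- The nonlinearity vanishes for a field in the direction `x` that does not depend on `x`. -/
theorem IsH1.conv_ae_eq_zero {u : Field} {G : MField} (hu : IsH1 u G)
    (h0 : ∀ φ, IsInteriorTest φ → ∫ p, u 0 p * pd 0 φ p ∂volΩ = 0)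
    (h1 : u 1 =ᵐ[volΩ] 0) (h2 : u 2 =ᵐ[volΩ] 0) (i : Fin 3) : conv u G i =ᵐ[volΩ] 0 := by
  have hi : ∀ φ, IsInteriorTest φ → ∫ p, u i p * pd 0 φ p ∂volΩ = 0 := by
    intro φ hφ
    fin_cases i
    · exact h0 φ hφ
    · exact integral_eq_zero_of_ae (h1.mono fun p hp => by simp [hp])
    · exact integral_eq_zero_of_ae (h2.mono fun p hp => by simp [hp])
  have hG := (hu.2.2 i 0).ae_eq_zero ((hu.2.1 i 0).integrable one_le_two) hi
  filter_upwards [hG, h1, h2] with p hp hp1 hp2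
  simp [conv, Fin.sum_univ_three, hp, hp1, hp2]

/-- A smooth periodic function is a constant plus the derivative of a smooth periodic function. -/
theorem exists_periodic_primitive {A : ℝ → ℝ} (hA : ContDiff ℝ ∞ A)
    (hp : ∀ x, A (x + 2 * Real.pi) = A x) :
    ∃ A₁ : ℝ → ℝ, ContDiff ℝ ∞ A₁ ∧ (∀ x, A₁ (x + 2 * Real.pi) = A₁ x) ∧
      ∀ x, deriv A₁ x = A x - (∫ s in Set.Ioo 0 (2 * Real.pi), A s) / (2 * Real.pi) := by
  set m := (∫ s in Set.Ioo 0 (2 * Real.pi), A s) / (2 * Real.pi) with hm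
  have hc : Continuous fun x => A x - m := hA.continuous.sub continuous_const
  have hd : ∀ x, HasDerivAt (fun x => ∫ s in (0 : ℝ)..x, (A s - m)) (A x - m) x := fun x =>
    intervalIntegral.integral_hasDerivAt_right (hc.intervalIntegrable _ _)
      (hc.stronglyMeasurableAtFilter _ _) hc.continuousAt
  have hdd : deriv (fun x => ∫ s in (0 : ℝ)..x, (A s - m)) = fun x => A x - m :=
    funext fun x => (hd x).deriv
  refine ⟨fun x => ∫ s in (0 : ℝ)..x, (A s - m), ?_, fun x => ?_, fun x => (hd x).deriv⟩
  · rw [contDiff_infty_iff_deriv, hdd]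
    exact ⟨fun x => (hd x).differentiableAt, hA.sub contDiff_const⟩
  · have hper : Function.Periodic (fun s => A s - m) (2 * Real.pi) := fun s => by simp only [hp]
    have h0 : ∫ s in (0 : ℝ)..(0 + 2 * Real.pi), (A s - m) = 0 := by
      rw [zero_add, intervalIntegral.integral_sub (hA.continuous.intervalIntegrable _ _)
        (continuous_const.intervalIntegrable _ _), intervalIntegral.integral_const,
        intervalIntegral.integral_of_le (by positivity), integral_Ioc_eq_integral_Ioo, hm]
      have := Real.pi_ne_zero
      simp only [smul_eq_mul]
      field_simp
      ring
    simp only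
    rw [← intervalIntegral.integral_add_adjacent_intervals (b := x)
      (hc.intervalIntegrable _ _) (hc.intervalIntegrable _ _),
      hper.intervalIntegral_add_eq x 0, h0, add_zero]

/-- Smooth functions with compact support in `(-δ, δ)`. -/
def SmoothSupported (δ : ℝ) (C : ℝ → ℝ) : Prop :=
  ContDiff ℝ ∞ C ∧ ∃ δ' < δ, ∀ z, δ' ≤ |z| → C z = 0

theorem SmoothSupported.mono {δ₁ δ₂ : ℝ} {C : ℝ → ℝ} (h : SmoothSupported δ₁ C) (hδ : δ₁ ≤ δ₂) :
    SmoothSupported δ₂ C := by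
  obtain ⟨h1, δ', h2, h3⟩ := h
  exact ⟨h1, δ', h2.trans_le hδ, h3⟩

theorem SmoothSupported.eq_zero {δ : ℝ} {C : ℝ → ℝ} (h : SmoothSupported δ C) {z : ℝ}
    (hz : δ ≤ |z|) : C z = 0 := by
  obtain ⟨-, δ', h2, h3⟩ := h
  exact h3 z (h2.le.trans hz)

theorem SmoothSupported.deriv_eq_zero {δ : ℝ} {C : ℝ → ℝ} (h : SmoothSupported δ C) {z : ℝ}
    (hz : δ ≤ |z|) : deriv C z = 0 := by
  obtain ⟨-, δ', h2, h3⟩ := h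
  have : C =ᶠ[𝓝 z] fun _ => 0 := by
    filter_upwards [(isOpen_lt continuous_const continuous_abs).mem_nhds (h2.trans_le hz)]
      with y hy
    exact h3 y (le_of_lt hy)
  rw [this.deriv_eq]
  simp

theorem smoothSupported_of_mem {δ : ℝ} {C : ℝ → ℝ} (h : C ∈ supportedFamily (-δ) δ) :
    SmoothSupported δ C := by
  obtain ⟨h1, ⟨a, b, ha, hb, h0⟩, -⟩ := h
  refine ⟨h1, max (-a) b, max_lt (by linarith) hb, fun z hz => h0 z ?_⟩
  rcases abs_cases z with h | h
  · right; rw [← h.1]; exact (le_max_right _ _).trans hz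
  · left; have := (le_max_left (-a) b).trans hz; linarith

theorem SmoothSupported.integral_Ioo {δ₁ δ₂ : ℝ} {C : ℝ → ℝ} (h : SmoothSupported δ₁ C)
    (hδ : δ₁ ≤ δ₂) : ∫ z in Set.Ioo (-δ₂) δ₂, C z = ∫ z in Set.Ioo (-δ₁) δ₁, C z := by
  refine (setIntegral_eq_of_subset_of_forall_sdiff_eq_zero measurableSet_Ioo
    (Set.Ioo_subset_Ioo (neg_le_neg hδ) hδ) fun z hz => h.eq_zero ?_).symm ▸ rfl
  by_contra hlt
  exact hz.2 (abs_lt.1 (not_le.1 hlt))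

/-- A smooth function with compact support is a multiple of a given one plus the derivative of a
smooth function with compact support. -/
theorem SmoothSupported.exists_primitive {δ : ℝ} {C ρ : ℝ → ℝ} (hC : SmoothSupported δ C)
    (hρ : SmoothSupported δ ρ) (hr : ∫ z in Set.Ioo (-δ) δ, ρ z ≠ 0) :
    ∃ C₁, SmoothSupported δ C₁ ∧ ∀ z, deriv C₁ z =
      C z - (∫ z in Set.Ioo (-δ) δ, C z) / (∫ z in Set.Ioo (-δ) δ, ρ z) * ρ z := by
  rcases le_or_gt δ 0 with hδ | hδ
  · exact absurd (by rw [Set.Ioo_eq_empty (by linarith)]; simp) hr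
  set m := (∫ z in Set.Ioo (-δ) δ, C z) / (∫ z in Set.Ioo (-δ) δ, ρ z) with hm
  have hc : Continuous fun z => C z - m * ρ z :=
    hC.1.continuous.sub (continuous_const.mul hρ.1.continuous)
  have hd : ∀ x, HasDerivAt (fun x => ∫ s in (-δ)..x, (C s - m * ρ s)) (C x - m * ρ x) x :=
    fun x => intervalIntegral.integral_hasDerivAt_right (hc.intervalIntegrable _ _)
      (hc.stronglyMeasurableAtFilter _ _) hc.continuousAt
  have hdd : deriv (fun x => ∫ s in (-δ)..x, (C s - m * ρ s)) = fun x => C x - m * ρ x :=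
    funext fun x => (hd x).deriv
  refine ⟨fun x => ∫ s in (-δ)..x, (C s - m * ρ s), ⟨?_, ?_⟩, fun x => (hd x).deriv⟩
  · rw [contDiff_infty_iff_deriv, hdd]
    exact ⟨fun x => (hd x).differentiableAt, hC.1.sub (contDiff_const.mul hρ.1)⟩
  · obtain ⟨δ₁, h1, z1⟩ := hC.2
    obtain ⟨δ₂, h2, z2⟩ := hρ.2
    have hz : ∀ s, max δ₁ δ₂ ≤ |s| → C s - m * ρ s = 0 := fun s hs => by
      rw [z1 s ((le_max_left _ _).trans hs), z2 s ((le_max_right _ _).trans hs)]; ring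
    have htot : ∫ s in (-δ)..δ, (C s - m * ρ s) = 0 := by
      rw [intervalIntegral.integral_sub (hC.1.continuous.intervalIntegrable _ _)
        (Continuous.intervalIntegrable (u := fun s => m * ρ s)
          (continuous_const.mul hρ.1.continuous) _ _),
        intervalIntegral.integral_const_mul, intervalIntegral.integral_of_le (by linarith),
        intervalIntegral.integral_of_le (by linarith), integral_Ioc_eq_integral_Ioo,
        integral_Ioc_eq_integral_Ioo, hm]
      field_simp
      ring
    have hmax : max δ₁ δ₂ < δ := max_lt h1 h2
    refine ⟨max 0 (max δ₁ δ₂), max_lt hδ hmax, fun x hx => ?_⟩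
    have hx' := (le_max_right _ _).trans hx
    have hx0 := (le_max_left _ _).trans hx
    -- To the right of both supports the primitive equals its total integral, which is zero by the
    -- choice of `m`; to the left the integrand vanishes on the whole range of integration.
    rcases abs_cases x with h | h
    · have : ∫ s in x..δ, (C s - m * ρ s) = 0 := by
        refine intervalIntegral.integral_zero_ae (Eventually.of_forall fun s hs => hz s ?_)
        rw [Set.uIoc, Set.mem_Ioc] at hs
        have h3 : max δ₁ δ₂ ≤ s := le_trans (le_min (h.1 ▸ hx') hmax.le) hs.1.le
        exact h3.trans (le_abs_self s)
      have h4 := intervalIntegral.integral_add_adjacent_intervals (a := -δ) (b := x) (c := δ)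
        (hc.intervalIntegrable (μ := volume) _ _) (hc.intervalIntegrable _ _)
      simp only
      linarith
    · refine intervalIntegral.integral_zero_ae (Eventually.of_forall fun s hs => hz s ?_)
      rw [Set.uIoc, Set.mem_Ioc] at hs
      have h3 : s ≤ -max δ₁ δ₂ := hs.2.trans (max_le (by linarith) (by linarith))
      have := neg_abs_le s
      linarith [neg_le_abs s]

/-- Lebesgue measure on the part `|z| < δ` of the cell. -/
noncomputable def slab (δ : ℝ) : Measure Pt :=
  (volume.restrict (Set.Ioo 0 (2 * Real.pi))).prod
    ((volume.restrict (Set.Ioo 0 (2 * Real.pi))).prod (volume.restrict (Set.Ioo (-δ) δ)))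

instance (δ : ℝ) : IsFiniteMeasure (slab δ) := by unfold slab; infer_instance

theorem measurableSet_slab (δ : ℝ) : MeasurableSet {p : Pt | |p.2.2| < δ} :=
  (isOpen_lt (by fun_prop) continuous_const).measurableSet

theorem slab_eq {δ : ℝ} (hδ : δ ≤ 1) : slab δ = volΩ.restrict {p : Pt | |p.2.2| < δ} := by
  rw [volΩ, Measure.restrict_restrict (measurableSet_slab δ)]
  simp only [slab, Measure.prod_restrict]
  congr 1
  ext ⟨x, y, z⟩
  simp only [cell, Set.mem_prod, Set.mem_inter_iff, Set.mem_ofPred_eq, abs_lt, Set.mem_Ioo]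
  constructor
  · rintro ⟨h1, h2, h3⟩
    exact ⟨h3, h1, h2, by linarith [h3.1], by linarith [h3.2]⟩
  · rintro ⟨h3, h1, h2, -⟩
    exact ⟨h1, h2, h3⟩

/-- The product test functions in a box. -/
def boxFamily (a b δ : ℝ) : Set (ℝ × Pt → ℝ) :=
  prodFamily (supportedFamily a b)
    (prodFamily periodicFamily (prodFamily periodicFamily (supportedFamily (-δ) δ)))

theorem determining_boxFamily {a b δ : ℝ} (hab : a < b) (hδ : 0 < δ) :
    Determining ((volume.restrict (Set.Ioo a b)).prod (slab δ)) (boxFamily a b δ) :=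
  (((determining_supportedFamily (by linarith)).prod_periodicFamily
    (unitBounded_supportedFamily _ _)).prod_periodicFamily
    (unitBounded_periodicFamily.prodFamily (unitBounded_supportedFamily _ _))).prod_supportedFamily
    (unitBounded_periodicFamily.prodFamily
      (unitBounded_periodicFamily.prodFamily (unitBounded_supportedFamily _ _))) hab

theorem integral_slab_prod (δ : ℝ) (A B C : ℝ → ℝ) :
    ∫ p, A p.1 * (B p.2.1 * C p.2.2) ∂slab δ =
      (∫ x in Set.Ioo 0 (2 * Real.pi), A x) * ((∫ y in Set.Ioo 0 (2 * Real.pi), B y) *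
        ∫ z in Set.Ioo (-δ) δ, C z) := by
  rw [slab, integral_prod_mul A fun s : ℝ × ℝ => B s.1 * C s.2, integral_prod_mul B C]

/-- A locally integrable function whose spatial derivatives vanish in a box depends only on
time there. -/
theorem ae_eq_of_derivatives_eq_zero {a b δ δ₀ : ℝ} (hab : a < b) (hδ₀ : 0 < δ₀) (hδ : δ₀ ≤ δ)
    {q : ℝ → Pt → ℝ}
    (hq : Integrable (fun P : ℝ × Pt => q P.1 P.2) ((volume.restrict (Set.Ioo a b)).prod (slab δ)))
    {ρ : ℝ → ℝ} (hρ : SmoothSupported δ₀ ρ) (hr : ∫ z in Set.Ioo (-δ₀) δ₀, ρ z ≠ 0)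
    (h : ∀ η ∈ supportedFamily a b, ∀ A B C : ℝ → ℝ, ContDiff ℝ ∞ A →
      (∀ x, A (x + 2 * Real.pi) = A x) → ContDiff ℝ ∞ B → (∀ x, B (x + 2 * Real.pi) = B x) →
      SmoothSupported δ C →
      ∫ P : ℝ × Pt, q P.1 P.2 * (η P.1 * (deriv A P.2.1 * (B P.2.2.1 * C P.2.2.2)))
        ∂((volume.restrict (Set.Ioo a b)).prod (slab δ)) = 0 ∧
      ∫ P : ℝ × Pt, q P.1 P.2 * (η P.1 * (A P.2.1 * (deriv B P.2.2.1 * C P.2.2.2)))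
        ∂((volume.restrict (Set.Ioo a b)).prod (slab δ)) = 0 ∧
      ∫ P : ℝ × Pt, q P.1 P.2 * (η P.1 * (A P.2.1 * (B P.2.2.1 * deriv C P.2.2.2)))
        ∂((volume.restrict (Set.Ioo a b)).prod (slab δ)) = 0) :
    ∀ᵐ t ∂volume.restrict (Set.Ioo a b), ∀ᵐ p ∂slab δ, q t p =
      (∫ p, q t p * ρ p.2.2 ∂slab δ) /
        ((2 * Real.pi) ^ 2 * ∫ z in Set.Ioo (-δ₀) δ₀, ρ z) := by
  set μ := (volume.restrict (Set.Ioo a b)).prod (slab δ) with hμ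
  set r := ∫ z in Set.Ioo (-δ₀) δ₀, ρ z with hrdef
  have hρδ := hρ.mono hδ
  have hrδ : ∫ z in Set.Ioo (-δ) δ, ρ z = r := hρ.integral_Ioo hδ
  have hpi : (2 * Real.pi) ≠ 0 := by have := Real.pi_ne_zero; positivity
  have bm : ∀ {g : ℝ × Pt → ℝ}, Continuous g →
      Integrable (fun P : ℝ × Pt => q P.1 P.2 * g P) μ := by
    intro g hg
    have hK : IsCompact (Set.Icc a b ×ˢ (Set.Icc 0 (2 * Real.pi) ×ˢ
        (Set.Icc 0 (2 * Real.pi) ×ˢ Set.Icc (-δ) δ))) :=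
      isCompact_Icc.prod (isCompact_Icc.prod (isCompact_Icc.prod isCompact_Icc))
    obtain ⟨M, hM⟩ := hK.exists_bound_of_continuousOn hg.continuousOn
    refine hq.mul_bdd (c := M) hg.aestronglyMeasurable ?_
    have : ∀ᵐ P ∂μ, P ∈ Set.Ioo a b ×ˢ (Set.Ioo 0 (2 * Real.pi) ×ˢ
        (Set.Ioo 0 (2 * Real.pi) ×ˢ Set.Ioo (-δ) δ)) := by
      simp only [hμ, slab, Measure.prod_restrict]
      exact ae_restrict_mem (measurableSet_Ioo.prod (measurableSet_Ioo.prod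
        (measurableSet_Ioo.prod measurableSet_Ioo)))
    filter_upwards [this] with P hP
    exact hM P ⟨Set.Ioo_subset_Icc_self hP.1, Set.Ioo_subset_Icc_self hP.2.1,
      Set.Ioo_subset_Icc_self hP.2.2.1, Set.Ioo_subset_Icc_self hP.2.2.2⟩
  set Q : ℝ → ℝ := fun t => (∫ p, q t p * ρ p.2.2 ∂slab δ) / ((2 * Real.pi) ^ 2 * r) with hQ
  have cρ := hρ.1.continuous
  have iρ : Integrable (fun P : ℝ × Pt => q P.1 P.2 * ρ P.2.2.2) μ := bm (by fun_prop)
  have iQ : Integrable Q (volume.restrict (Set.Ioo a b)) := iρ.integral_prod_left.div_const _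
  have iF : Integrable (fun P : ℝ × Pt => q P.1 P.2 - Q P.1) μ := hq.sub (iQ.comp_fst _)
  have key : (fun P : ℝ × Pt => q P.1 P.2 - Q P.1) =ᵐ[μ] 0 := by
    refine determining_boxFamily hab (hδ₀.trans_le hδ) _ iF ?_
    rintro _ ⟨η, hη, _, ⟨A, hA, _, ⟨B, hB, C, hC, rfl⟩, rfl⟩, rfl⟩
    have hC' := smoothSupported_of_mem hC
    -- `A` and `B` are a mean plus a derivative, and `C` is a multiple of `ρ` plus a derivative. The
    -- hypothesis kills the derivative parts, so `l1`, `l2`, `l3` remove one variable after the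
    -- other until only `Q` tested with `η` is left.
    obtain ⟨A₁, sA, pA, dA⟩ := exists_periodic_primitive hA.1 hA.2.1
    obtain ⟨B₁, sB, pB, dB⟩ := exists_periodic_primitive hB.1 hB.2.1
    obtain ⟨C₁, sC, dC⟩ := hC'.exists_primitive hρδ (hrδ ▸ hr)
    rw [hrδ] at dC
    have cη := hη.1.continuous
    have cA := hA.1.continuous
    have cB := hB.1.continuous
    have cC := hC.1.continuous
    set α := ∫ s in Set.Ioo 0 (2 * Real.pi), A s with hα
    set γ := ∫ s in Set.Ioo 0 (2 * Real.pi), B s with hγ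
    set κ := ∫ s in Set.Ioo (-δ) δ, C s with hκ
    have one_c : ContDiff ℝ ∞ fun _ : ℝ => (1 : ℝ) := contDiff_const
    have k1 := (h η hη A₁ B C sA pA hB.1 hB.2.1 hC').1
    have k2 := (h η hη (fun _ => 1) B₁ C one_c (fun _ => rfl) sB pB hC').2.1
    have k3 := (h η hη (fun _ => 1) (fun _ => 1) C₁ one_c (fun _ => rfl) one_c (fun _ => rfl) sC).2.2
    simp only [dA, dB, dC, one_mul] at k1 k2 k3
    have l1 : ∫ P : ℝ × Pt, q P.1 P.2 * (η P.1 * (A P.2.1 * (B P.2.2.1 * C P.2.2.2))) ∂μ =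
        α / (2 * Real.pi) * ∫ P : ℝ × Pt, q P.1 P.2 * (η P.1 * (B P.2.2.1 * C P.2.2.2)) ∂μ := by
      rw [← integral_const_mul, ← sub_eq_zero, ← integral_sub (bm (by fun_prop))
        ((bm (by fun_prop)).const_mul _), ← k1]
      congr 1; ext P; ring
    have l2 : ∫ P : ℝ × Pt, q P.1 P.2 * (η P.1 * (B P.2.2.1 * C P.2.2.2)) ∂μ =
        γ / (2 * Real.pi) * ∫ P : ℝ × Pt, q P.1 P.2 * (η P.1 * C P.2.2.2) ∂μ := by
      rw [← integral_const_mul, ← sub_eq_zero, ← integral_sub (bm (by fun_prop))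
        ((bm (by fun_prop)).const_mul _), ← k2]
      congr 1; ext P; ring
    have l3 : ∫ P : ℝ × Pt, q P.1 P.2 * (η P.1 * C P.2.2.2) ∂μ =
        κ / r * ∫ P : ℝ × Pt, q P.1 P.2 * (η P.1 * ρ P.2.2.2) ∂μ := by
      rw [← integral_const_mul, ← sub_eq_zero, ← integral_sub (bm (by fun_prop))
        ((bm (by fun_prop)).const_mul _), ← k3]
      congr 1; ext P; ring
    have l4 : ∫ P : ℝ × Pt, q P.1 P.2 * (η P.1 * ρ P.2.2.2) ∂μ =
        ((2 * Real.pi) ^ 2 * r) * ∫ t in Set.Ioo a b, Q t * η t := by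
      rw [integral_prod _ (bm (by fun_prop)), ← integral_const_mul]
      congr 1; ext t
      have : ∀ p : Pt, q t p * (η t * ρ p.2.2) = η t * (q t p * ρ p.2.2) := fun p => by ring
      simp only [this, integral_const_mul, hQ]
      field_simp
    have l5 : ∫ P : ℝ × Pt, Q P.1 * (η P.1 * (A P.2.1 * (B P.2.2.1 * C P.2.2.2))) ∂μ =
        (∫ t in Set.Ioo a b, Q t * η t) * (α * (γ * κ)) := by
      rw [← integral_slab_prod, ← integral_prod_mul (fun t => Q t * η t)
        fun p : Pt => A p.1 * (B p.2.1 * C p.2.2)]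
      congr 1; ext P; ring
    have iQF : Integrable (fun P : ℝ × Pt => Q P.1 * (η P.1 * (A P.2.1 * (B P.2.2.1 * C P.2.2.2))))
        μ := by
      refine (iQ.comp_fst (slab δ)).mul_bdd (c := 1)
        (show Continuous fun P : ℝ × Pt => η P.1 * (A P.2.1 * (B P.2.2.1 * C P.2.2.2)) by
          fun_prop).aestronglyMeasurable (Eventually.of_forall fun P => ?_)
      exact ((unitBounded_supportedFamily a b).prodFamily (unitBounded_periodicFamily.prodFamily
        (unitBounded_periodicFamily.prodFamily (unitBounded_supportedFamily (-δ) δ)))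
        _ ⟨η, hη, _, ⟨A, hA, _, ⟨B, hB, C, hC, rfl⟩, rfl⟩, rfl⟩).2 P
    simp only [sub_mul]
    rw [integral_sub (bm (by fun_prop)) iQF, l1, l2, l3, l4, l5]
    field_simp
    ring
  have := Measure.ae_ae_of_ae_prod key
  exact this.mono fun t ht => ht.mono fun p hp => sub_eq_zero.1 hp

theorem isSpaceTimeTest_of_prod {T a b δ : ℝ} (ha : 0 ≤ a) (hb : b ≤ T) (hδ : δ ≤ 1)
    {η A B C : ℝ → ℝ} (hη : η ∈ supportedFamily a b) (hA : ContDiff ℝ ∞ A)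
    (pA : ∀ x, A (x + 2 * Real.pi) = A x) (hB : ContDiff ℝ ∞ B)
    (pB : ∀ x, B (x + 2 * Real.pi) = B x) (hC : SmoothSupported δ C) :
    IsSpaceTimeTest T fun P : ℝ × Pt => η P.1 * (A P.2.1 * (B P.2.2.1 * C P.2.2.2)) := by
  obtain ⟨hη, ⟨a', b', ha', hb', h0⟩, -⟩ := hη
  obtain ⟨hC, δ', hδ', hC0⟩ := hC
  refine ⟨by fun_prop, fun t x y z => ⟨by simp only [pA], by simp only [pB]⟩,
    a', b', δ', ha.trans_lt ha', hb'.trans_le hb, hδ'.trans_le hδ, ?_⟩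
  rintro t x y z (h | h | h)
  · simp [h0 t (Or.inl h)]
  · simp [h0 t (Or.inr h)]
  · simp [hC0 z h]

theorem pd_prod {A B C : ℝ → ℝ} (hA : ContDiff ℝ ∞ A) (hB : ContDiff ℝ ∞ B)
    (hC : ContDiff ℝ ∞ C) (η : ℝ) (p : Pt) :
    pd 0 (fun p => η * (A p.1 * (B p.2.1 * C p.2.2))) p =
        η * (deriv A p.1 * (B p.2.1 * C p.2.2)) ∧
      pd 1 (fun p => η * (A p.1 * (B p.2.1 * C p.2.2))) p =
        η * (A p.1 * (deriv B p.2.1 * C p.2.2)) ∧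
      pd 2 (fun p => η * (A p.1 * (B p.2.1 * C p.2.2))) p =
        η * (A p.1 * (B p.2.1 * deriv C p.2.2)) := by
  have hd : Differentiable ℝ fun p : Pt => η * (A p.1 * (B p.2.1 * C p.2.2)) :=
    ContDiff.differentiable (n := ∞) (by fun_prop) (by simp)
  have dA := fun x => (hA.differentiable (by simp) x).hasDerivAt
  have dB := fun x => (hB.differentiable (by simp) x).hasDerivAt
  have dC := fun x => (hC.differentiable (by simp) x).hasDerivAt
  obtain ⟨x, y, z⟩ := p
  exact ⟨(hasDerivAt_fst hd x y z).unique (((dA x).mul_const (B y * C z)).const_mul η),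
    (hasDerivAt_snd hd x y z).unique ((((dB y).mul_const (C z)).const_mul (A x)).const_mul η),
    (hasDerivAt_trd hd x y z).unique ((((dC z).const_mul (B y)).const_mul (A x)).const_mul η)⟩

/-- The gradient of the difference of two pressures for the same velocity vanishes. -/
theorem IsPressure.integral_mul_pd_eq_zero {T : ℝ} {v w : ℝ → Field} {G Gw : ℝ → MField}
    {q : ℝ → Pt → ℝ} (hq : IsPressure T w Gw q) (h0 : IsPressure T v G fun _ _ => 0)
    (mw : ∀ i, MemLp (fun P : ℝ × Pt => w P.1 i P.2) 2 ((volT T).prod volΩ))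
    (mG : ∀ i j, MemLp (fun P : ℝ × Pt => Gw P.1 i j P.2) 2 ((volT T).prod volΩ))
    (ew : ∀ i, (fun P : ℝ × Pt => w P.1 i P.2) =ᵐ[(volT T).prod volΩ] fun P => v P.1 i P.2)
    (eG : ∀ i j, (fun P : ℝ × Pt => Gw P.1 i j P.2) =ᵐ[(volT T).prod volΩ]
      fun P => G P.1 i j P.2)
    {ψ : ℝ × Pt → ℝ} (hψ : IsSpaceTimeTest T ψ) (i : Fin 3) :
    ∫ P : ℝ × Pt, q P.1 P.2 * pd i (fun p => ψ (P.1, p)) P.2 ∂((volT T).prod volΩ) = 0 := by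
  -- If the product is not integrable, its Bochner integral is zero by convention and there is
  -- nothing to prove.
  by_cases hi : Integrable (fun P : ℝ × Pt => q P.1 P.2 * pd i (fun p => ψ (P.1, p)) P.2)
    ((volT T).prod volΩ)
  · have c1 := continuous_fderiv_apply hψ.1 (1, 0)
    have c2 := fun j => continuous_fderiv_apply hψ.1 (0, dir j)
    have bm : ∀ {f g : ℝ × Pt → ℝ}, Integrable f ((volT T).prod volΩ) → Continuous g →
        Integrable (fun P => f P * g P) ((volT T).prod volΩ) := by
      intro f g hf hg
      obtain ⟨C, -, hC⟩ := exists_bound_prod hg T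
      exact hf.mul_bdd (c := C) hg.aestronglyMeasurable
        ((ae_prod_mem T).mono fun P hP => hC P hP.1 hP.2)
    have hconv : Integrable (fun P : ℝ × Pt => conv (w P.1) (Gw P.1) i P.2)
        ((volT T).prod volΩ) :=
      integrable_finsetSum _ fun j _ => (mw j).integrable_mul (mG i j)
    have J : Integrable (fun P : ℝ × Pt => w P.1 i P.2 * fderiv ℝ ψ P (1, 0) -
        (∑ j, Gw P.1 i j P.2 * pd j (fun p => ψ (P.1, p)) P.2) -
        conv (w P.1) (Gw P.1) i P.2 * ψ P) ((volT T).prod volΩ) := by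
      simp only [pd_slice hψ.1]
      exact ((bm ((mw i).integrable one_le_two) c1).sub (integrable_finsetSum _ fun j _ =>
        bm ((mG i j).integrable one_le_two) (c2 j))).sub (bm hconv hψ.1.continuous)
    have h1 := hq.2 ψ hψ.1 hψ.2.1 hψ.2.2 i
    rw [integral_add J hi] at h1
    have h2 := h0.2 ψ hψ.1 hψ.2.1 hψ.2.2 i
    simp only [zero_mul, add_zero] at h2
    have e : ∫ P : ℝ × Pt, (w P.1 i P.2 * fderiv ℝ ψ P (1, 0) -
        (∑ j, Gw P.1 i j P.2 * pd j (fun p => ψ (P.1, p)) P.2) -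
        conv (w P.1) (Gw P.1) i P.2 * ψ P) ∂((volT T).prod volΩ) = 0 := by
      rw [← h2]
      refine integral_congr_ae ?_
      filter_upwards [ae_all_iff.2 ew, ae_all_iff.2 fun i => ae_all_iff.2 (eG i)] with P hP hP'
      simp only [conv, hP, hP']
    rw [e, zero_add] at h1
    exact h1
  · exact integral_undef hi

theorem integral_prod_slab {T a b δ : ℝ} (ha : 0 ≤ a) (hb : b ≤ T) (hδ : δ ≤ 1)
    {f : ℝ × Pt → ℝ} (hf : ∀ P : ℝ × Pt, P.1 ∉ Set.Ioo a b ∨ δ ≤ |P.2.2.2| → f P = 0) :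
    ∫ P, f P ∂((volume.restrict (Set.Ioo a b)).prod (slab δ)) =
      ∫ P, f P ∂((volT T).prod volΩ) := by
  have : (volume.restrict (Set.Ioo a b)).prod (slab δ) = ((volT T).prod volΩ).restrict
      (Set.Ioo a b ×ˢ {p : Pt | |p.2.2| < δ}) := by
    rw [slab_eq hδ, volT, ← Measure.prod_restrict,
      Measure.restrict_restrict measurableSet_Ioo, Set.inter_eq_left.2
        (Set.Ioo_subset_Ioo ha hb)]
  rw [this]
  refine setIntegral_eq_integral_of_forall_compl_eq_zero fun P hP => hf P ?_
  by_contra hcon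
  rw [not_or, not_not, not_le] at hcon
  exact hP hcon

/-- A pressure is constant in space in every box. -/
theorem IsPressure.ae_eq_in_box {T a b δ δ₀ : ℝ} (ha : 0 < a) (hab : a < b) (hb : b < T)
    (hδ₀ : 0 < δ₀) (hδ : δ₀ ≤ δ) (hδ1 : δ < 1) {w : ℝ → Field} {Gw : ℝ → MField}
    {q : ℝ → Pt → ℝ} (hq : IsPressure T w Gw q)
    (h : ∀ ψ, IsSpaceTimeTest T ψ → ∀ i,
      ∫ P : ℝ × Pt, q P.1 P.2 * pd i (fun p => ψ (P.1, p)) P.2 ∂((volT T).prod volΩ) = 0)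
    {ρ : ℝ → ℝ} (hρ : SmoothSupported δ₀ ρ) (hr : ∫ z in Set.Ioo (-δ₀) δ₀, ρ z ≠ 0) :
    ∀ᵐ t ∂volume.restrict (Set.Ioo a b), ∀ᵐ p ∂volΩ, |p.2.2| < δ → q t p =
      (∫ p, q t p * ρ p.2.2 ∂volΩ) / ((2 * Real.pi) ^ 2 * ∫ z in Set.Ioo (-δ₀) δ₀, ρ z) := by
  have hqi : Integrable (fun P : ℝ × Pt => q P.1 P.2)
      ((volume.restrict (Set.Ioo a b)).prod (slab δ)) := by
    have := hq.1 a b δ ha hb hδ1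
    rw [slab_eq hδ1.le, volΩ, Measure.restrict_restrict (measurableSet_slab δ), Set.inter_comm,
      Measure.prod_restrict]
    exact this
  have h1 := ae_eq_of_derivatives_eq_zero hab hδ₀ hδ hqi hρ hr ?_
  · filter_upwards [h1] with t ht
    -- Since `ρ` is supported in `|z| < δ₀`, the constant found in the box does not depend on `δ`;
    -- hence the values from different boxes agree.
    have e : ∫ p, q t p * ρ p.2.2 ∂slab δ = ∫ p, q t p * ρ p.2.2 ∂volΩ := by
      rw [slab_eq hδ1.le]
      refine setIntegral_eq_integral_of_forall_compl_eq_zero fun p hp => ?_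
      rw [(hρ.mono hδ).eq_zero (not_lt.1 hp), mul_zero]
    rw [e, slab_eq hδ1.le, ae_restrict_iff' (measurableSet_slab δ)] at ht
    exact ht
  · intro η hη A B C hA pA hB pB hC
    have hψ := isSpaceTimeTest_of_prod ha.le hb.le hδ1.le hη hA pA hB pB hC
    have hη0 : ∀ t, t ∉ Set.Ioo a b → η t = 0 := by
      obtain ⟨-, ⟨a', b', ha', hb', h0⟩, -⟩ := hη
      intro t ht
      rw [Set.mem_Ioo, not_and_or, not_lt, not_lt] at ht
      exact h0 t (ht.imp (fun h => h.trans ha'.le) fun h => hb'.le.trans h)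
    refine ⟨?_, ?_, ?_⟩
    · rw [integral_prod_slab ha.le hb.le hδ1.le]
      · have := h _ hψ 0
        simpa only [(pd_prod hA hB hC.1 _ _).1] using this
      · rintro P (hP | hP)
        · simp [hη0 _ hP]
        · simp [hC.eq_zero hP]
    · rw [integral_prod_slab ha.le hb.le hδ1.le]
      · have := h _ hψ 1
        simpa only [(pd_prod hA hB hC.1 _ _).2.1] using this
      · rintro P (hP | hP)
        · simp [hη0 _ hP]
        · simp [hC.eq_zero hP]
    · rw [integral_prod_slab ha.le hb.le hδ1.le]
      · have := h _ hψ 2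
        simpa only [(pd_prod hA hB hC.1 _ _).2.2] using this
      · rintro P (hP | hP)
        · simp [hη0 _ hP]
        · simp [hC.deriv_eq_zero hP]

/-- If all these integrals vanished, the supported family would annihilate the constant one without
separating it from zero. -/
theorem exists_smoothSupported {δ : ℝ} (hδ : 0 < δ) :
    ∃ ρ, SmoothSupported δ ρ ∧ ∫ z in Set.Ioo (-δ) δ, ρ z ≠ 0 := by
  by_contra! hcon
  have hab : -δ < δ := by linarith
  have h1 := determining_supportedFamily hab (fun _ => 1) (integrable_const _)
    fun A hA => by simpa using hcon A (smoothSupported_of_mem hA)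
  have h2 : ∀ᵐ _ ∂(volume : Measure ℝ).restrict (Set.Ioo (-δ) δ), False :=
    h1.mono fun x hx => one_ne_zero hx
  rw [eventually_false_iff_eq_bot, ae_eq_bot, Measure.restrict_eq_zero, Real.volume_Ioo,
    ENNReal.ofReal_eq_zero] at h2
  linarith

/-- The pressure is unique up to a function of time. -/
theorem IsPressure.exists_ae_eq {T : ℝ} (hT : 0 < T) {w : ℝ → Field} {Gw : ℝ → MField}
    {q : ℝ → Pt → ℝ} (hq : IsPressure T w Gw q)
    (h : ∀ ψ, IsSpaceTimeTest T ψ → ∀ i,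
      ∫ P : ℝ × Pt, q P.1 P.2 * pd i (fun p => ψ (P.1, p)) P.2 ∂((volT T).prod volΩ) = 0) :
    ∃ Q : ℝ → ℝ, ∀ᵐ t ∂volT T, ∀ᵐ p ∂volΩ, q t p = Q t := by
  obtain ⟨ρ, hρ, hr⟩ := exists_smoothSupported (δ := 1 / 2) (by norm_num)
  refine ⟨fun t => (∫ p, q t p * ρ p.2.2 ∂volΩ) /
    ((2 * Real.pi) ^ 2 * ∫ z in Set.Ioo (-(1 / 2 : ℝ)) (1 / 2), ρ z), ?_⟩
  -- The `3` gives `ε ≤ 1/3`: the time intervals are nonempty and the slabs `|z| < 1 - ε` contain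
  -- `|z| < 1/2`, where `ρ` lives.
  set ε : ℕ → ℝ := fun k => 1 / ((k : ℝ) + 3) with hε
  have ε0 : ∀ k, 0 < ε k := fun k => by simp only [hε]; positivity
  have ε1 : ∀ k, ε k ≤ 1 / 3 := fun k => by
    simp only [hε]
    exact one_div_le_one_div_of_le (by norm_num) (by linarith [(k.cast_nonneg : (0 : ℝ) ≤ k)])
  have εlim : Tendsto ε atTop (𝓝 0) := by
    refine tendsto_const_nhds.div_atTop ?_
    exact tendsto_natCast_atTop_atTop.atTop_add tendsto_const_nhds
  have hk : ∀ k, ∀ᵐ t ∂volT T, t ∈ Set.Ioo (T * ε k) (T - T * ε k) → ∀ᵐ p ∂volΩ,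
      |p.2.2| < 1 - ε k → q t p = (∫ p, q t p * ρ p.2.2 ∂volΩ) /
        ((2 * Real.pi) ^ 2 * ∫ z in Set.Ioo (-(1 / 2 : ℝ)) (1 / 2), ρ z) := by
    intro k
    have e0 := ε0 k
    have e1 := ε1 k
    have h1 : 0 < T * ε k := mul_pos hT e0
    have h2 : T * ε k ≤ T * (1 / 3) := mul_le_mul_of_nonneg_left e1 hT.le
    have := hq.ae_eq_in_box h1 (b := T - T * ε k) (by linarith) (by linarith)
      (δ := 1 - ε k) (by norm_num) (by linarith) (by linarith) h hρ hr
    rw [ae_restrict_iff' measurableSet_Ioo] at this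
    exact ae_mono Measure.restrict_le_self this
  filter_upwards [ae_all_iff.2 hk, ae_volT_mem T] with t ht htm
  have l1 : Tendsto (fun k => T * ε k) atTop (𝓝 0) := by simpa using εlim.const_mul T
  have l2 : Tendsto (fun k => T - T * ε k) atTop (𝓝 T) := by simpa using l1.const_sub T
  have l3 : Tendsto (fun k => 1 - ε k) atTop (𝓝 1) := by simpa using εlim.const_sub 1
  have hp : ∀ᵐ p ∂volΩ, ∀ k, t ∈ Set.Ioo (T * ε k) (T - T * ε k) →
      |p.2.2| < 1 - ε k → q t p = (∫ p, q t p * ρ p.2.2 ∂volΩ) /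
        ((2 * Real.pi) ^ 2 * ∫ z in Set.Ioo (-(1 / 2 : ℝ)) (1 / 2), ρ z) := by
    refine ae_all_iff.2 fun k => ?_
    by_cases hm : t ∈ Set.Ioo (T * ε k) (T - T * ε k)
    · exact (ht k hm).mono fun p hp _ => hp
    · exact Eventually.of_forall fun p hm' => absurd hm' hm
  filter_upwards [hp, ae_mem_cell] with p hp hpm
  obtain ⟨k, k1, k2, k3⟩ := ((l1.eventually_lt_const htm.1).and
    ((l2.eventually_const_lt htm.2).and
      (l3.eventually_const_lt (abs_lt.2 ⟨hpm.2.2.1, hpm.2.2.2⟩)))).exists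
  exact hp k ⟨k1, k2⟩ k3

end NSChannel

namespace NSChannel

/-! ### The eigenfunctions independent of `x` -/

/-- `sin (s x)` or `cos (s x)`. -/
noncomputable def osc (b : Bool) (s x : ℝ) : ℝ := if b then Real.sin (s * x) else Real.cos (s * x)

/-- The sign in the derivative of `osc`. -/
def oscSign (b : Bool) : ℝ := if b then 1 else -1

theorem hasDerivAt_osc (b : Bool) (s x : ℝ) :
    HasDerivAt (osc b s) (oscSign b * s * osc (!b) s x) x := by
  have h : HasDerivAt (fun x => s * x) s x := by simpa using (hasDerivAt_id x).const_mul s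
  cases b
  · exact h.cos.congr_deriv (by simp [osc, oscSign]; ring)
  · exact h.sin.congr_deriv (by simp [osc, oscSign]; ring)

theorem deriv_osc (b : Bool) (s : ℝ) :
    deriv (osc b s) = fun x => oscSign b * s * osc (!b) s x :=
  funext fun x => (hasDerivAt_osc b s x).deriv

theorem oscSign_mul_not (b : Bool) : oscSign b * oscSign (!b) = -1 := by
  cases b <;> simp [oscSign]

theorem oscSign_not (b : Bool) : oscSign (!b) = -oscSign b := by
  cases b <;> simp [oscSign]

theorem abs_oscSign (b : Bool) : |oscSign b| = 1 := by cases b <;> simp [oscSign]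

theorem contDiff_osc (b : Bool) (s : ℝ) : ContDiff ℝ ∞ (osc b s) := by
  cases b
  · exact Real.contDiff_cos.comp (contDiff_const.mul contDiff_id)
  · exact Real.contDiff_sin.comp (contDiff_const.mul contDiff_id)

theorem abs_osc_le (b : Bool) (s x : ℝ) : |osc b s x| ≤ 1 := by
  cases b
  · exact Real.abs_cos_le_one _
  · exact Real.abs_sin_le_one _

theorem osc_periodic (b : Bool) (n : ℕ) (x : ℝ) : osc b n (x + 2 * Real.pi) = osc b n x := by
  have : (n : ℝ) * (x + 2 * Real.pi) = n * x + n * (2 * Real.pi) := by ring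
  cases b
  · simp [osc, this, Real.cos_add_nat_mul_two_pi]
  · simp [osc, this, Real.sin_add_nat_mul_two_pi]

theorem osc_neg (b : Bool) (s x : ℝ) : osc b s (-x) = -oscSign b * osc b s x := by
  cases b <;> simp [osc, oscSign]

/-- Solutions of `f'' = - κ f` for different `κ` are orthogonal if their Wronskian takes the same
values at the end points. -/
theorem integral_osc_mul_osc {a b : ℝ} (hab : a ≤ b) {i j : Bool} {s r : ℝ} (hsr : s ^ 2 ≠ r ^ 2)
    (hW : oscSign i * s * osc (!i) s b * osc j r b - osc i s b * (oscSign j * r * osc (!j) r b) =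
      oscSign i * s * osc (!i) s a * osc j r a - osc i s a * (oscSign j * r * osc (!j) r a)) :
    ∫ x in Set.Ioo a b, osc i s x * osc j r x = 0 := by
  have h := integral_Ioo_deriv hab
    (f := fun x => (oscSign i * s * osc (!i) s x) * osc j r x -
      osc i s x * (oscSign j * r * osc (!j) r x))
    (f' := fun x => (r ^ 2 - s ^ 2) * (osc i s x * osc j r x)) (fun x => by
      have h1 := hasDerivAt_osc i s x
      have h2 := hasDerivAt_osc j r x
      have h3 := (hasDerivAt_osc (!i) s x).const_mul (oscSign i * s)
      have h4 := (hasDerivAt_osc (!j) r x).const_mul (oscSign j * r)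
      refine ((h3.mul h2).sub (h1.mul h4)).congr_deriv ?_
      simp only [Bool.not_not]
      linear_combination (s ^ 2 * osc i s x * osc j r x) * oscSign_mul_not i -
        (r ^ 2 * osc i s x * osc j r x) * oscSign_mul_not j)
    (continuous_const.mul ((contDiff_osc i s).continuous.mul (contDiff_osc j r).continuous))
  rw [integral_const_mul, hW, sub_self] at h
  exact (mul_eq_zero.1 h).resolve_left (sub_ne_zero.2 hsr.symm)

theorem integral_osc_mul_self {a b : ℝ} (hab : a ≤ b) (i : Bool) {s : ℝ} (hs : s ≠ 0) :
    ∫ x in Set.Ioo a b, osc i s x * osc i s x =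
      (b - oscSign i * (osc i s b * osc (!i) s b) / s) / 2 -
        (a - oscSign i * (osc i s a * osc (!i) s a) / s) / 2 := by
  refine integral_Ioo_deriv hab
    (f := fun x => (x - oscSign i * (osc i s x * osc (!i) s x) / s) / 2) (fun x => ?_)
    ((contDiff_osc i s).continuous.mul (contDiff_osc i s).continuous)
  have h1 := hasDerivAt_osc i s x
  have h3 := hasDerivAt_osc (!i) s x
  refine (((hasDerivAt_id x).sub (((h1.mul h3).const_mul (oscSign i)).div_const s)).div_const
    2).congr_deriv ?_
  have hcs := Real.sin_sq_add_cos_sq (s * x)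
  cases i
  · simp only [oscSign, osc, Bool.not_false, Bool.not_true, if_true, Bool.false_eq_true, if_false]
    field_simp
    linear_combination -hcs
  · simp only [oscSign, osc, Bool.not_false, Bool.not_true, if_true, Bool.false_eq_true, if_false]
    field_simp
    linear_combination -hcs

theorem integral_osc_mul_not (b : Bool) {n : ℕ} (hn : 1 ≤ n) :
    ∫ x in Set.Ioo 0 (2 * Real.pi), osc b n x * osc (!b) n x = 0 := by
  have hn0 : (n : ℝ) ≠ 0 := by positivity
  have h := integral_Ioo_deriv (a := 0) (b := 2 * Real.pi) (by positivity)
    (f := fun x => osc b n x ^ 2 * (oscSign b / (2 * n)))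
    (f' := fun x => osc b n x * osc (!b) n x) (fun x => by
      refine (((hasDerivAt_osc b n x).pow 2).mul_const _).congr_deriv ?_
      have : oscSign b * oscSign b = 1 := by cases b <;> simp [oscSign]
      push_cast
      field_simp
      linear_combination (osc b n x * osc (!b) n x) * this)
    ((contDiff_osc b n).continuous.mul (contDiff_osc (!b) n).continuous)
  rw [h]
  have := osc_periodic b n 0
  rw [zero_add] at this
  simp only [this, sub_self]

theorem integral_osc_periodic_self (b : Bool) {n : ℕ} (hn : 1 ≤ n) :
    ∫ x in Set.Ioo 0 (2 * Real.pi), osc b n x * osc b n x = Real.pi := by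
  have hn0 : (n : ℝ) ≠ 0 := by positivity
  rw [integral_osc_mul_self (by positivity) b hn0]
  have h1 := osc_periodic b n 0
  have h2 := osc_periodic (!b) n 0
  rw [zero_add] at h1 h2
  rw [h1, h2]
  ring

theorem integral_osc_periodic_of_ne (i j : Bool) {n m : ℕ} (h : n ≠ m) :
    ∫ x in Set.Ioo 0 (2 * Real.pi), osc i n x * osc j m x = 0 := by
  refine integral_osc_mul_osc (by positivity) (fun hh => h ?_) ?_
  · exact_mod_cast (pow_left_inj₀ n.cast_nonneg m.cast_nonneg two_ne_zero).1 hh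
  · have h1 := osc_periodic i n 0
    have h2 := osc_periodic (!i) n 0
    have h3 := osc_periodic j m 0
    have h4 := osc_periodic (!j) m 0
    rw [zero_add] at h1 h2 h3 h4
    rw [h1, h2, h3, h4]

/-- The parity of the profile. -/
def parity (p : ℕ) : Bool := !decide (Even p)

theorem profileZ_eq (n p : ℕ) (lam z : ℝ) :
    profileZ 0 n p lam z = osc (parity p) (√(lam - muSq 0 n)) z := by
  by_cases h : Even p <;> simp [profileZ, osc, parity, h]

theorem muSq_zero (n : ℕ) : muSq 0 n = (n : ℝ) ^ 2 := by simp [muSq]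

/-! ### The transcendental eigenvalue equations -/

section Eigenvalue

variable {β lam lam' : ℝ} {n p : ℕ}

theorem IsStokesEigenvalue.sub_pos (h : IsStokesEigenvalue β 0 n p lam) :
    0 < lam - muSq 0 n := by
  have := h.1.1
  have h2 : 0 ≤ Real.pi ^ 2 / 4 * (p : ℝ) ^ 2 := by positivity
  linarith

theorem IsStokesEigenvalue.sqrt_pos (h : IsStokesEigenvalue β 0 n p lam) :
    0 < √(lam - muSq 0 n) := Real.sqrt_pos.2 h.sub_pos

theorem IsStokesEigenvalue.sq_sqrt (h : IsStokesEigenvalue β 0 n p lam) :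
    √(lam - muSq 0 n) ^ 2 = lam - (n : ℝ) ^ 2 := by
  rw [Real.sq_sqrt h.sub_pos.le, muSq_zero]

theorem IsStokesEigenvalue.sqrt_mem (h : IsStokesEigenvalue β 0 n p lam) :
    √(lam - muSq 0 n) ∈ Set.Ioo (Real.pi / 2 * p) (Real.pi / 2 * (1 + p)) := by
  obtain ⟨⟨h1, h2⟩, -⟩ := h
  have hp := Real.pi_pos
  constructor
  · apply Real.lt_sqrt_of_sq_lt
    nlinarith
  · rw [Real.sqrt_lt' (by positivity)]
    nlinarith

/-- The boundary condition satisfied by the profile. -/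
theorem IsStokesEigenvalue.robin (hβ : 0 < β) (h : IsStokesEigenvalue β 0 n p lam) :
    oscSign (parity p) * √(lam - muSq 0 n) * osc (!parity p) √(lam - muSq 0 n) 1 =
      -β * osc (parity p) √(lam - muSq 0 n) 1 := by
  have hs := h.sqrt_pos
  have h2 := h.2
  set s := √(lam - muSq 0 n)
  by_cases hp : Even p
  · rw [if_pos hp, Real.cot_eq_cos_div_sin] at h2
    -- Division by zero yields zero: a vanishing sine would make the cotangent zero, whereas `s / β`
    -- is positive.
    have hsin : Real.sin s ≠ 0 := fun h0 => by
      rw [h0, div_zero] at h2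
      exact (div_pos hs hβ).ne h2
    rw [div_eq_div_iff hsin hβ.ne'] at h2
    simp only [parity, hp, osc, oscSign]
    simp only [decide_true, Bool.not_true, Bool.not_false, if_true, Bool.false_eq_true, if_false,
      mul_one]
    linear_combination h2
  · rw [if_neg hp, Real.tan_eq_sin_div_cos] at h2
    have hcos : Real.cos s ≠ 0 := fun h0 => by
      rw [h0, div_zero, neg_div] at h2
      have := div_pos hs hβ
      linarith
    rw [div_eq_div_iff hcos hβ.ne'] at h2
    simp only [parity, hp, osc, oscSign]
    simp only [decide_false, Bool.not_true, Bool.not_false, if_true, Bool.false_eq_true, if_false,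
      mul_one]
    linear_combination h2

/-- Between consecutive multiples of `π` the sine has the constant sign `(-1)^k`. -/
theorem sin_mul_sin_pos {k : ℕ} {s r : ℝ}
    (hs : s ∈ Set.Ioo (Real.pi * k) (Real.pi * k + Real.pi))
    (hr : r ∈ Set.Ioo (Real.pi * k) (Real.pi * k + Real.pi)) : 0 < Real.sin s * Real.sin r := by
  have e : ∀ x, Real.sin x = (-1) ^ k * Real.sin (x - k * Real.pi) := fun x => by
    rw [← Real.sin_add_nat_mul_pi, sub_add_cancel]
  have p : ∀ x ∈ Set.Ioo (Real.pi * k) (Real.pi * k + Real.pi),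
      0 < Real.sin (x - k * Real.pi) := fun x hx =>
    Real.sin_pos_of_pos_of_lt_pi (by linarith [hx.1]) (by linarith [hx.2])
  rw [e s, e r]
  have h1 : ((-1 : ℝ) ^ k) * (-1) ^ k = 1 := by rw [← mul_pow]; simp
  have := mul_pos (p s hs) (p r hr)
  calc (0 : ℝ) < ((-1) ^ k * (-1) ^ k) * (Real.sin (s - k * Real.pi) * Real.sin (r - k * Real.pi)) := by
        rw [h1, one_mul]; exact this
    _ = _ := by ring

/-- Eliminating between the boundary conditions of two roots `s < r` gives `β sin(r - s) = -(r - s)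
sin s sin r` for even `p`, with cosines on the right for odd `p`. As both roots lie in the same
interval of length `π/2`, the left side is positive and the right side negative. -/
theorem IsStokesEigenvalue.not_lt (hβ : 0 < β) (h : IsStokesEigenvalue β 0 n p lam)
    (h' : IsStokesEigenvalue β 0 n p lam') : ¬ lam < lam' := by
  intro hlt
  have hs := h.sqrt_mem
  have hs' := h'.sqrt_mem
  have e := h.robin hβ
  have e' := h'.robin hβ
  have hss : √(lam - muSq 0 n) < √(lam' - muSq 0 n) :=
    Real.sqrt_lt_sqrt h.sub_pos.le (by linarith)
  set s := √(lam - muSq 0 n)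
  set r := √(lam' - muSq 0 n)
  have hpi := Real.pi_pos
  have hd : 0 < Real.sin (r - s) := by
    apply Real.sin_pos_of_pos_of_lt_pi (by linarith)
    linarith [hs.1, hs'.2]
  rw [Real.sin_sub] at hd
  have hp1 : (0 : ℝ) < r - s := by linarith
  rcases Nat.even_or_odd' p with ⟨k, hk | hk⟩
  · have hp : Even p := ⟨k, by omega⟩
    simp only [parity, hp, osc, oscSign] at e e'
    simp only [decide_true, Bool.not_true, Bool.not_false, if_true, Bool.false_eq_true, if_false,
      mul_one] at e e'
    have hc : (p : ℝ) = 2 * k := by exact_mod_cast hk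
    rw [hc] at hs hs'
    have hpos := sin_mul_sin_pos (k := k) (s := s) (r := r)
      ⟨by linarith [hs.1], by linarith [hs.2]⟩ ⟨by linarith [hs'.1], by linarith [hs'.2]⟩
    have h1 := mul_pos hp1 hpos
    have h2 := mul_pos hβ hd
    have : β * (Real.sin r * Real.cos s - Real.cos r * Real.sin s) =
        -((r - s) * (Real.sin s * Real.sin r)) := by
      linear_combination Real.sin r * e - Real.sin s * e'
    linarith
  · have hp : ¬ Even p := by rw [Nat.not_even_iff_odd]; exact ⟨k, hk⟩
    simp only [parity, hp, osc, oscSign] at e e'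
    simp only [decide_false, Bool.not_true, Bool.not_false, if_true, Bool.false_eq_true, if_false,
      mul_one] at e e'
    have hc : (p : ℝ) = 2 * k + 1 := by exact_mod_cast hk
    rw [hc] at hs hs'
    -- A shift by `π/2` reduces the cosines to the sine case; the signs cancel in the product.
    have hpos := sin_mul_sin_pos (k := k) (s := s - Real.pi / 2) (r := r - Real.pi / 2)
      ⟨by linarith [hs.1], by linarith [hs.2]⟩ ⟨by linarith [hs'.1], by linarith [hs'.2]⟩
    rw [Real.sin_sub_pi_div_two, Real.sin_sub_pi_div_two, neg_mul_neg] at hpos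
    have h1 := mul_pos hp1 hpos
    have h2 := mul_pos hβ hd
    have : β * (Real.sin r * Real.cos s - Real.cos r * Real.sin s) =
        -((r - s) * (Real.cos s * Real.cos r)) := by
      linear_combination -Real.cos r * e + Real.cos s * e'
    linarith

/-- The eigenvalue is determined by its indices. -/
theorem IsStokesEigenvalue.unique (hβ : 0 < β) (h : IsStokesEigenvalue β 0 n p lam)
    (h' : IsStokesEigenvalue β 0 n p lam') : lam = lam' :=
  le_antisymm (le_of_not_gt (h'.not_lt hβ h)) (le_of_not_gt (h.not_lt hβ h'))

theorem IsStokesEigenvalue.le (h : IsStokesEigenvalue β 0 n p lam) :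
    (n : ℝ) ^ 2 + (p : ℝ) ^ 2 ≤ lam := by
  have h1 := h.1.1
  rw [muSq_zero] at h1
  have h2 : (p : ℝ) ^ 2 ≤ Real.pi ^ 2 / 4 * (p : ℝ) ^ 2 := by
    refine le_mul_of_one_le_left (sq_nonneg _) ?_
    nlinarith [Real.pi_gt_three]
  linarith

theorem IsStokesEigenvalue.one_le (hn : 1 ≤ n) (h : IsStokesEigenvalue β 0 n p lam) :
    1 ≤ lam := by
  have h1 : (1 : ℝ) ≤ n := by exact_mod_cast hn
  nlinarith [h.le, sq_nonneg (p : ℝ)]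

end Eigenvalue

/-- The unnormalized eigenfunction. -/
noncomputable def rawMode (n p : ℕ) (lam : ℝ) (b : Bool) (q : Pt) : ℝ :=
  osc b n q.2.1 * osc (parity p) √(lam - muSq 0 n) q.2.2

/-- The factor that normalizes `rawMode`. -/
noncomputable def modeScale (n p : ℕ) (lam : ℝ) (b : Bool) : ℝ :=
  (√(∫ q, rawMode n p lam b q * rawMode n p lam b q ∂volΩ))⁻¹

/-- The normalized eigenfunction. -/
noncomputable def stokesMode (n p : ℕ) (lam : ℝ) (b : Bool) (q : Pt) : ℝ :=
  modeScale n p lam b * (1 * (osc b n q.2.1 * osc (parity p) √(lam - muSq 0 n) q.2.2))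

theorem stokesMode_eq (n p : ℕ) (lam : ℝ) (b : Bool) (q : Pt) :
    stokesMode n p lam b q = modeScale n p lam b * rawMode n p lam b q := by
  rw [stokesMode, rawMode, one_mul]

theorem integral_rawMode_mul (n p n' p' : ℕ) (lam lam' : ℝ) (b b' : Bool) :
    ∫ q, rawMode n p lam b q * rawMode n' p' lam' b' q ∂volΩ = 2 * Real.pi *
      ((∫ y in Set.Ioo 0 (2 * Real.pi), osc b n y * osc b' n' y) *
        ∫ z in Set.Ioo (-1 : ℝ) 1, osc (parity p) √(lam - muSq 0 n) z *
          osc (parity p') √(lam' - muSq 0 n') z) := by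
  have h := integral_slab_prod 1 (fun _ => 1) (fun y => osc b n y * osc b' n' y)
    fun z => osc (parity p) √(lam - muSq 0 n) z * osc (parity p') √(lam' - muSq 0 n') z
  have e : ∫ _ in Set.Ioo 0 (2 * Real.pi), (1 : ℝ) = 2 * Real.pi := by
    have := Real.pi_pos
    simp
    linarith
  rw [e] at h
  rw [← h, volΩ_eq, slab]
  congr 1; ext q
  simp only [rawMode]
  ring

/-! ### Orthonormality and bounds of the modes -/

section Mode

variable {β lam lam' : ℝ} {n p n' p' : ℕ}

/-- With `Z` the profile and `s` its frequency, the boundary condition turns the explicit primitive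
into `∫ Z² = 1 + β Z(1)²/s²`. This lower bound keeps the normalizing factor at most one. -/
theorem one_le_integral_profile (hβ : 0 < β) (h : IsStokesEigenvalue β 0 n p lam) :
    1 ≤ ∫ z in Set.Ioo (-1 : ℝ) 1, osc (parity p) √(lam - muSq 0 n) z *
      osc (parity p) √(lam - muSq 0 n) z := by
  have hs := h.sqrt_pos
  have e := h.robin hβ
  rw [integral_osc_mul_self (by norm_num) _ hs.ne']
  set s := √(lam - muSq 0 n)
  rw [osc_neg, osc_neg]
  have hσ := oscSign_mul_not (parity p)
  set f := osc (parity p) s 1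
  set g := osc (!parity p) s 1
  set σ := oscSign (parity p)
  set σ' := oscSign (!parity p)
  have h1 : σ * (f * g) / s = -(β * f ^ 2 / s ^ 2) := by
    field_simp
    linear_combination f * e
  have h2 : σ * (-σ * f * (-σ' * g)) / s = -(σ * (f * g) / s) := by
    rw [← neg_div]
    congr 1
    linear_combination (σ * f * g) * hσ
  rw [h2, h1]
  have : 0 ≤ β * f ^ 2 / s ^ 2 := by positivity
  linarith

theorem one_le_integral_rawMode (hβ : 0 < β) (hn : 1 ≤ n) (h : IsStokesEigenvalue β 0 n p lam)
    (b : Bool) : 1 ≤ ∫ q, rawMode n p lam b q * rawMode n p lam b q ∂volΩ := by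
  rw [integral_rawMode_mul, integral_osc_periodic_self b hn]
  have h1 := one_le_integral_profile hβ h
  set J := ∫ z in Set.Ioo (-1 : ℝ) 1, osc (parity p) √(lam - muSq 0 n) z *
      osc (parity p) √(lam - muSq 0 n) z
  have := Real.pi_gt_three
  have h2 : 1 ≤ 2 * Real.pi * Real.pi := by nlinarith
  nlinarith

theorem modeScale_pos (hβ : 0 < β) (hn : 1 ≤ n) (h : IsStokesEigenvalue β 0 n p lam)
    (b : Bool) : 0 < modeScale n p lam b :=
  inv_pos.2 (Real.sqrt_pos.2 (zero_lt_one.trans_le (one_le_integral_rawMode hβ hn h b)))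

theorem modeScale_le_one (hβ : 0 < β) (hn : 1 ≤ n) (h : IsStokesEigenvalue β 0 n p lam)
    (b : Bool) : modeScale n p lam b ≤ 1 :=
  inv_le_one_of_one_le₀ (Real.one_le_sqrt.2 (one_le_integral_rawMode hβ hn h b))

theorem integral_stokesMode_mul (n p n' p' : ℕ) (lam lam' : ℝ) (b b' : Bool) :
    ∫ q, stokesMode n p lam b q * stokesMode n' p' lam' b' q ∂volΩ =
      modeScale n p lam b * modeScale n' p' lam' b' *
        ∫ q, rawMode n p lam b q * rawMode n' p' lam' b' q ∂volΩ := by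
  rw [← integral_const_mul]
  congr 1; ext q
  rw [stokesMode_eq, stokesMode_eq]
  ring

theorem integral_stokesMode_self (hβ : 0 < β) (hn : 1 ≤ n) (h : IsStokesEigenvalue β 0 n p lam)
    (b : Bool) : ∫ q, stokesMode n p lam b q * stokesMode n p lam b q ∂volΩ = 1 := by
  have h1 := zero_lt_one.trans_le (one_le_integral_rawMode hβ hn h b)
  rw [integral_stokesMode_mul, modeScale, ← mul_inv, Real.mul_self_sqrt h1.le,
    inv_mul_cancel₀ h1.ne']

/-- For different `n` the factors in `y` are orthogonal. For equal `n` and different `p`, the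
Wronskian of the profiles vanishes at both ends by the Robin conditions. For equal pairs it is sine
against cosine in `y`. -/
theorem integral_stokesMode_of_ne (hβ : 0 < β) (hn : 1 ≤ n) (h : IsStokesEigenvalue β 0 n p lam)
    (h' : IsStokesEigenvalue β 0 n' p' lam') {b b' : Bool} (hne : ((n, p), b) ≠ ((n', p'), b')) :
    ∫ q, stokesMode n p lam b q * stokesMode n' p' lam' b' q ∂volΩ = 0 := by
  rw [integral_stokesMode_mul, integral_rawMode_mul]
  suffices hz : (∫ y in Set.Ioo 0 (2 * Real.pi), osc b n y * osc b' n' y) = 0 ∨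
      (∫ z in Set.Ioo (-1 : ℝ) 1, osc (parity p) √(lam - muSq 0 n) z *
          osc (parity p') √(lam' - muSq 0 n') z) = 0 by
    rcases hz with hz | hz <;> rw [hz] <;> ring
  by_cases hnn : n = n'
  · subst hnn
    by_cases hpp : p = p'
    · subst hpp
      have hb : b' = !b := by
        cases b <;> cases b' <;> simp_all
      left
      rw [hb]
      exact integral_osc_mul_not b hn
    · right
      have m := h.sqrt_mem
      have m' := h'.sqrt_mem
      have e := h.robin hβ
      have e' := h'.robin hβ
      refine integral_osc_mul_osc (by norm_num) (fun hh => hpp ?_) ?_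
      -- The frequency determines `p`, since the intervals `(πp/2, π(p+1)/2)` are disjoint.
      · rw [pow_left_inj₀ h.sqrt_pos.le h'.sqrt_pos.le two_ne_zero] at hh
        rw [hh] at m
        have hpi := Real.pi_pos
        have h1 : (p : ℝ) < 1 + p' := by
          have := m.1.trans m'.2
          exact lt_of_mul_lt_mul_left this (by positivity)
        have h2 : (p' : ℝ) < 1 + p := by
          have := m'.1.trans m.2
          exact lt_of_mul_lt_mul_left this (by positivity)
        have h1' : p < 1 + p' := by exact_mod_cast h1
        have h2' : p' < 1 + p := by exact_mod_cast h2
        omega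
      · simp only [osc_neg]
        rw [oscSign_not, oscSign_not]
        set f := osc (parity p) √(lam - muSq 0 n) 1
        set g := osc (!parity p) √(lam - muSq 0 n) 1
        set f' := osc (parity p') √(lam' - muSq 0 n) 1
        set g' := osc (!parity p') √(lam' - muSq 0 n) 1
        have w1 : oscSign (parity p) * √(lam - muSq 0 n) * g * f' -
            f * (oscSign (parity p') * √(lam' - muSq 0 n) * g') = 0 := by
          linear_combination f' * e - f * e'
        rw [w1]
        linear_combination (oscSign (parity p) * oscSign (parity p')) * w1
  · left
    exact integral_osc_periodic_of_ne b b' hnn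

theorem contDiff_stokesMode (n p : ℕ) (lam : ℝ) (b : Bool) : ContDiff ℝ ∞ (stokesMode n p lam b) := by
  have h1 := contDiff_osc b n
  have h2 := contDiff_osc (parity p) √(lam - muSq 0 n)
  unfold stokesMode
  fun_prop

/-- The factor `1` in `stokesMode` is the trivial dependence on `x`; it lets `pd_prod` apply
verbatim. -/
theorem pd_stokesMode (n p : ℕ) (lam : ℝ) (b : Bool) (q : Pt) :
    pd 0 (stokesMode n p lam b) q = 0 ∧
    pd 1 (stokesMode n p lam b) q = modeScale n p lam b * (1 * (oscSign b * n * osc (!b) n q.2.1 *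
      osc (parity p) √(lam - muSq 0 n) q.2.2)) ∧
    pd 2 (stokesMode n p lam b) q = modeScale n p lam b * (1 * (osc b n q.2.1 *
      (oscSign (parity p) * √(lam - muSq 0 n) *
        osc (!parity p) √(lam - muSq 0 n) q.2.2))) := by
  have h := pd_prod (A := fun _ => 1) contDiff_const (contDiff_osc b n)
    (contDiff_osc (parity p) √(lam - muSq 0 n)) (modeScale n p lam b) q
  simp only [deriv_osc, deriv_const, zero_mul, mul_zero] at h
  exact h

theorem isRobin_stokesMode (hβ : 0 < β) (h : IsStokesEigenvalue β 0 n p lam) (b : Bool) :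
    IsRobin β (stokesMode n p lam b) fun q => lam * stokesMode n p lam b q := by
  have e := h.robin hβ
  refine ⟨⟨contDiff_stokesMode n p lam b, fun x y z => ⟨rfl, ?_⟩⟩, fun x y z => rfl, fun q => ?_,
    fun x y => ?_, fun x y => ?_⟩
  · simp only [stokesMode, osc_periodic]
  · have f1 : pd 1 (stokesMode n p lam b) = _ := funext fun q => (pd_stokesMode n p lam b q).2.1
    have f2 : pd 2 (stokesMode n p lam b) = _ := funext fun q => (pd_stokesMode n p lam b q).2.2
    have g1 := (pd_prod (A := fun _ => 1) contDiff_const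
      (contDiff_const.mul (contDiff_osc (!b) n) : ContDiff ℝ ∞ fun y => oscSign b * n * osc (!b) n y)
      (contDiff_osc (parity p) √(lam - muSq 0 n)) (modeScale n p lam b) q).2.1
    have g2 := (pd_prod (A := fun _ => 1) contDiff_const (contDiff_osc b n)
      (contDiff_const.mul (contDiff_osc (!parity p) √(lam - muSq 0 n)) : ContDiff ℝ ∞ fun z =>
        oscSign (parity p) * √(lam - muSq 0 n) * osc (!parity p) √(lam - muSq 0 n) z)
      (modeScale n p lam b) q).2.2
    rw [f1, f2, g1, g2, ((hasDerivAt_osc (!b) n _).const_mul _).deriv,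
      ((hasDerivAt_osc (!parity p) √(lam - muSq 0 n) _).const_mul _).deriv]
    simp only [Bool.not_not, stokesMode]
    have s1 := oscSign_mul_not b
    have s2 := oscSign_mul_not (parity p)
    have hs := h.sq_sqrt
    set f := osc b n q.2.1
    set g := osc (parity p) √(lam - muSq 0 n) q.2.2
    set κ := modeScale n p lam b
    linear_combination (κ * f * g * n ^ 2) * s1 +
      (κ * f * g * √(lam - muSq 0 n) ^ 2) * s2 - (κ * f * g) * hs
  · rw [(pd_stokesMode n p lam b _).2.2, stokesMode]
    simp only [e]
    ring
  · rw [(pd_stokesMode n p lam b _).2.2, stokesMode]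
    simp only [osc_neg, oscSign_not]
    linear_combination (modeScale n p lam b * osc b n y * oscSign (parity p)) * e

theorem abs_stokesMode_le (hβ : 0 < β) (hn : 1 ≤ n) (h : IsStokesEigenvalue β 0 n p lam)
    (b : Bool) (q : Pt) : |stokesMode n p lam b q| ≤ 1 := by
  rw [stokesMode, one_mul, abs_mul, abs_mul, abs_of_pos (modeScale_pos hβ hn h b)]
  exact mul_le_one₀ (modeScale_le_one hβ hn h b) (by positivity)
    (mul_le_one₀ (abs_osc_le _ _ _) (abs_nonneg _) (abs_osc_le _ _ _))

/-- A derivative brings down `n` or the vertical frequency `s`. Both are at most `lam`, as `n² + s²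
= lam` and `lam ≥ 1`. -/
theorem abs_pd_stokesMode_le (hβ : 0 < β) (hn : 1 ≤ n) (h : IsStokesEigenvalue β 0 n p lam)
    (b : Bool) (j : Fin 3) (q : Pt) : |pd j (stokesMode n p lam b) q| ≤ lam := by
  have hl := h.one_le hn
  have hn1 : (1 : ℝ) ≤ n := by exact_mod_cast hn
  have hle := h.le
  have hs := h.sq_sqrt
  have hs0 := h.sqrt_pos
  set s := √(lam - muSq 0 n) with hsdef
  have k0 := modeScale_pos hβ hn h b
  have k1 := modeScale_le_one hβ hn h b
  have hnl : (n : ℝ) ≤ lam := by nlinarith [sq_nonneg (p : ℝ)]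
  have hsl : s ≤ lam := by
    by_contra! hcon
    nlinarith
  have key : ∀ κ f g r : ℝ, 0 < κ → κ ≤ 1 → |f| ≤ 1 → |g| ≤ 1 → 0 ≤ r → r ≤ lam →
      κ * (r * (|f| * |g|)) ≤ lam := by
    intro κ f g r h1 h2 h3 h4 h5 h6
    have h7 : |f| * |g| ≤ 1 := mul_le_one₀ h3 (abs_nonneg _) h4
    have h8 : r * (|f| * |g|) ≤ r * 1 := mul_le_mul_of_nonneg_left h7 h5
    have h9 : 0 ≤ r * (|f| * |g|) := by positivity
    calc κ * (r * (|f| * |g|)) ≤ 1 * (r * (|f| * |g|)) := mul_le_mul_of_nonneg_right h2 h9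
      _ ≤ lam := by linarith
  obtain ⟨p0, p1, p2⟩ := pd_stokesMode n p lam b q
  fin_cases j
  · change |pd 0 _ q| ≤ _
    rw [p0, abs_zero]
    linarith
  · change |pd 1 _ q| ≤ _
    rw [p1]
    simp only [abs_mul, abs_oscSign, abs_of_pos k0, one_mul, Nat.abs_cast]
    rw [mul_assoc]
    exact key _ _ _ _ k0 k1 (abs_osc_le _ _ _) (abs_osc_le _ _ _) (by linarith) hnl
  · change |pd 2 _ q| ≤ _
    rw [p2]
    simp only [abs_mul, abs_oscSign, abs_of_pos k0, one_mul, ← hsdef, abs_of_pos hs0]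
    rw [mul_left_comm |osc b n q.2.1|]
    exact key _ _ _ _ k0 k1 (abs_osc_le _ _ _) (abs_osc_le _ _ _) hs0.le hsl

end Mode

/-- The majorant for `Λ⁻²` is a product of two convergent series; the shift `p + 1` accommodates `p
= 0`. -/
theorem summable_mode_bound : Summable fun q : (ℕ × ℕ) × Bool =>
    ((q.1.1 : ℝ) ^ 2)⁻¹ * (2 * (((q.1.2 : ℝ) + 1) ^ 2)⁻¹) := by
  have h1 : Summable fun n : ℕ => ((n : ℝ) ^ 2)⁻¹ := Real.summable_nat_pow_inv.2 one_lt_two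
  have h2 : Summable fun n : ℕ => 2 * (((n : ℝ) + 1) ^ 2)⁻¹ := by
    have := (summable_nat_add_iff 1).2 h1
    push_cast at this
    exact this.mul_left 2
  have h3 := h1.mul_of_nonneg h2 (fun n => by positivity) fun n => by positivity
  have h4 := h3.mul_of_nonneg (g := fun _ : Bool => (1 : ℝ)) (hasSum_fintype _).summable
    (fun n => by positivity) fun _ => zero_le_one
  simpa only [mul_one] using h4

/-- The eigenfunctions independent of `x` form an orthonormal family. -/
theorem modeFamily_stokesMode {β : ℝ} (hβ : 0 < β) {J : Type*} {n p : J → ℕ} {lam : J → ℝ}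
    (hinj : Function.Injective fun j => (n j, p j)) (hn : ∀ j, 1 ≤ n j)
    (hlam : ∀ j, IsStokesEigenvalue β 0 (n j) (p j) (lam j)) :
    ModeFamily β (fun m : J × Bool => stokesMode (n m.1) (p m.1) (lam m.1) m.2)
      fun m => lam m.1 where
  robin m := isRobin_stokesMode hβ (hlam m.1) m.2
  bound m := abs_stokesMode_le hβ (hn m.1) (hlam m.1) m.2
  bound_pd m := abs_pd_stokesMode_le hβ (hn m.1) (hlam m.1) m.2
  one_le m := (hlam m.1).one_le (hn m.1)
  norm_eq m := integral_stokesMode_self hβ (hn m.1) (hlam m.1) m.2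
  ortho m m' hne := integral_stokesMode_of_ne hβ (hn m.1) (hlam m.1) (hlam m'.1) fun h => hne <| by
    obtain ⟨h1, h2⟩ := Prod.ext_iff.1 h
    exact Prod.ext (hinj h1) h2
  summable := by
    have hi : Function.Injective fun m : J × Bool => ((n m.1, p m.1), m.2) := fun m m' h => by
      obtain ⟨h1, h2⟩ := Prod.ext_iff.1 h
      exact Prod.ext (hinj h1) h2
    refine Summable.of_nonneg_of_le (fun m => by positivity) (fun m => ?_)
      (summable_mode_bound.comp_injective hi)
    have h1 : (1 : ℝ) ≤ n m.1 := by exact_mod_cast hn m.1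
    have h2 := (hlam m.1).le
    have h3 : (0 : ℝ) ≤ p m.1 := Nat.cast_nonneg _
    simp only [Function.comp_apply]
    set N : ℝ := (n m.1 : ℝ)
    set P : ℝ := (p m.1 : ℝ)
    -- This multiplies `N² ≤ Λ` by `(P + 1)²/2 ≤ 1 + P² ≤ Λ`.
    have h4 : N ^ 2 * ((P + 1) ^ 2 / 2) ≤ lam m.1 ^ 2 := by
      have h5 : N ^ 2 ≤ lam m.1 := by nlinarith
      have h6 : (P + 1) ^ 2 / 2 ≤ lam m.1 := by nlinarith [sq_nonneg (P - 1)]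
      rw [sq (lam m.1)]
      exact mul_le_mul h5 h6 (by positivity) (by nlinarith)
    rw [show (N ^ 2)⁻¹ * (2 * ((P + 1) ^ 2)⁻¹) = (N ^ 2 * ((P + 1) ^ 2 / 2))⁻¹ by
      rw [mul_inv, inv_div]; rfl]
    exact inv_anti₀ (by positivity) h4

end NSChannel

namespace NSChannel

variable {β : ℝ} {ι : Type*} {E : ι → Pt → ℝ} {Λ : ι → ℝ}

/-! ### Convergence of the series -/

theorem ModeFamily.coeff_sub_finsupp (hE : ModeFamily β E Λ) {f : Pt → ℝ}
    (hf : Integrable f volΩ) (L : ι →₀ ℝ) (m : ι) :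
    coeff E (fun p => f p - ∑ m ∈ L.support, L m * E m p) m = coeff E f m - L m := by
  classical
  have e : ∀ p, ∑ m ∈ L.support, L m * E m p = ∑ m ∈ insert m L.support, L m * E m p := fun p =>
    Finset.sum_subset (Finset.subset_insert _ _) fun m' _ h => by
      rw [Finsupp.notMem_support_iff.1 h, zero_mul]
  simp only [e]
  have h := hE.coeff_sum (insert m L.support) L (Finset.mem_insert_self m _)
  rw [coeff] at h ⊢
  have h2 := integrable_of_continuous (hE.continuous_sum (insert m L.support) L)
  simp only [mul_sub]
  rw [integral_sub (hE.integrable_mul m hf) (hE.integrable_mul m h2), h, coeff]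

/-- Convergence of the initial data implies convergence of the decaying series. -/
theorem ModeFamily.tendsto_heatSeries (hE : ModeFamily β E Λ) {f : Pt → ℝ} (hf : MemLp f 2 volΩ)
    {L : ℕ → ι →₀ ℝ}
    (h : Tendsto (fun N => eLpNorm (fun p => f p - ∑ m ∈ (L N).support, L N m * E m p) 2 volΩ)
      atTop (𝓝 0)) {X : Type*} [MeasurableSpace X] {μ : Measure X} [IsFiniteMeasure μ]
    {H : ι → X → ℝ} (hH : ∀ m x, |H m x| ≤ Λ m) {t : ℝ} (ht : 0 < t) :
    Tendsto (fun N => eLpNorm (fun x => heatSeries Λ (coeff E f) H t x -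
      ∑ m ∈ (L N).support, L N m * Real.exp (-Λ m * t) * H m x) 2 μ) atTop (𝓝 0) := by
  have hm : ∀ N, MemLp (fun p => f p - ∑ m ∈ (L N).support, L N m * E m p) 2 volΩ := fun N =>
    hf.sub (memLp_of_continuous (hE.continuous_sum _ _))
  have hd := tendsto_integral_of_tendsto_eLpNorm hm h
  set d : ℕ → ℝ := fun N => ∫ p, (f p - ∑ m ∈ (L N).support, L N m * E m p) *
    (f p - ∑ m ∈ (L N).support, L N m * E m p) ∂volΩ with hdd
  set K := ∑' m, Λ m * Real.exp (-Λ m * t) with hK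
  -- By Bessel's inequality the coefficients of the error are bounded by its `L²` norm, uniformly in
  -- `m`. For `t > 0` the exponentials upgrade this to uniform convergence in `x`.
  have hcd : ∀ N m, |coeff E f m - L N m| ≤ √(d N) := fun N m => by
    have := hE.sq_coeff_le (hm N) m
    rw [hE.coeff_sub_finsupp (hf.integrable one_le_two)] at this
    exact Real.abs_le_sqrt this
  have hcf : ∀ m, |coeff E f m| ≤ √(∫ p, f p * f p ∂volΩ) := fun m =>
    Real.abs_le_sqrt (hE.sq_coeff_le hf m)
  have hb : ∀ N x, |heatSeries Λ (coeff E f) H t x -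
      ∑ m ∈ (L N).support, L N m * Real.exp (-Λ m * t) * H m x| ≤ √(d N) * K := by
    intro N x
    have e : heatSeries Λ (coeff E f) H t x -
        ∑ m ∈ (L N).support, L N m * Real.exp (-Λ m * t) * H m x =
        heatSeries Λ (fun m => coeff E f m - L N m) H t x := by
      have h0 : ∀ m ∉ (L N).support, L N m * Real.exp (-Λ m * t) * H m x = 0 := fun m hm => by
        rw [Finsupp.notMem_support_iff.1 hm, zero_mul, zero_mul]
      rw [← tsum_eq_sum (L := SummationFilter.unconditional ι) h0, heatSeries, heatSeries,
        ← (hE.summable_heat hcf hH ht x).tsum_sub (summable_of_ne_finset_zero h0)]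
      exact tsum_congr fun m => by ring
    rw [e]
    exact hE.abs_heatSeries_le (hcd N) hH ht x
  have hlim : Tendsto (fun N => μ Set.univ ^ (2 : ENNReal).toReal⁻¹ *
      ENNReal.ofReal (√(d N) * K)) atTop (𝓝 0) := by
    have h1 : Tendsto (fun N => √(d N) * K) atTop (𝓝 0) := by
      simpa using (hd.sqrt).mul_const K
    have h2 := ENNReal.tendsto_ofReal h1
    rw [ENNReal.ofReal_zero] at h2
    have h3 : μ Set.univ ^ (2 : ENNReal).toReal⁻¹ ≠ ⊤ :=
      ENNReal.rpow_ne_top_of_nonneg (by simp) (measure_ne_top _ _)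
    simpa using ENNReal.Tendsto.const_mul h2 (Or.inr h3)
  exact tendsto_of_tendsto_of_tendsto_of_le_of_le tendsto_const_nhds hlim (fun N => bot_le)
    fun N => eLpNorm_le_of_ae_bound (Eventually.of_forall fun x => hb N x)

/-- The nonlinearity vanishes for fields in the closed span of the modes. -/
theorem ModeFamily.conv_ae_eq_zero (hE : ModeFamily β E Λ) {u : Field} {G : MField}
    (hu : IsH1 u G)
    (hsq : HasSum (fun m => coeff E (u 0) m ^ 2) (∫ p, u 0 p * u 0 p ∂volΩ))
    (h1 : u 1 =ᵐ[volΩ] 0) (h2 : u 2 =ᵐ[volΩ] 0) (i : Fin 3) : conv u G i =ᵐ[volΩ] 0 := by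
  refine hu.conv_ae_eq_zero (fun φ hφ => ?_) h1 h2 i
  -- Parseval's identity transfers `∂ₓE = 0` from the modes to `u 0`. This covers `t = 0`, where the
  -- gradient is only known abstractly.
  refine (hE.hasSum_coeff_mul (hu.1 0) (memLp_of_continuous (hφ.1.continuous_pd 0)) hsq).unique ?_
  have : ∀ m, coeff E (pd 0 φ) m = 0 := fun m => by
    rw [coeff, integral_mul_pd_of_ne_two (hE.robin m).isTest hφ.1 (by decide)]
    simp [hE.pd_zero]
  simp only [this, mul_zero]
  exact hasSum_zero

theorem ae_eq_prod_of_ae {X : Type*} [MeasurableSpace X] {μ : Measure X} [SFinite μ] {T : ℝ}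
    {f g : ℝ → X → ℝ} (hf : Integrable (fun P : ℝ × X => f P.1 P.2) ((volT T).prod μ))
    (hg : Integrable (fun P : ℝ × X => g P.1 P.2) ((volT T).prod μ))
    (h : ∀ᵐ t ∂volT T, f t =ᵐ[μ] g t) :
    (fun P : ℝ × X => f P.1 P.2) =ᵐ[(volT T).prod μ] fun P => g P.1 P.2 := by
  have := ae_eq_zero_of_ae_ae (hf.sub hg) (h.mono fun t ht => ht.mono fun x hx => by simp [hx])
  exact this.mono fun P hP => sub_eq_zero.1 hP

/-- Two Leray-Hopf solutions that agree have the same pressures up to functions of time. -/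
theorem IsLerayHopf.exists_pressure_eq {T : ℝ} (hT : 0 < T) {v₀ : Field} {v w : ℝ → Field}
    {G Gw : ℝ → MField} {τ τw : ℝ → BField} (hv : IsLerayHopf β T v₀ v G τ)
    (hw : IsLerayHopf β T v₀ w Gw τw) (h0 : IsPressure T v G fun _ _ => 0)
    (h : ∀ᵐ t ∂volT T, ∀ i, w t i =ᵐ[volΩ] v t i) {q : ℝ → Pt → ℝ} (hq : IsPressure T w Gw q) :
    ∃ Q : ℝ → ℝ, ∀ᵐ t ∂volT T, ∀ᵐ p ∂volΩ, q t p = Q t := by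
  refine hq.exists_ae_eq hT fun ψ hψ i =>
    hq.integral_mul_pd_eq_zero h0 hw.memLp hw.memLp_grad (fun i => ?_) (fun i j => ?_) hψ i
  · exact ae_eq_prod_of_ae (f := fun t => w t i) (g := fun t => v t i)
      ((hw.memLp i).integrable one_le_two) ((hv.memLp i).integrable one_le_two)
      (h.mono fun t ht => ht i)
  · refine ae_eq_prod_of_ae (f := fun t => Gw t i j) (g := fun t => G t i j)
      ((hw.memLp_grad i j).integrable one_le_two) ((hv.memLp_grad i j).integrable one_le_two) ?_
    filter_upwards [h, hv.memVP, hw.memVP] with t ht h1 h2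
    exact (h2.2.1.2.2 i j).ae_eq (h1.2.1.2.2 i j) ((h2.2.1.2.1 i j).integrable one_le_two)
      ((h1.2.1.2.1 i j).integrable one_le_two) (ht i)

/-- Combinations of modes give combinations of modes. -/
theorem exists_finsupp_partialSum {γ lam : ℕ → ℝ} {u : ℕ → Field}
    (hrep : ∀ k, ∃ L : ι →₀ ℝ, ∀ t p, Real.exp (-lam k * t) * u k 0 p =
      ∑ m ∈ L.support, L m * Real.exp (-Λ m * t) * E m p) (N : ℕ) :
    ∃ L : ι →₀ ℝ, ∀ t p, partialSum γ lam u N t 0 p =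
      ∑ m ∈ L.support, L m * Real.exp (-Λ m * t) * E m p := by
  induction N with
  | zero => exact ⟨0, fun t p => by simp [partialSum]⟩
  | succ N ih =>
    obtain ⟨L, hL⟩ := ih
    obtain ⟨M, hM⟩ := hrep N
    refine ⟨L + γ N • M, fun t p => ?_⟩
    have h := hL t p
    have h2 := hM t p
    simp only [partialSum] at h ⊢
    rw [Finset.sum_range_succ, h, mul_assoc, h2]
    change L.sum (fun m l => l * Real.exp (-Λ m * t) * E m p) +
      γ N * M.sum (fun m l => l * Real.exp (-Λ m * t) * E m p) =
      (L + γ N • M).sum (fun m l => l * Real.exp (-Λ m * t) * E m p)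
    rw [Finsupp.sum_add_index' (fun m => by simp) (fun m a b => by ring),
      Finsupp.sum_smul_index (fun m => by simp), Finsupp.mul_sum]
    congr 2
    ext m l
    ring_nf

section

variable [Countable ι] {γ lam : ℕ → ℝ} {u : ℕ → Field} {v₀ : Field}

/-- Existence, uniqueness and properties of the solution with initial datum in the closed span of a
family of modes. -/
theorem ModeFamily.exists_solution (hE : ModeFamily β E Λ) (hβ : 0 < β)
    (hrep : ∀ k, ∃ L : ι →₀ ℝ, ∀ t p, Real.exp (-lam k * t) * u k 0 p =
      ∑ m ∈ L.support, L m * Real.exp (-Λ m * t) * E m p)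
    (hu : ∀ k i, i ≠ 0 → u k i = fun _ => 0) (hv₀ : MemVP v₀)
    (hsum : ∀ i, Tendsto (fun N => eLpNorm (fun P => v₀ i P -
      partialSum γ lam u N 0 i P) 2 volΩ) atTop (𝓝 0)) :
    ∃ (v : ℝ → Field) (G : ℝ → MField) (τ : ℝ → BField),
      (∀ t, 0 ≤ t → ∀ i, Tendsto (fun N => eLpNorm (fun P => v t i P -
        partialSum γ lam u N t i P) 2 volΩ) atTop (𝓝 0)) ∧
      (∀ t, 0 < t → ∀ i j, Tendsto (fun N => eLpNorm (fun P => G t i j P -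
        grad (partialSum γ lam u N t) i j P) 2 volΩ) atTop (𝓝 0)) ∧
      (∀ T, 0 < T → IsLerayHopf β T v₀ v G τ) ∧
      (∀ Q₀ T : ℝ, 0 < T → IsPressure T v G fun _ _ => Q₀) ∧
      (∀ t, 0 ≤ t → IsVP (v t) (G t) (τ t)) ∧
      (∃ C : ℝ, ∀ t, 0 ≤ t → normSqVP (v t) (G t) ≤ C) ∧
      (∀ t, 0 ≤ t → ∀ i, conv (v t) (G t) i =ᵐ[volΩ] 0) ∧
      (∀ T, 0 < T → ∀ (w : ℝ → Field) (Gw : ℝ → MField)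
        (τw : ℝ → BField), IsLerayHopf β T v₀ w Gw τw →
          (∀ᵐ t ∂volT T, ∀ i, w t i =ᵐ[volΩ] v t i) ∧
          ∀ q : ℝ → Pt → ℝ, IsPressure T w Gw q →
            ∃ Q : ℝ → ℝ, ∀ᵐ t ∂volT T, ∀ᵐ P ∂volΩ, q t P = Q t) := by
  obtain ⟨G₀, τ₀, hvp⟩ := hv₀
  choose L hL using exists_finsupp_partialSum (γ := γ) hrep
  have hS : ∀ N t i, i ≠ 0 → partialSum γ lam u N t i = fun _ => 0 := fun N t i hi => by
    ext p
    simp [partialSum, hu _ i hi]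
  have hmem := hvp.1.1
  -- The other components of all partial sums vanish, hence so do their `L²` limits.
  have hz : ∀ i, i ≠ 0 → v₀ i =ᵐ[volΩ] 0 := by
    intro i hi
    have h := hsum i
    simp only [hS _ _ i hi, sub_zero] at h
    exact (eLpNorm_eq_zero_iff (hmem i).aestronglyMeasurable two_ne_zero).1
      (tendsto_nhds_unique tendsto_const_nhds h)
  have h1 := hz 1 (by decide)
  have h2 := hz 2 (by decide)
  have hconv : Tendsto (fun N => eLpNorm (fun p => v₀ 0 p - ∑ m ∈ (L N).support, L N m * E m p)
      2 volΩ) atTop (𝓝 0) := by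
    have := hsum 0
    simp only [hL, mul_zero, Real.exp_zero, mul_one] at this
    exact this
  have hsq := hE.tendsto_sum_sq (hmem 0) hconv
  have hip : ip v₀ v₀ = ∫ p, v₀ 0 p * v₀ 0 p ∂volΩ := by
    refine integral_congr_ae ?_
    filter_upwards [h1, h2] with p hp1 hp2
    simp [Fin.sum_univ_three, hp1, hp2]
  have hc : ∀ m, |coeff E (v₀ 0) m| ≤ √(∫ p, v₀ 0 p * v₀ 0 p ∂volΩ) := fun m =>
    Real.abs_le_sqrt (hE.sq_coeff_le (hmem 0) m)
  have hB := fun F => hE.bessel_form hβ F hvp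
  have hvel : ∀ t, 0 < t → (if 0 < t then vel E Λ (coeff E (v₀ 0)) t else v₀) =
      vel E Λ (coeff E (v₀ 0)) t := fun t ht => if_pos ht
  have hgrad : ∀ t, 0 < t → (if 0 < t then velGrad E Λ (coeff E (v₀ 0)) t else G₀) =
      velGrad E Λ (coeff E (v₀ 0)) t := fun t ht => if_pos ht
  have htr : ∀ t, 0 < t → (if 0 < t then velTrace E Λ (coeff E (v₀ 0)) t else τ₀) =
      velTrace E Λ (coeff E (v₀ 0)) t := fun t ht => if_pos ht
  have hLH := fun (T : ℝ) (hT : 0 < T) => hE.isLerayHopf hβ hmem h1 h2 hsq hc hB hvel hgrad htr hT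
  have hpr := fun (Q₀ T : ℝ) (hT : 0 < T) =>
    hE.isPressure hc hvel hgrad hT (hLH T hT).memLp (hLH T hT).memLp_grad Q₀
  -- At `t = 0` the datum itself is taken, with the gradient and trace provided by `v₀ ∈ V_P`; the
  -- series and its derivatives are used only for `t > 0`.
  refine ⟨fun t => if 0 < t then vel E Λ (coeff E (v₀ 0)) t else v₀,
    fun t => if 0 < t then velGrad E Λ (coeff E (v₀ 0)) t else G₀,
    fun t => if 0 < t then velTrace E Λ (coeff E (v₀ 0)) t else τ₀,
    fun t ht i => ?_, fun t ht i j => ?_, hLH, hpr, fun t ht => ?_, ?_, fun t ht i => ?_,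
    fun T hT w Gw τw hw => ?_⟩
  · rcases ht.eq_or_lt with rfl | ht
    · simpa using hsum i
    · simp only [if_pos ht]
      by_cases hi : i = 0
      · subst hi
        simp only [hL]
        exact hE.tendsto_heatSeries (hmem 0) hconv hE.bound' ht
      · simp [vel, scalarField, hi, hS _ _ i hi]
  · simp only [if_pos ht]
    by_cases hi : i = 0
    · subst hi
      have e : ∀ N, grad (partialSum γ lam u N t) 0 j = fun p =>
          ∑ m ∈ (L N).support, L N m * Real.exp (-Λ m * t) * pd j (E m) p := fun N => by
        have h3 : partialSum γ lam u N t 0 = fun p =>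
          ∑ m ∈ (L N).support, L N m * Real.exp (-Λ m * t) * E m p := funext (hL N t)
        ext p
        rw [grad, h3, pd_sum _ fun m _ => ((hE.robin m).isTest.const_mul _).differentiable]
        exact Finset.sum_congr rfl fun m _ => pd_const_mul (hE.robin m).isTest.differentiable _ _ _
      simp only [e]
      exact hE.tendsto_heatSeries (hmem 0) hconv (fun m => hE.bound_pd m j) ht
    · have e : ∀ N, grad (partialSum γ lam u N t) i j = fun _ => 0 := fun N => by
        ext p
        rw [grad, hS N t i hi]
        simp [pd]
      simp [velGrad, scalarGrad, hi, e]
  · rcases ht.eq_or_lt with rfl | ht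
    · simpa using hvp
    · simp only [if_pos ht]
      exact hE.isVP_vel hc ht
  · refine ⟨max (normSqVP v₀ G₀) ((∫ p, v₀ 0 p * v₀ 0 p ∂volΩ) + form β G₀ τ₀ G₀ τ₀),
      fun t ht => ?_⟩
    rcases ht.eq_or_lt with rfl | ht
    · simp
    · simp only [if_pos ht]
      refine le_trans (add_le_add (hE.ip_vel_self_le hc ht fun F => hE.bessel F (hmem 0)) ?_)
        (le_max_right _ _)
      have h3 := hE.form_vel_self_le hc ht hB
      have h4 := ipΓ_self_nonneg (velTrace E Λ (coeff E (v₀ 0)) t)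
      rw [hE.ipM_velGrad]
      rw [form] at h3
      have := mul_nonneg hβ.le h4
      linarith
  · rcases ht.eq_or_lt with rfl | ht
    · simp only [lt_irrefl, if_false]
      exact hE.conv_ae_eq_zero hvp.2.1 hsq h1 h2 i
    · simp only [if_pos ht, hE.conv_vel]
      rfl
  · have hw' : ∀ᵐ t ∂volT T, ∀ i, w t i =ᵐ[volΩ]
        (if 0 < t then vel E Λ (coeff E (v₀ 0)) t else v₀) i := by
      filter_upwards [hw.ae_eq_vel hT hβ hE (hip ▸ hsq) hc hB, ae_volT_mem T] with t ht htm
      rw [if_pos htm.1]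
      exact ht
    exact ⟨hw', fun q hq => (hLH T hT).exists_pressure_eq hT hw (hpr 0 T hT) hw' hq⟩

end

/-- The eigenfunctions with wave number zero in the direction `x` are combinations of two modes. -/
theorem eigenfunction_eq {n p : ℕ} {lam : ℝ} (hβ : 0 < β) (hn : 1 ≤ n)
    (h : IsStokesEigenvalue β 0 n p lam) (a b c d : ℝ) (P : Pt) :
    eigenfunction 0 n p lam a b c d 0 P =
      a / modeScale n p lam true * stokesMode n p lam true P +
      d / modeScale n p lam false * stokesMode n p lam false P := by
  have h1 := (modeScale_pos hβ hn h true).ne'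
  have h2 := (modeScale_pos hβ hn h false).ne'
  simp only [eigenfunction, Matrix.cons_val_zero, profileZ_eq, periodicU, stokesMode]
  field_simp
  simp [osc]
  ring_nf

end NSChannel

/-! ### The proposition for the given sequence of eigenfunctions -/

theorem proposition3p9 (β : ℝ) (hβ : 0 < β)
    -- the indices, eigenvalues and normalized eigenfunctions
    (n p : ℕ → ℕ) (hn : ∀ k, 1 ≤ n k) (lam a b c d : ℕ → ℝ)
    (hlam : ∀ k, NSChannel.IsStokesEigenvalue β 0 (n k) (p k) (lam k))
    (u : ℕ → NSChannel.Field)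
    (hu : ∀ k, u k = NSChannel.eigenfunction 0 (n k) (p k) (lam k) (a k) (b k) (c k) (d k))
    (hnorm : ∀ k, NSChannel.ip (u k) (u k) = 1)
    -- the initial datum `v₀ = ∑ γ_k u_k ∈ V_P`, the series converging in `L²(Ω)`
    (γ : ℕ → ℝ) (hγ : Summable fun k => lam k * γ k ^ 2)
    (v₀ : NSChannel.Field) (hv₀ : NSChannel.MemVP v₀)
    (hsum : ∀ i, Tendsto (fun N => eLpNorm (fun P => v₀ i P -
      NSChannel.partialSum γ lam u N 0 i P) 2 NSChannel.volΩ) atTop (𝓝 0)) :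
    ∃ (v : ℝ → NSChannel.Field) (G : ℝ → NSChannel.MField) (τ : ℝ → NSChannel.BField),
      -- `v(t) = ∑ γ_k exp(-λ_k t) u_k`, in `L²(Ω)` for `t ≥ 0` and in `V_P` for `t > 0`
      (∀ t, 0 ≤ t → ∀ i, Tendsto (fun N => eLpNorm (fun P => v t i P -
        NSChannel.partialSum γ lam u N t i P) 2 NSChannel.volΩ) atTop (𝓝 0)) ∧
      (∀ t, 0 < t → ∀ i j, Tendsto (fun N => eLpNorm (fun P => G t i j P -
        NSChannel.grad (NSChannel.partialSum γ lam u N t) i j P) 2 NSChannel.volΩ)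
          atTop (𝓝 0)) ∧
      -- `v` is a global solution of the Navier-Stokes problem, with any constant pressure
      (∀ T, 0 < T → NSChannel.IsLerayHopf β T v₀ v G τ) ∧
      (∀ Q₀ T : ℝ, 0 < T → NSChannel.IsPressure T v G fun _ _ => Q₀) ∧
      -- `v ∈ L^∞(ℝ⁺; V_P)`
      (∀ t, 0 ≤ t → NSChannel.IsVP (v t) (G t) (τ t)) ∧
      (∃ C : ℝ, ∀ t, 0 ≤ t → NSChannel.normSqVP (v t) (G t) ≤ C) ∧
      -- the nonlinearity vanishes
      (∀ t, 0 ≤ t → ∀ i, NSChannel.conv (v t) (G t) i =ᵐ[NSChannel.volΩ] 0) ∧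
      -- uniqueness on every time interval, the pressure being unique up to constants in space
      (∀ T, 0 < T → ∀ (w : ℝ → NSChannel.Field) (Gw : ℝ → NSChannel.MField)
        (τw : ℝ → NSChannel.BField), NSChannel.IsLerayHopf β T v₀ w Gw τw →
          (∀ᵐ t ∂NSChannel.volT T, ∀ i, w t i =ᵐ[NSChannel.volΩ] v t i) ∧
          ∀ q : ℝ → NSChannel.Pt → ℝ, NSChannel.IsPressure T w Gw q →
            ∃ Q : ℝ → ℝ, ∀ᵐ t ∂NSChannel.volT T, ∀ᵐ P ∂NSChannel.volΩ, q t P = Q t) := by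
  classical
  -- The sequence may repeat a pair `(n, p)` with different coefficients. The orthonormal family is
  -- therefore indexed by the set of pairs that occur, with a representative `κ j` chosen for each.
  have hk : ∀ j : Set.range fun k => (n k, p k), ∃ k, (n k, p k) = j.1 := fun j => j.2
  choose κ hκ using hk
  have hE := NSChannel.modeFamily_stokesMode hβ (n := fun j => n (κ j)) (p := fun j => p (κ j))
    (lam := fun j => lam (κ j)) (fun j j' h => Subtype.ext (by rw [← hκ j, ← hκ j']; exact h))
    (fun j => hn _) fun j => hlam _
  refine hE.exists_solution hβ (fun k => ?_) (fun k i hi => ?_) hv₀ hsum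
  · obtain ⟨e1, e2⟩ := Prod.ext_iff.1 (hκ ⟨(n k, p k), k, rfl⟩)
    simp only at e1 e2
    -- The eigenvalue is determined by the pair, so the representative carries the same one.
    have e3 : lam (κ ⟨(n k, p k), k, rfl⟩) = lam k := by
      have := hlam (κ ⟨(n k, p k), k, rfl⟩)
      rw [e1, e2] at this
      exact this.unique hβ (hlam k)
    -- With wave number zero in `x` the terms with `b` and `c` drop out of the first component; `a`
    -- multiplies the sine mode and `d` the cosine mode.
    refine ⟨Finsupp.single (⟨(n k, p k), k, rfl⟩, true)
        (a k / NSChannel.modeScale (n k) (p k) (lam k) true) +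
      Finsupp.single (⟨(n k, p k), k, rfl⟩, false)
        (d k / NSChannel.modeScale (n k) (p k) (lam k) false), fun t P => ?_⟩
    rw [hu k, NSChannel.eigenfunction_eq hβ (hn k) (hlam k)]
    set j : Set.range fun k => (n k, p k) := ⟨(n k, p k), k, rfl⟩
    change _ = Finsupp.sum _ fun (m : (Set.range fun k => (n k, p k)) × Bool) l =>
      l * Real.exp (-lam (κ m.1) * t) *
        NSChannel.stokesMode (n (κ m.1)) (p (κ m.1)) (lam (κ m.1)) m.2 P
    rw [Finsupp.sum_add_index' (fun m => by simp) (fun m x y => by ring),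
      Finsupp.sum_single_index (by simp), Finsupp.sum_single_index (by simp)]
    simp only [e1, e2, e3]
    ring
  · rw [hu k]
    ext P
    fin_cases i
    · exact absurd rfl hi
    · simp [NSChannel.eigenfunction]
    · simp [NSChannel.eigenfunction]
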